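/- **Setting.** Fix a field $\Bbbk$ and $n\ge 0$. Manifolds are compact, unoriented, piecewise linear (PL), possibly with boundary, possibly empty or disconnected; homeomorphisms are PL. A *gluing map* $\pi:X\to X'$ presents $X'$ as the quotient of $X$ obtained by gluing together two disjoint homeomorphic codimension-zero submanifolds $Y,Y\subset\partial X$ (for $Y=\emptyset$, $\pi$ is a homeomorphism). *Systems of fields.* An $n$-dimensional system of fields $\mathcal F$ enriched over $\Bbbk$-vector spaces assigns to each manifold $X$ of dimension $n-k$, $0\le k\le n$, a set $\mathcal F(X)$, functorially with respect to homeomorphisms, together with: natural restriction maps $\mathcal F(X)\to\mathcal F(\partial X)$; for each $n$-manifold $X$ and $c\in\mathcal F(\partial X)$ a $\Bbbk$-vector space structure on $\mathcal F(X;c)=\{x\in\mathcal F(X): x|_{\partial X}=c\}$, on which homeomorphisms act linearly; an associative, commutative, unital operation of disjoint union $\mathcal F(X_1)\times\mathcal F(X_2)\to\mathcal F(X_1\sqcup X_2)$, compatible with homeomorphisms and boundaries, which is bijective in dimensions $<n$ and induces isomorphisms $\mathcal F(X_1;c_1)\otimes\mathcal F(X_2;c_2)\cong\mathcal F(X_1\sqcup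 X_2;c_1\sqcup c_2)$ in dimension $n$, where $\mathcal F(\emptyset)$ is a point in dimensions $<n$ and $\Bbbk$ in dimension $n$; and, for each gluing map $\pi:X\to X'$ along $Y$, a partially defined map from $\mathcal F(X)$ to $\mathcal F(X')$, defined on those fields whose restriction to $\partial X=Y\cup Y\cup W$ is glued from fields $y\sqcup y\sqcup c$ on $Y\sqcup Y\sqcup W$ (and then the restriction of the result to $\partial X'$ is glued from $c$). Gluing is compatible with homeomorphisms and with disjoint unions (a field $x_1\sqcup x_2$ glues along $\pi_1\sqcup\pi_2$ exactly when each $x_i$ glues along $\pi_i$, the result being the disjoint union of the results), is given by the homeomorphism itself when $\pi$ is a homeomorphism, is injective in dimensions $<n$, and in dimension $n$ is linear and injective on each vector space of fields with fixed boundary condition. *Gluing decompositions.* A gluing decomposition of an $n$-manifold $X$ is a sequence of gluing maps $M_0\to M_1\to\dots\to M_m\cong X$. A field $x$ on $X$ is split along it if there are fields $r_l$ on $M_l$, each $r_{l+1}$ glued from $r_l$, with $r_m$ corresponding to $x$. For a connected component $B$ of $M_l$ which is a ball and a set $U(B)\subset\mathcal F(B)$, "the restriction of $x$ to $B$ lies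 in $U(B)$" means that $r_l$ lies in the linear span of the fields $u\sqcup v$ on $M_l=B\sqcup R$ with $u\in U(B)$, $v\in\mathcal F(R)$, having the same restriction to $\partial M_l$ as $r_l$. *Local relations.* A local relation $U$ assigns to each $n$-ball $B$ a set $U(B)\subset\mathcal F(B)$ such that $U(B)\cap\mathcal F(B;c)$ is a linear subspace for each $c$, $U$ is invariant under homeomorphisms of balls, and $U$ is an ideal with respect to gluing: if $x$ is split along a gluing decomposition, $B,B'$ are ball components of stages of it, the image of $B$ in $X$ is strictly contained in the image of $B'$, and the restriction of $x$ to $B$ lies in $U(B)$, then the restriction of $x$ to $B'$ lies in $U(B')$. *The blob complex.* Let $X$ be an $n$-manifold and $c\in\mathcal F(\partial X)$. A $k$-blob diagram on $X$ with boundary condition $c$ consists of a $k$-tuple $\beta=(\beta_1,\dots,\beta_k)$ of subsets of $X$ (the blobs) and a field $x\in\mathcal F(X;c)$, such that there is a gluing decomposition of $X$, along which $x$ is split, for which each $\beta_i$ is the image of a ball component of some stage, and such that the restriction of $x$ to each twig blob (a blob strictly containing no other blob) lies in $U$. Let $\mathcal D(\beta)\subset\mathcal F(X;c)$ be the span of the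 fields $x$ of blob diagrams with blobs $\beta$. Define $$\mathcal B_k(X;c)=\Big(\bigoplus_{\beta}\mathcal D(\beta)\Big)\Big/\big((\beta\circ\sigma,x)\sim\operatorname{sign}(\sigma)(\beta,x),\ \sigma\in S_k\big),$$ $$\partial(\beta_1,\dots,\beta_k;x)=\sum_{i=1}^{k}(-1)^{i-1}(\beta_1,\dots,\widehat{\beta_i},\dots,\beta_k;x).$$ This is a chain complex $\mathcal B_*(X;c)$ of $\Bbbk$-vector spaces. A homeomorphism $f:X\to X'$ induces a chain map $f_*:\mathcal B_*(X;c)\to\mathcal B_*(X';f_*c)$, $(\beta,x)\mapsto(f(\beta),f_*x)$. **Theorem (disjoint union).** Let $\mathcal F$ be an $n$-dimensional system of fields enriched over $\Bbbk$-vector spaces and $U$ a local relation. For all $n$-manifolds $X_1,X_2$ and boundary conditions $c_1\in\mathcal F(\partial X_1)$, $c_2\in\mathcal F(\partial X_2)$ there is an isomorphism of chain complexes $$\Phi:\ \mathcal B_*(X_1;c_1)\otimes\mathcal B_*(X_2;c_2)\ \xrightarrow{\ \cong\ }\ \mathcal B_*(X_1\sqcup X_2;\,c_1\sqcup c_2),$$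 where the tensor product carries the differential with the Koszul sign, $\partial(b_1\otimes b_2)=\partial b_1\otimes b_2+(-1)^{\deg b_1}b_1\otimes\partial b_2$. It is given by juxtaposition of blob diagrams, the blobs of the first one coming first: $$\Phi\big((\beta,x)\otimes(\beta',x')\big)=(\beta_1,\dots,\beta_k,\beta'_1,\dots,\beta'_{k'};\ x\sqcup x'),$$ and it is natural: for all homeomorphisms $f_i:X_i\to X_i'$ one has $(f_1\sqcup f_2)_*\circ\Phi=\Phi\circ\big((f_1)_*\otimes(f_2)_*\big)$. -/

import Mathlib

open CategoryTheory TensorProduct Topology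

universe u

/-! ## Compact piecewise linear manifolds -/

/-- A convex polyhedron: a finite intersection of closed half-spaces. -/
def IsConvexPolyhedron {E : Type*} [AddCommGroup E] [Module ℝ E] (C : Set E) : Prop :=
  ∃ S : Set (E →ᵃ[ℝ] ℝ), S.Finite ∧ C = {x | ∀ φ ∈ S, φ x ≤ 0}

theorem IsConvexPolyhedron.univ {E : Type*} [AddCommGroup E] [Module ℝ E] :
    IsConvexPolyhedron (Set.univ : Set E) :=
  ⟨∅, Set.finite_empty, by simp⟩

theorem IsConvexPolyhedron.inter {E : Type*} [AddCommGroup E] [Module ℝ E] {C D : Set E}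
    (hC : IsConvexPolyhedron C) (hD : IsConvexPolyhedron D) : IsConvexPolyhedron (C ∩ D) := by
  obtain ⟨S, hS, rfl⟩ := hC
  obtain ⟨T, hT, rfl⟩ := hD
  refine ⟨S ∪ T, hS.union hT, ?_⟩
  ext x
  simp only [Set.mem_inter_iff, Set.mem_ofPred_eq, Set.mem_union]
  constructor
  · rintro ⟨h₁, h₂⟩ φ (h | h)
    · exact h₁ φ h
    · exact h₂ φ h
  · intro h
    exact ⟨fun φ hφ => h φ (Or.inl hφ), fun φ hφ => h φ (Or.inr hφ)⟩

theorem IsConvexPolyhedron.preimage {E F : Type*} [AddCommGroup E] [Module ℝ E]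
    [AddCommGroup F] [Module ℝ F] {C : Set F} (hC : IsConvexPolyhedron C) (A : E →ᵃ[ℝ] F) :
    IsConvexPolyhedron (A ⁻¹' C) := by
  obtain ⟨S, hS, rfl⟩ := hC
  refine ⟨(fun φ : F →ᵃ[ℝ] ℝ => φ.comp A) '' S, hS.image _, ?_⟩
  ext x
  simp

/-- A compact polyhedron: a finite union of compact convex polyhedra. -/
def IsCompactPolyhedron {N : ℕ} (P : Set (Fin N → ℝ)) : Prop :=
  ∃ 𝒞 : Set (Set (Fin N → ℝ)), 𝒞.Finite ∧
    (∀ C ∈ 𝒞, IsConvexPolyhedron C ∧ IsCompact C) ∧ P = ⋃₀ 𝒞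

/-- A piecewise linear map between subsets of real vector spaces: the source is covered by
finitely many closed convex polyhedra, on each of which the map is affine. -/
def IsPL {E F : Type*} [AddCommGroup E] [Module ℝ E] [AddCommGroup F] [Module ℝ F]
    {s : Set E} {t : Set F} (f : s → t) : Prop :=
  ∃ 𝒞 : Set (Set E × (E →ᵃ[ℝ] F)), 𝒞.Finite ∧ (∀ p ∈ 𝒞, IsConvexPolyhedron p.1) ∧
    (∀ x : s, ∃ p ∈ 𝒞, (x : E) ∈ p.1) ∧
    ∀ p ∈ 𝒞, ∀ x : s, (x : E) ∈ p.1 → (f x : F) = p.2 x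

theorem IsPL.id {E : Type*} [AddCommGroup E] [Module ℝ E] (s : Set E) :
    IsPL (fun x : s => x) :=
  ⟨{(Set.univ, AffineMap.id ℝ E)}, Set.finite_singleton _,
    by simpa using IsConvexPolyhedron.univ, by simp, by simp⟩

theorem IsPL.comp {E F G : Type*} [AddCommGroup E] [Module ℝ E] [AddCommGroup F] [Module ℝ F]
    [AddCommGroup G] [Module ℝ G] {s : Set E} {t : Set F} {w : Set G} {g : t → w} {f : s → t}
    (hg : IsPL g) (hf : IsPL f) : IsPL (fun x => g (f x)) := by
  obtain ⟨𝒟, hfin', hpoly', hcov', haff'⟩ := hg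
  obtain ⟨𝒞, hfin, hpoly, hcov, haff⟩ := hf
  refine ⟨Set.image2 (fun p q => (p.1 ∩ p.2 ⁻¹' q.1, q.2.comp p.2)) 𝒞 𝒟,
    hfin.image2 _ hfin', ?_, ?_, ?_⟩
  · rintro _ ⟨p, hp, q, hq, rfl⟩
    exact (hpoly p hp).inter ((hpoly' q hq).preimage p.2)
  · intro x
    obtain ⟨p, hp, hxp⟩ := hcov x
    obtain ⟨q, hq, hxq⟩ := hcov' (f x)
    refine ⟨_, ⟨p, hp, q, hq, rfl⟩, hxp, ?_⟩
    rw [Set.mem_preimage, ← haff p hp x hxp]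
    exact hxq
  · rintro _ ⟨p, hp, q, hq, rfl⟩ x ⟨hxp, hxq⟩
    rw [Set.mem_preimage, ← haff p hp x hxp] at hxq
    simp [haff' q hq (f x) hxq, haff p hp x hxp]

/-- A piecewise linear homeomorphism. -/
structure PLHomeo {E F : Type*} [AddCommGroup E] [Module ℝ E] [AddCommGroup F] [Module ℝ F]
    (s : Set E) (t : Set F) extends s ≃ t where
  isPL : IsPL toFun
  isPL_symm : IsPL invFun

namespace PLHomeo

variable {E F G : Type*} [AddCommGroup E] [Module ℝ E] [AddCommGroup F] [Module ℝ F]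
  [AddCommGroup G] [Module ℝ G] {s : Set E} {t : Set F} {w : Set G}

instance : CoeFun (PLHomeo s t) (fun _ => s → t) := ⟨fun f => f.toFun⟩

/-- The identity. -/
def refl (s : Set E) : PLHomeo s s where
  toEquiv := Equiv.refl _
  isPL := IsPL.id s
  isPL_symm := IsPL.id s

/-- The composite of `f`, followed by `g`. -/
def trans (f : PLHomeo s t) (g : PLHomeo t w) : PLHomeo s w where
  toEquiv := f.toEquiv.trans g.toEquiv
  isPL := g.isPL.comp f.isPL
  isPL_symm := f.isPL_symm.comp g.isPL_symm

end PLHomeo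

/-- The standard piecewise linear ball `[0,1]^m`. -/
def unitCube (m : ℕ) : Set (Fin m → ℝ) := Set.Icc 0 1

/-- A compact (unoriented) piecewise linear manifold of dimension `d`, possibly with boundary,
possibly empty or disconnected, realised as a compact polyhedron: every point has a neighbourhood
which is a piecewise linear `d`-ball. For `d < 0` the only one is empty. -/
structure PLManifold (d : ℤ) where
  N : ℕ
  carrier : Set (Fin N → ℝ)
  isCompactPolyhedron : IsCompactPolyhedron carrier
  locally_ball : ∀ x ∈ carrier, 0 ≤ d ∧
    ∃ V ⊆ carrier, V ∈ 𝓝[carrier] x ∧ Nonempty (PLHomeo V (unitCube d.toNat))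

instance {d : ℤ} : CoeSort (PLManifold d) Type := ⟨fun X => X.carrier⟩

namespace PLManifold

variable {d e : ℤ}

/-- Piecewise linear homeomorphisms of manifolds. -/
abbrev Homeo (X X' : PLManifold d) := PLHomeo X.carrier X'.carrier

/-- `X` is a `d`-ball. -/
def IsBall (X : PLManifold d) : Prop :=
  0 ≤ d ∧ Nonempty (PLHomeo X.carrier (unitCube d.toNat))

/-- `x` is an interior point: it is interior to a ball neighbourhood. -/
def IsInteriorPoint (X : PLManifold d) (x : X) : Prop :=
  ∃ V ⊆ X.carrier, V ∈ 𝓝[X.carrier] (x : Fin X.N → ℝ) ∧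
    ∃ (h : PLHomeo V (unitCube d.toNat)) (hx : (x : Fin X.N → ℝ) ∈ V),
      (h ⟨x, hx⟩ : Fin d.toNat → ℝ) ∈ interior (unitCube d.toNat)

/-- The set of boundary points of `X`. -/
def boundary (X : PLManifold d) : Set X := {x | ¬ X.IsInteriorPoint x}

end PLManifold

/-- A presentation of the manifold `Z` as the boundary of the manifold `X`. -/
structure BoundaryOf {d e : ℤ} (Z : PLManifold e) (X : PLManifold d) where
  incl : Z → X
  isPL : IsPL incl
  injective : Function.Injective incl
  range_eq : Set.range incl = X.boundary

/-- A presentation of `X` as the disjoint union of `X₁` and `X₂`. -/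
structure DisjointUnion {d : ℤ} (X₁ X₂ X : PLManifold d) where
  inl : X₁ → X
  inr : X₂ → X
  isPL_inl : IsPL inl
  isPL_inr : IsPL inr
  injective_inl : Function.Injective inl
  injective_inr : Function.Injective inr
  isCompl : IsCompl (Set.range inl) (Set.range inr)

/-- `π : X → X'` presents `X'` as the manifold obtained from `X` by gluing together two disjoint
codimension zero submanifolds `a(Y)`, `b(Y)` of the boundary of `X` by means of `b ∘ a⁻¹`. -/
structure IsGluing {d e : ℤ} {Y : PLManifold e} {X X' : PLManifold d}
    (a b : Y → X) (π : X → X') : Prop where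
  dim : e + 1 = d
  isPL_left : IsPL a
  isPL_right : IsPL b
  injective_left : Function.Injective a
  injective_right : Function.Injective b
  left_mem : ∀ y, a y ∈ X.boundary
  right_mem : ∀ y, b y ∈ X.boundary
  disjoint : Disjoint (Set.range a) (Set.range b)
  isPL : IsPL π
  surjective : Function.Surjective π
  eq_iff : ∀ x x', π x = π x' ↔
    x = x' ∨ ∃ y, (x = a y ∧ x' = b y) ∨ (x = b y ∧ x' = a y)

/-- `π : X → X'` is obtained by gluing some disjoint pair of homeomorphic codimension zero
submanifolds of the boundary of `X`. -/
def IsGluingMap {d : ℤ} {X X' : PLManifold d} (π : X → X') : Prop :=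
  ∃ (e : ℤ) (Y : PLManifold e) (a b : Y → X), IsGluing a b π

/-- The effect on boundaries of gluing `X` to itself along two copies of `Y` (with corners):
the boundary `Z` of `X` is obtained from `(Y ⊔ Y) ⊔ W` by the gluing `q` of `∂(Y ⊔ Y)` to `∂W`,
and the boundary `Z'` of the glued manifold `X'` is obtained from `W` by the gluing `q'` along
the two copies of `∂Y`. -/
structure GluingBoundary {d e : ℤ} {X X' : PLManifold d} (π : X → X')
    (Y W YY P Z Z' : PLManifold e) where
  a : Y → X
  b : Y → X
  isGluing : IsGluing a b π
  bdry : BoundaryOf Z X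
  bdry' : BoundaryOf Z' X'
  double : DisjointUnion Y Y YY
  pieces : DisjointUnion YY W P
  q : P → Z
  isGluingMap_q : IsGluingMap q
  q' : W → Z'
  isGluingMap_q' : IsGluingMap q'
  left_eq : ∀ y, bdry.incl (q (pieces.inl (double.inl y))) = a y
  right_eq : ∀ y, bdry.incl (q (pieces.inl (double.inr y))) = b y
  injective_rest : Function.Injective (fun w => q (pieces.inr w))
  rest_eq : ∀ w, bdry'.incl (q' w) = π (bdry.incl (q (pieces.inr w)))

/-! ## Systems of fields, enriched over vector spaces -/

/-- Compact manifolds of codimension `k` in dimension `n`, that is, of dimension `n - k`. -/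
abbrev Mfd (n k : ℕ) := PLManifold ((n : ℤ) - (k : ℤ))

/-- The operations of an `n`-dimensional system of fields. `Fld k X` is the set of fields on the
manifold `X` of dimension `n - k` (for `k > n` only the empty manifold occurs). -/
structure FieldData (n : ℕ) where
  /-- the fields on a manifold -/
  Fld : ∀ k : ℕ, Mfd n k → Type u
  /-- the action of homeomorphisms -/
  map : ∀ {k : ℕ} {X X' : Mfd n k}, X.Homeo X' → Fld k X → Fld k X'
  /-- restriction to the boundary -/
  res : ∀ {k : ℕ} {Z : Mfd n (k + 1)} {X : Mfd n k}, BoundaryOf Z X → Fld k X → Fld (k + 1) Z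
  /-- the disjoint union of two fields -/
  union : ∀ {k : ℕ} {X₁ X₂ X : Mfd n k}, DisjointUnion X₁ X₂ X → Fld k X₁ → Fld k X₂ → Fld k X
  /-- the trivial field on an empty manifold -/
  unit : ∀ {k : ℕ} (X : Mfd n k), IsEmpty X → Fld k X
  /-- `Glue π x x'`: the field `x` can be glued along the gluing map `π`, with result `x'` -/
  Glue : ∀ {k : ℕ} {X X' : Mfd n k}, (X → X') → Fld k X → Fld k X' → Prop

/-- The set of top-dimensional fields on `X` with boundary condition `c`. -/
def FieldData.Fiber {n : ℕ} (S : FieldData.{u} n) {Z : Mfd n 1} {X : Mfd n 0}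
    (ζ : BoundaryOf Z X) (c : S.Fld 1 Z) : Type u :=
  {x : S.Fld 0 X // S.res ζ x = c}

/-- The field `x` as an element of the set of fields with the boundary condition of `x`. -/
def FieldData.toFiber {n : ℕ} (S : FieldData.{u} n) {Z : Mfd n 1} {X : Mfd n 0}
    (ζ : BoundaryOf Z X) (x : S.Fld 0 X) : S.Fiber ζ (S.res ζ x) :=
  ⟨x, rfl⟩

/-- An `n`-dimensional system of fields enriched over vector spaces. Clauses which play no role
for the blob complex (existence of product fields, of sufficiently many splittings, and
surjectivity of gluing up to isotopy and collars) are not imposed. -/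
structure SystemOfFields (𝕜 : Type u) [Field 𝕜] (n : ℕ) extends FieldData.{u} n where
  /-- top-dimensional fields with a fixed boundary condition form a vector space -/
  [addCommGroup : ∀ {Z : Mfd n 1} {X : Mfd n 0} (ζ : BoundaryOf Z X) (c : Fld 1 Z),
    AddCommGroup (toFieldData.Fiber ζ c)]
  [module : ∀ {Z : Mfd n 1} {X : Mfd n 0} (ζ : BoundaryOf Z X) (c : Fld 1 Z),
    Module 𝕜 (toFieldData.Fiber ζ c)]
  -- functoriality
  map_refl : ∀ {k : ℕ} {X : Mfd n k} (x : Fld k X), map (PLHomeo.refl X.carrier) x = x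
  map_trans : ∀ {k : ℕ} {X X' X'' : Mfd n k} (f : X.Homeo X') (g : X'.Homeo X'') (x : Fld k X),
    map (f.trans g) x = map g (map f x)
  -- restriction to the boundary is natural
  res_map : ∀ {k : ℕ} {Z Z' : Mfd n (k + 1)} {X X' : Mfd n k} (ζ : BoundaryOf Z X)
    (ζ' : BoundaryOf Z' X') (f : X.Homeo X') (g : Z.Homeo Z'),
    (∀ z, f (ζ.incl z) = ζ'.incl (g z)) → ∀ x, res ζ' (map f x) = map g (res ζ x)
  map_linear : ∀ {Z Z' : Mfd n 1} {X X' : Mfd n 0} (ζ : BoundaryOf Z X)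
    (ζ' : BoundaryOf Z' X') (f : X.Homeo X') (g : Z.Homeo Z'),
    (∀ z, f (ζ.incl z) = ζ'.incl (g z)) → ∀ c : Fld 1 Z,
    ∃ L : toFieldData.Fiber ζ c →ₗ[𝕜] toFieldData.Fiber ζ' (map g c),
      ∀ x, (L x).1 = map f x.1
  -- disjoint unions: compatibility with homeomorphisms and boundaries, symmetry, associativity
  map_union : ∀ {k : ℕ} {X₁ X₂ X X₁' X₂' X' : Mfd n k} (J : DisjointUnion X₁ X₂ X)
    (J' : DisjointUnion X₁' X₂' X') (f₁ : X₁.Homeo X₁') (f₂ : X₂.Homeo X₂') (f : X.Homeo X'),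
    (∀ x, f (J.inl x) = J'.inl (f₁ x)) → (∀ x, f (J.inr x) = J'.inr (f₂ x)) →
    ∀ x₁ x₂, map f (union J x₁ x₂) = union J' (map f₁ x₁) (map f₂ x₂)
  res_union : ∀ {k : ℕ} {X₁ X₂ X : Mfd n k} {Z₁ Z₂ Z : Mfd n (k + 1)} (J : DisjointUnion X₁ X₂ X)
    (J' : DisjointUnion Z₁ Z₂ Z) (ζ₁ : BoundaryOf Z₁ X₁) (ζ₂ : BoundaryOf Z₂ X₂)
    (ζ : BoundaryOf Z X), (∀ z, ζ.incl (J'.inl z) = J.inl (ζ₁.incl z)) →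
    (∀ z, ζ.incl (J'.inr z) = J.inr (ζ₂.incl z)) →
    ∀ x₁ x₂, res ζ (union J x₁ x₂) = union J' (res ζ₁ x₁) (res ζ₂ x₂)
  union_comm : ∀ {k : ℕ} {X₁ X₂ X : Mfd n k} (J : DisjointUnion X₁ X₂ X)
    (J' : DisjointUnion X₂ X₁ X), J'.inl = J.inr → J'.inr = J.inl →
    ∀ x₁ x₂, union J' x₂ x₁ = union J x₁ x₂
  union_assoc : ∀ {k : ℕ} {X₁ X₂ X₃ X₁₂ X₂₃ X : Mfd n k} (J₁₂ : DisjointUnion X₁ X₂ X₁₂)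
    (J : DisjointUnion X₁₂ X₃ X) (J₂₃ : DisjointUnion X₂ X₃ X₂₃) (J' : DisjointUnion X₁ X₂₃ X),
    (∀ x, J.inl (J₁₂.inl x) = J'.inl x) → (∀ x, J.inl (J₁₂.inr x) = J'.inr (J₂₃.inl x)) →
    (∀ x, J.inr x = J'.inr (J₂₃.inr x)) →
    ∀ x₁ x₂ x₃, union J (union J₁₂ x₁ x₂) x₃ = union J' x₁ (union J₂₃ x₂ x₃)
  unit_union : ∀ {k : ℕ} {X₁ X₂ X : Mfd n k} (J : DisjointUnion X₁ X₂ X) (h : IsEmpty X₁)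
    (f : X₂.Homeo X), (∀ x, f x = J.inr x) → ∀ x, union J (unit X₁ h) x = map f x
  -- below the top dimension, disjoint unions go to products (and the empty manifold to a point)
  union_bijective : ∀ {k : ℕ} {X₁ X₂ X : Mfd n (k + 1)} (J : DisjointUnion X₁ X₂ X),
    Function.Bijective (fun p : Fld (k + 1) X₁ × Fld (k + 1) X₂ => union J p.1 p.2)
  eq_unit : ∀ {k : ℕ} {X : Mfd n (k + 1)} (h : IsEmpty X) (x : Fld (k + 1) X), x = unit X h
  -- in the top dimension, disjoint unions go to tensor products (and the empty manifold to `𝕜`)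
  union_tensor : ∀ {X₁ X₂ X : Mfd n 0} {Z₁ Z₂ Z : Mfd n 1} (J : DisjointUnion X₁ X₂ X)
    (J' : DisjointUnion Z₁ Z₂ Z) (ζ₁ : BoundaryOf Z₁ X₁) (ζ₂ : BoundaryOf Z₂ X₂)
    (ζ : BoundaryOf Z X), (∀ z, ζ.incl (J'.inl z) = J.inl (ζ₁.incl z)) →
    (∀ z, ζ.incl (J'.inr z) = J.inr (ζ₂.incl z)) → ∀ (c₁ : Fld 1 Z₁) (c₂ : Fld 1 Z₂),
    ∃ L : toFieldData.Fiber ζ₁ c₁ ⊗[𝕜] toFieldData.Fiber ζ₂ c₂ ≃ₗ[𝕜]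
        toFieldData.Fiber ζ (union J' c₁ c₂),
      ∀ x₁ x₂, (L (x₁ ⊗ₜ[𝕜] x₂)).1 = union J x₁.1 x₂.1
  unit_bijective : ∀ {Z : Mfd n 1} {X : Mfd n 0} (ζ : BoundaryOf Z X) (h : IsEmpty X),
    Function.Bijective (fun t : 𝕜 => t • toFieldData.toFiber ζ (unit X h))
  -- gluing is a partially defined map; its domain consists of the fields whose boundary is
  -- glued from `y ⊔ y ⊔ c`, and the boundary of the glued field is then glued from `c`
  glue_unique : ∀ {k : ℕ} {X X' : Mfd n k} {π : X → X'}, IsGluingMap π →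
    ∀ {x : Fld k X} {x₁' x₂' : Fld k X'}, Glue π x x₁' → Glue π x x₂' → x₁' = x₂'
  glue_domain : ∀ {k : ℕ} {X X' : Mfd n k} {π : X → X'} {Y W YY P Z Z' : Mfd n (k + 1)}
    (G : GluingBoundary π Y W YY P Z Z') (x : Fld k X),
    (∃ x', Glue π x x') ↔
      ∃ y c, Glue G.q (union G.pieces (union G.double y y) c) (res G.bdry x)
  glue_res : ∀ {k : ℕ} {X X' : Mfd n k} {π : X → X'} {Y W YY P Z Z' : Mfd n (k + 1)}
    (G : GluingBoundary π Y W YY P Z Z') (x : Fld k X) (x' : Fld k X')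
    (y : Fld (k + 1) Y) (c : Fld (k + 1) W), Glue π x x' →
    Glue G.q (union G.pieces (union G.double y y) c) (res G.bdry x) →
    Glue G.q' c (res G.bdry' x')
  -- compatibility of gluing with homeomorphisms and with disjoint unions
  glue_map : ∀ {k : ℕ} {X₁ X₁' X₂ X₂' : Mfd n k} {π₁ : X₁ → X₁'} {π₂ : X₂ → X₂'}
    (f : X₁.Homeo X₂) (f' : X₁'.Homeo X₂'), IsGluingMap π₁ → IsGluingMap π₂ →
    (∀ x, f' (π₁ x) = π₂ (f x)) →
    ∀ x x', Glue π₁ x x' → Glue π₂ (map f x) (map f' x')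
  glue_homeo : ∀ {k : ℕ} {X X' : Mfd n k} (f : X.Homeo X') (x : Fld k X) (x' : Fld k X'),
    Glue f x x' ↔ x' = map f x
  glue_union : ∀ {k : ℕ} {X₁ X₂ X X₁' X₂' X' : Mfd n k} (J : DisjointUnion X₁ X₂ X)
    (J' : DisjointUnion X₁' X₂' X') {π₁ : X₁ → X₁'} {π₂ : X₂ → X₂'} {π : X → X'},
    IsGluingMap π₁ → IsGluingMap π₂ → IsGluingMap π →
    (∀ x, π (J.inl x) = J'.inl (π₁ x)) → (∀ x, π (J.inr x) = J'.inr (π₂ x)) →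
    ∀ x₁ x₂ x', Glue π (union J x₁ x₂) x' ↔
      ∃ x₁' x₂', Glue π₁ x₁ x₁' ∧ Glue π₂ x₂ x₂' ∧ x' = union J' x₁' x₂'
  -- gluing is injective below the top dimension, and is linear and injective on each vector
  -- space of top-dimensional fields with a fixed boundary condition
  glue_injective : ∀ {k : ℕ} {X X' : Mfd n (k + 1)} {π : X → X'}, IsGluingMap π →
    ∀ {x₁ x₂ : Fld (k + 1) X} {x' : Fld (k + 1) X'}, Glue π x₁ x' → Glue π x₂ x' → x₁ = x₂
  glue_linear : ∀ {Z Z' : Mfd n 1} {X X' : Mfd n 0} (ζ : BoundaryOf Z X)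
    (ζ' : BoundaryOf Z' X') {π : X → X'}, IsGluingMap π →
    ∀ (x₀ : Fld 0 X) (x₀' : Fld 0 X'), Glue π x₀ x₀' →
      ∃ L : toFieldData.Fiber ζ (res ζ x₀) →ₗ[𝕜] toFieldData.Fiber ζ' (res ζ' x₀'),
        Function.Injective L ∧ ∀ x, Glue π x.1 (L x).1

attribute [instance] SystemOfFields.addCommGroup SystemOfFields.module

/-! ## Gluing decompositions and local relations -/

/-- A gluing decomposition `M 0 → M 1 → ⋯ → M m = X`, together with the boundaries of the
manifolds `M l` and the maps `toX l : M l → X`. Only the terms with `l ≤ m` matter. -/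
structure GluingDecomposition {n : ℕ} (X : Mfd n 0) where
  m : ℕ
  M : ℕ → Mfd n 0
  bdryM : ℕ → Mfd n 1
  bdry : ∀ l, BoundaryOf (bdryM l) (M l)
  π : ∀ l, M l → M (l + 1)
  isGluingMap : ∀ l < m, IsGluingMap (π l)
  top : (M m).Homeo X
  toX : ∀ l, M l → X
  toX_top : ∀ x, toX m x = top x
  toX_step : ∀ l < m, ∀ x, toX (l + 1) (π l x) = toX l x

/-- A connected component of `M` which is a ball. -/
structure BallComponent {n : ℕ} (M : Mfd n 0) where
  B : Mfd n 0
  rest : Mfd n 0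
  sum : DisjointUnion B rest M
  isBall : B.IsBall

/-- The image in `X` of a ball component of a stage of a gluing decomposition. -/
def GluingDecomposition.image {n : ℕ} {X : Mfd n 0} (D : GluingDecomposition X) (l : ℕ)
    (C : BallComponent (D.M l)) : Set X :=
  Set.range (fun b => D.toX l (C.sum.inl b))

section Blob

variable {𝕜 : Type u} [Field 𝕜] {n : ℕ}

/-- `r` is a sequence of fields on the stages of `D`, each one glued from the preceding one, which
splits the field `x` along `D`. -/
structure GluingDecomposition.Splits (S : SystemOfFields 𝕜 n) {X : Mfd n 0}
    (D : GluingDecomposition X) (r : ∀ l, S.Fld 0 (D.M l)) (x : S.Fld 0 X) : Prop where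
  glue : ∀ l < D.m, S.Glue (D.π l) (r l) (r (l + 1))
  top : S.map D.top (r D.m) = x

/-- The restriction of the field `x` on `M` to the component `C` lies in `U`: with the boundary
condition of `x` fixed, `x` lies in the image of `U(B) ⊗ Fld(rest)` in the fields on
`M = B ⊔ rest`. -/
def RestrictsInto (S : SystemOfFields 𝕜 n) (U : ∀ B : Mfd n 0, Set (S.Fld 0 B))
    {Z : Mfd n 1} {M : Mfd n 0} (ζ : BoundaryOf Z M) (C : BallComponent M) (x : S.Fld 0 M) :
    Prop :=
  S.toFiber ζ x ∈
    Submodule.span 𝕜 {y : S.Fiber ζ (S.res ζ x) | ∃ u ∈ U C.B, ∃ v, y.1 = S.union C.sum u v}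

/-- A local relation. The ideal property is stated for iterated gluings: if a field is split along
a gluing decomposition, a ball `B` of one stage is strictly contained in a ball `B'` of another
stage (as subsets of the glued manifold), and the restriction to `B` is a local relation, then so
is the restriction to `B'`. (Invariance under extended isotopy is not imposed.) -/
structure LocalRelation (S : SystemOfFields 𝕜 n) where
  U : ∀ B : Mfd n 0, Set (S.Fld 0 B)
  subspace : ∀ {B : Mfd n 0}, B.IsBall → ∀ {Z : Mfd n 1} (ζ : BoundaryOf Z B) (c : S.Fld 1 Z),
    ∃ W : Submodule 𝕜 (S.Fiber ζ c), ∀ x, x ∈ W ↔ x.1 ∈ U B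
  map_mem_iff : ∀ {B B' : Mfd n 0}, B.IsBall → ∀ (f : B.Homeo B') (x : S.Fld 0 B),
    S.map f x ∈ U B' ↔ x ∈ U B
  ideal : ∀ {X : Mfd n 0} (D : GluingDecomposition X) (r : ∀ l, S.Fld 0 (D.M l))
    (x : S.Fld 0 X), D.Splits S r x →
    ∀ l ≤ D.m, ∀ l' ≤ D.m, ∀ (C : BallComponent (D.M l)) (C' : BallComponent (D.M l')),
    D.image l C ⊂ D.image l' C' →
    RestrictsInto S U (D.bdry l) C (r l) → RestrictsInto S U (D.bdry l') C' (r l')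

/-! ## The blob complex -/

/-- A compact `n`-manifold together with its boundary. -/
structure BMfd (n : ℕ) where
  X : Mfd n 0
  Z : Mfd n 1
  bdry : BoundaryOf Z X

/-- A homeomorphism, together with its restriction to the boundary. -/
structure BMfd.Homeo (X X' : BMfd n) where
  f : X.X.Homeo X'.X
  g : X.Z.Homeo X'.Z
  comm : ∀ z, f (X.bdry.incl z) = X'.bdry.incl (g z)

/-- A disjoint union, together with the induced decomposition of the boundary. -/
structure BMfd.DisjointUnion (X₁ X₂ X : BMfd n) where
  sum : _root_.DisjointUnion X₁.X X₂.X X.X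
  sumBdry : _root_.DisjointUnion X₁.Z X₂.Z X.Z
  inl_comm : ∀ z, X.bdry.incl (sumBdry.inl z) = sum.inl (X₁.bdry.incl z)
  inr_comm : ∀ z, X.bdry.incl (sumBdry.inr z) = sum.inr (X₂.bdry.incl z)

variable {S : SystemOfFields 𝕜 n} (U : LocalRelation S)

/-- `(β, x)` is a `k`-blob diagram on `X`: there is a gluing decomposition of `X` along which `x`
splits, each blob `β i` is the image of a component of one of its stages which is a ball, and for
each twig blob (one which contains no other blob strictly) the restriction of `x` to that ball is
a local relation. -/
def IsBlobDiagram {X : Mfd n 0} {k : ℕ} (β : Fin k → Set X) (x : S.Fld 0 X) : Prop :=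
  ∃ (D : GluingDecomposition X) (r : ∀ l, S.Fld 0 (D.M l)), D.Splits S r x ∧
    ∀ i, ∃ l ≤ D.m, ∃ C : BallComponent (D.M l), D.image l C = β i ∧
      ((∀ j, ¬ β j ⊂ β i) → RestrictsInto S U.U (D.bdry l) C (r l))

/-- Forgetting a blob of a blob diagram gives a blob diagram. -/
theorem IsBlobDiagram.forget {X : Mfd n 0} {k : ℕ} {β : Fin (k + 1) → Set X} {x : S.Fld 0 X}
    (h : IsBlobDiagram U β x) (i : Fin (k + 1)) : IsBlobDiagram U (β ∘ i.succAbove) x := by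
  obtain ⟨D, r, hr, hβ⟩ := h
  refine ⟨D, r, hr, fun j => ?_⟩
  obtain ⟨l, hl, C, hC, hU⟩ := hβ (i.succAbove j)
  refine ⟨l, hl, C, hC, fun hj => ?_⟩
  by_cases htwig : ∀ s, ¬ β s ⊂ β (i.succAbove j)
  · exact hU htwig
  have key : ∀ s, β s ⊂ β (i.succAbove j) → s = i := by
    intro s hs
    by_contra hne
    obtain ⟨t, rfl⟩ := Fin.exists_succAbove_eq hne
    exact hj t hs
  push Not at htwig
  obtain ⟨s, hs⟩ := htwig
  obtain rfl := key s hs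
  obtain ⟨l₁, hl₁, C₁, hC₁, hU₁⟩ := hβ s
  refine U.ideal D r x hr l₁ hl₁ l hl C₁ C (by rw [hC₁, hC]; exact hs) (hU₁ fun t ht => ?_)
  obtain rfl := key t (ht.trans hs)
  exact (ssubset_irrefl _) ht

/-- The vector space spanned by the `k`-blob diagrams with configuration of blobs `β` on the
manifold `X` with boundary condition `c`. -/
def blobSpace (X : BMfd n) (c : S.Fld 1 X.Z) {k : ℕ} (β : Fin k → Set X.X) :
    Submodule 𝕜 (S.Fiber X.bdry c) :=
  Submodule.span 𝕜 {x | IsBlobDiagram U β x.1}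

/-- The direct sum of the spaces of `k`-blob diagrams over all (ordered) configurations of `k`
blobs, realised as finitely supported families. -/
noncomputable def orderedBlobs (X : BMfd n) (c : S.Fld 1 X.Z) (k : ℕ) :
    Submodule 𝕜 ((Fin k → Set X.X) →₀ S.Fiber X.bdry c) where
  carrier := {f | ∀ β, f β ∈ blobSpace U X c β}
  zero_mem' _ := zero_mem _
  add_mem' hf hg β := add_mem (hf β) (hg β)
  smul_mem' t _ hf β := Submodule.smul_mem _ t (hf β)

theorem single_mem_orderedBlobs {X : BMfd n} {c : S.Fld 1 X.Z} {k : ℕ} {β : Fin k → Set X.X}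
    {x : S.Fiber X.bdry c} (hx : x ∈ blobSpace U X c β) :
    Finsupp.single β x ∈ orderedBlobs U X c k := by
  intro γ
  by_cases h : β = γ
  · subst h
    rwa [Finsupp.single_eq_same]
  · rw [Finsupp.single_eq_of_ne (Ne.symm h)]
    exact zero_mem _

theorem orderedBlobs_le_comap {X : BMfd n} {c : S.Fld 1 X.Z} {k : ℕ} {M : Type*}
    [AddCommGroup M] [Module 𝕜 M] (T : ((Fin k → Set X.X) →₀ S.Fiber X.bdry c) →ₗ[𝕜] M)
    (Q : Submodule 𝕜 M)
    (h : ∀ β, ∀ x ∈ blobSpace U X c β, T (Finsupp.single β x) ∈ Q) :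
    ∀ f ∈ orderedBlobs U X c k, T f ∈ Q := by
  intro f hf
  rw [← f.sum_single, Finsupp.sum, map_sum]
  exact sum_mem fun β _ => h β _ (hf β)

/-- The relations: a permutation of the blobs is identified with the sign of the permutation. -/
noncomputable def permutationRelations (X : BMfd n) (c : S.Fld 1 X.Z) (k : ℕ) :
    Submodule 𝕜 ((Fin k → Set X.X) →₀ S.Fiber X.bdry c) :=
  Submodule.span 𝕜 {f | ∃ (σ : Equiv.Perm (Fin k)) (β : Fin k → Set X.X),
    ∃ x ∈ blobSpace U X c β,
      f = Finsupp.single (β ∘ σ) x - ((Equiv.Perm.sign σ : ℤ) : 𝕜) • Finsupp.single β x}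

/-- The `k`-th vector space of the blob complex. -/
abbrev BlobModule (X : BMfd n) (c : S.Fld 1 X.Z) (k : ℕ) : Type u :=
  orderedBlobs U X c k ⧸ (permutationRelations U X c k).comap (orderedBlobs U X c k).subtype

/-- The element of the blob complex given by a configuration `β` and an element of the space of
blob diagrams with that configuration. -/
noncomputable def blobClass (X : BMfd n) (c : S.Fld 1 X.Z) {k : ℕ} (β : Fin k → Set X.X)
    (x : S.Fiber X.bdry c) (hx : x ∈ blobSpace U X c β) : BlobModule U X c k :=
  Submodule.Quotient.mk ⟨Finsupp.single β x, single_mem_orderedBlobs U hx⟩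

/-- A linear map of families which preserves blob diagrams and the permutation relations descends
to the blob complex. -/
noncomputable def BlobModule.lift {X X' : BMfd n} {c : S.Fld 1 X.Z} {c' : S.Fld 1 X'.Z}
    {k k' : ℕ} (T : ((Fin k → Set X.X) →₀ S.Fiber X.bdry c) →ₗ[𝕜]
      ((Fin k' → Set X'.X) →₀ S.Fiber X'.bdry c'))
    (h₁ : ∀ f ∈ orderedBlobs U X c k, T f ∈ orderedBlobs U X' c' k')
    (h₂ : ∀ f ∈ permutationRelations U X c k, T f ∈ permutationRelations U X' c' k') :
    BlobModule U X c k →ₗ[𝕜] BlobModule U X' c' k' :=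
  Submodule.mapQ _ _ (T.restrict h₁) (fun f hf => h₂ f.1 hf)

/-- The alternating sum of the ways of forgetting one blob. -/
noncomputable def forgetSum (X : BMfd n) (c : S.Fld 1 X.Z) (k : ℕ) :
    ((Fin (k + 1) → Set X.X) →₀ S.Fiber X.bdry c) →ₗ[𝕜]
      ((Fin k → Set X.X) →₀ S.Fiber X.bdry c) :=
  ∑ i : Fin (k + 1), ((-1 : 𝕜) ^ (i : ℕ)) •
    Finsupp.lmapDomain (S.Fiber X.bdry c) 𝕜 (fun β => β ∘ i.succAbove)

theorem forgetSum_single (X : BMfd n) (c : S.Fld 1 X.Z) (k : ℕ) (β : Fin (k + 1) → Set X.X)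
    (x : S.Fiber X.bdry c) :
    forgetSum X c k (Finsupp.single β x) =
      ∑ i : Fin (k + 1), ((-1 : 𝕜) ^ (i : ℕ)) • Finsupp.single (β ∘ i.succAbove) x := by
  simp [forgetSum, LinearMap.sum_apply, Finsupp.mapDomain_single]

theorem blobSpace_forget {X : BMfd n} {c : S.Fld 1 X.Z} {k : ℕ} {β : Fin (k + 1) → Set X.X}
    {x : S.Fiber X.bdry c} (hx : x ∈ blobSpace U X c β) (i : Fin (k + 1)) :
    x ∈ blobSpace U X c (β ∘ i.succAbove) :=
  Submodule.span_mono (fun _ hy => IsBlobDiagram.forget U hy i) hx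

theorem forgetSum_mem_orderedBlobs (X : BMfd n) (c : S.Fld 1 X.Z) (k : ℕ) :
    ∀ f ∈ orderedBlobs U X c (k + 1), forgetSum X c k f ∈ orderedBlobs U X c k := by
  refine orderedBlobs_le_comap U _ _ fun β x hx => ?_
  rw [forgetSum_single]
  exact sum_mem fun i _ => Submodule.smul_mem _ _
    (single_mem_orderedBlobs U (blobSpace_forget U hx i))

/-- A permutation restricts to the complements of `i` and `σ i`. -/
theorem exists_perm_succAbove {k : ℕ} (σ : Equiv.Perm (Fin (k + 1))) (i : Fin (k + 1)) :
    ∃ τ : Equiv.Perm (Fin k), (∀ j, σ (i.succAbove j) = (σ i).succAbove (τ j)) ∧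
      Equiv.Perm.sign σ = (-1) ^ ((σ i : ℕ) + (i : ℕ)) * Equiv.Perm.sign τ := by
  obtain ⟨⟨p, τ⟩, hρ⟩ := Equiv.Perm.decomposeFin.symm.surjective
    ((σ i).cycleRange * σ * i.cycleRange⁻¹)
  have h0 : p = 0 := by
    have := congrArg (fun e : Equiv.Perm (Fin (k + 1)) => e 0) hρ
    simpa [Equiv.Perm.mul_apply, Equiv.Perm.inv_def] using this
  subst h0
  refine ⟨τ, fun j => ?_, ?_⟩
  · have := congrArg (fun e : Equiv.Perm (Fin (k + 1)) => e j.succ) hρ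
    simp only [Equiv.Perm.decomposeFin_symm_apply_succ, Equiv.swap_self, Equiv.refl_apply,
      Equiv.Perm.mul_apply, Equiv.Perm.inv_def, Fin.cycleRange_symm_succ] at this
    apply (σ i).cycleRange.injective
    rw [← this, Fin.cycleRange_succAbove]
  · have := congrArg Equiv.Perm.sign hρ
    rw [Equiv.Perm.decomposeFin.symm_sign, if_pos rfl, one_mul] at this
    rw [this]
    simp only [map_mul, map_inv, Fin.sign_cycleRange, pow_add]
    rcases Nat.even_or_odd (i : ℕ) with hi | hi <;>
      rcases Nat.even_or_odd (σ i : ℕ) with hj | hj <;> simp [hi.neg_one_pow, hj.neg_one_pow]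

theorem forgetSum_mem_permutationRelations (X : BMfd n) (c : S.Fld 1 X.Z) (k : ℕ) :
    ∀ f ∈ permutationRelations U X c (k + 1),
      forgetSum X c k f ∈ permutationRelations U X c k := by
  intro f hf
  induction hf using Submodule.span_induction with
  | zero => simp
  | add f g _ _ hf hg => rw [map_add]; exact add_mem hf hg
  | smul t f _ hf => rw [map_smul]; exact Submodule.smul_mem _ _ hf
  | mem f hf =>
    obtain ⟨σ, β, x, hx, rfl⟩ := hf
    rw [map_sub, map_smul, forgetSum_single, forgetSum_single, Finset.smul_sum,
      ← Equiv.sum_comp σ (fun i => ((Equiv.Perm.sign σ : ℤ) : 𝕜) • _ • _),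
      ← Finset.sum_sub_distrib]
    refine sum_mem fun i _ => ?_
    obtain ⟨τ, hτ, hsign⟩ := exists_perm_succAbove σ i
    have hcomp : (β ∘ σ) ∘ i.succAbove = (β ∘ (σ i).succAbove) ∘ τ := by
      funext j
      simp [hτ]
    have hs : ((Equiv.Perm.sign σ : ℤ) : 𝕜) * (-1) ^ (σ i : ℕ) =
        (-1) ^ (i : ℕ) * ((Equiv.Perm.sign τ : ℤ) : 𝕜) := by
      rw [hsign]
      push_cast
      rw [pow_add]
      have : ((-1 : 𝕜) ^ (σ i : ℕ)) * (-1) ^ (σ i : ℕ) = 1 := by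
        rw [← mul_pow]; simp
      linear_combination ((-1 : 𝕜) ^ (i : ℕ) * ((Equiv.Perm.sign τ : ℤ) : 𝕜)) * this
    rw [smul_smul, hs, hcomp, ← smul_smul, ← smul_sub]
    exact Submodule.smul_mem _ _ (Submodule.subset_span
      ⟨τ, _, x, blobSpace_forget U hx (σ i), rfl⟩)

theorem forgetSum_forgetSum (X : BMfd n) (c : S.Fld 1 X.Z) (k : ℕ)
    (f : (Fin (k + 2) → Set X.X) →₀ S.Fiber X.bdry c) :
    forgetSum X c k (forgetSum X c (k + 1) f) = 0 := by
  induction f using Finsupp.induction_linear with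
  | zero => simp
  | add f g hf hg => simp [hf, hg]
  | single β x =>
    rw [forgetSum_single, map_sum]
    simp only [map_smul, forgetSum_single, Finset.smul_sum, smul_smul, ← pow_add]
    rw [← Finset.sum_product', Finset.univ_product_univ]
    refine Finset.sum_involution
      (fun p _ => (p.1.succAbove p.2, p.2.predAbove p.1)) ?_ ?_ ?_ ?_
    · rintro ⟨i, j⟩ -
      have : (β ∘ (i.succAbove j).succAbove) ∘ (j.predAbove i).succAbove =
          (β ∘ i.succAbove) ∘ j.succAbove := by
        funext t
        simp [Fin.succAbove_succAbove_succAbove_predAbove]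
      dsimp only
      rw [this, Fin.neg_one_pow_succAbove_add_predAbove, neg_smul, add_neg_cancel]
    · rintro ⟨i, j⟩ - - h
      exact Fin.succAbove_ne i j (congrArg Prod.fst h)
    · simp
    · rintro ⟨i, j⟩ -
      have h : (j.predAbove i).predAbove (i.succAbove j) = j := by
        apply Fin.succAbove_right_injective (p := i)
        have h₁ := Fin.succAbove_succAbove_predAbove (i.succAbove j) (j.predAbove i)
        rwa [Fin.succAbove_succAbove_predAbove i j] at h₁
      simp [Fin.succAbove_succAbove_predAbove, h]

/-- The differential of the blob complex. -/
noncomputable def blobD (X : BMfd n) (c : S.Fld 1 X.Z) (k : ℕ) :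
    BlobModule U X c (k + 1) →ₗ[𝕜] BlobModule U X c k :=
  BlobModule.lift U (forgetSum X c k) (forgetSum_mem_orderedBlobs U X c k)
    (forgetSum_mem_permutationRelations U X c k)

theorem blobD_blobD (X : BMfd n) (c : S.Fld 1 X.Z) (k : ℕ) (y : BlobModule U X c (k + 2)) :
    blobD U X c k (blobD U X c (k + 1) y) = 0 := by
  obtain ⟨f, rfl⟩ := Submodule.Quotient.mk_surjective _ y
  refine (Submodule.Quotient.mk_eq_zero _).2 ?_
  change forgetSum X c k (forgetSum X c (k + 1) f.1) ∈ permutationRelations U X c k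
  rw [forgetSum_forgetSum]
  exact zero_mem _

/-- The blob complex of the manifold `X` with boundary condition `c`. -/
noncomputable def blobComplex (X : BMfd n) (c : S.Fld 1 X.Z) : ChainComplex (ModuleCat.{u} 𝕜) ℕ :=
  ChainComplex.of (fun k => ModuleCat.of 𝕜 (BlobModule U X c k))
    (fun k => ModuleCat.ofHom (blobD U X c k))
    (fun k => ModuleCat.hom_ext (LinearMap.ext fun y => blobD_blobD U X c k y))

theorem blobComplex_d (X : BMfd n) (c : S.Fld 1 X.Z) (k : ℕ) :
    (blobComplex U X c).d (k + 1) k = ModuleCat.ofHom (blobD U X c k) :=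
  ChainComplex.of_d (fun k => ModuleCat.of 𝕜 (BlobModule U X c k))
    (fun k => ModuleCat.ofHom (blobD U X c k)) k

/-! ### Functoriality with respect to homeomorphisms -/

theorem IsBlobDiagram.map {X X' : Mfd n 0} (f : X.Homeo X') {k : ℕ} {β : Fin k → Set X}
    {x : S.Fld 0 X} (h : IsBlobDiagram U β x) :
    IsBlobDiagram U (fun i => f '' β i) (S.map f x) := by
  obtain ⟨D, r, hr, hβ⟩ := h
  refine ⟨{ D with
      top := D.top.trans f
      toX := fun l y => f (D.toX l y)
      toX_top := fun y => congrArg f (D.toX_top y)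
      toX_step := fun l hl y => congrArg f (D.toX_step l hl y) }, r,
    ⟨hr.glue, by rw [← hr.top]; exact S.map_trans _ _ _⟩, fun i => ?_⟩
  obtain ⟨l, hl, C, hC, hU⟩ := hβ i
  refine ⟨l, hl, C, ?_, fun hi => hU fun j hj => hi j ?_⟩
  · refine Eq.trans ?_ (congrArg (fun B => f '' B) hC)
    exact Set.range_comp f (fun b => D.toX l (C.sum.inl b))
  · exact f.toEquiv.injective.image_strictMono hj

theorem exists_fiberMap {X X' : BMfd n} (F : X.Homeo X') {c : S.Fld 1 X.Z} {c' : S.Fld 1 X'.Z}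
    (hc : S.map F.g c = c') :
    ∃ L : S.Fiber X.bdry c →ₗ[𝕜] S.Fiber X'.bdry c', ∀ x, (L x).1 = S.map F.f x.1 := by
  subst hc
  exact S.map_linear X.bdry X'.bdry F.f F.g F.comm c

/-- The action of a homeomorphism on fields with fixed boundary condition. -/
noncomputable def fiberMap {X X' : BMfd n} (F : X.Homeo X') {c : S.Fld 1 X.Z}
    {c' : S.Fld 1 X'.Z} (hc : S.map F.g c = c') :
    S.Fiber X.bdry c →ₗ[𝕜] S.Fiber X'.bdry c' :=
  (exists_fiberMap F hc).choose

theorem fiberMap_val {X X' : BMfd n} (F : X.Homeo X') {c : S.Fld 1 X.Z} {c' : S.Fld 1 X'.Z}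
    (hc : S.map F.g c = c') (x : S.Fiber X.bdry c) : (fiberMap F hc x).1 = S.map F.f x.1 :=
  (exists_fiberMap F hc).choose_spec x

/-- The action of a homeomorphism on families of fields indexed by configurations. -/
noncomputable def familyMap {X X' : BMfd n} (F : X.Homeo X') {c : S.Fld 1 X.Z}
    {c' : S.Fld 1 X'.Z} (hc : S.map F.g c = c') (k : ℕ) :
    ((Fin k → Set X.X) →₀ S.Fiber X.bdry c) →ₗ[𝕜]
      ((Fin k → Set X'.X) →₀ S.Fiber X'.bdry c') :=
  Finsupp.lmapDomain _ 𝕜 (fun β i => F.f '' β i) ∘ₗ Finsupp.mapRange.linearMap (fiberMap F hc)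

theorem familyMap_single {X X' : BMfd n} (F : X.Homeo X') {c : S.Fld 1 X.Z}
    {c' : S.Fld 1 X'.Z} (hc : S.map F.g c = c') (k : ℕ)
    (β : Fin k → Set X.X) (x : S.Fiber X.bdry c) :
    familyMap F hc k (Finsupp.single β x) =
      Finsupp.single (fun i => F.f '' β i) (fiberMap F hc x) := by
  simp [familyMap, Finsupp.mapDomain_single]

theorem fiberMap_mem_blobSpace {X X' : BMfd n} (F : X.Homeo X') {c : S.Fld 1 X.Z}
    {c' : S.Fld 1 X'.Z} (hc : S.map F.g c = c') {k : ℕ}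
    {β : Fin k → Set X.X} {x : S.Fiber X.bdry c} (hx : x ∈ blobSpace U X c β) :
    fiberMap F hc x ∈ blobSpace U X' c' (fun i => F.f '' β i) := by
  have : blobSpace U X c β ≤
      (blobSpace U X' c' (fun i => F.f '' β i)).comap (fiberMap F hc) := by
    refine Submodule.span_le.2 fun y hy => Submodule.subset_span ?_
    change IsBlobDiagram U _ (fiberMap F hc y).1
    rw [fiberMap_val]
    exact IsBlobDiagram.map U F.f hy
  exact this hx

theorem familyMap_mem_permutationRelations {X X' : BMfd n} (F : X.Homeo X') {c : S.Fld 1 X.Z}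
    {c' : S.Fld 1 X'.Z} (hc : S.map F.g c = c')
    (k : ℕ) : ∀ f ∈ permutationRelations U X c k,
      familyMap F hc k f ∈ permutationRelations U X' c' k := by
  intro f hf
  induction hf using Submodule.span_induction with
  | zero => simp
  | add f g _ _ hf hg => rw [map_add]; exact add_mem hf hg
  | smul t f _ hf => rw [map_smul]; exact Submodule.smul_mem _ _ hf
  | mem f hf =>
    obtain ⟨σ, β, x, hx, rfl⟩ := hf
    rw [map_sub, map_smul, familyMap_single, familyMap_single]
    exact Submodule.subset_span ⟨σ, _, _, fiberMap_mem_blobSpace U F hc hx, rfl⟩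

/-- The map of blob spaces induced by a homeomorphism. -/
noncomputable def blobModuleMap {X X' : BMfd n} (F : X.Homeo X') {c : S.Fld 1 X.Z}
    {c' : S.Fld 1 X'.Z} (hc : S.map F.g c = c') (k : ℕ) :
    BlobModule U X c k →ₗ[𝕜] BlobModule U X' c' k :=
  BlobModule.lift U (familyMap F hc k)
    (orderedBlobs_le_comap U _ _ fun β x hx => by
      rw [familyMap_single]
      exact single_mem_orderedBlobs U (fiberMap_mem_blobSpace U F hc hx))
    (familyMap_mem_permutationRelations U F hc k)

theorem blobModuleMap_blobD {X X' : BMfd n} (F : X.Homeo X') {c : S.Fld 1 X.Z}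
    {c' : S.Fld 1 X'.Z} (hc : S.map F.g c = c') (k : ℕ)
    (y : BlobModule U X c (k + 1)) :
    blobD U X' c' k (blobModuleMap U F hc (k + 1) y) =
      blobModuleMap U F hc k (blobD U X c k y) := by
  have key : forgetSum X' c' k ∘ₗ familyMap F hc (k + 1) =
      familyMap F hc k ∘ₗ forgetSum X c k := by
    refine Finsupp.lhom_ext fun β x => ?_
    simp only [LinearMap.comp_apply, familyMap_single, forgetSum_single, map_sum, map_smul]
    rfl
  obtain ⟨f, rfl⟩ := Submodule.Quotient.mk_surjective _ y
  exact congrArg Submodule.Quotient.mk (Subtype.ext (LinearMap.congr_fun key f.1))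

/-- The chain map induced by a homeomorphism: it acts on blobs by taking images and on fields by
the given action of homeomorphisms on fields. -/
noncomputable def blobMap {X X' : BMfd n} (F : X.Homeo X') {c : S.Fld 1 X.Z}
    {c' : S.Fld 1 X'.Z} (hc : S.map F.g c = c') :
    blobComplex U X c ⟶ blobComplex U X' c' :=
  ChainComplex.ofHom (fun k => ModuleCat.ofHom (blobModuleMap U F hc k)) fun k => by
    refine (congrArg (_ ≫ ·) (blobComplex_d U X' c' k)).trans
      (Eq.trans ?_ (congrArg (· ≫ _) (blobComplex_d U X c k)).symm)
    exact ModuleCat.hom_ext (LinearMap.ext fun y => blobModuleMap_blobD U F hc k y)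

end Blob

/-! ## Polyhedra and piecewise linear maps -/

/-! A blob is the image of a ball, so it is connected and nonempty and lies in exactly one of the
two clopen parts of `X₁ ⊔ X₂`. Hence the blobs of a diagram can be permuted so that those in `X₁`
come first, and two such orderings differ by a permutation inside each block. Up to the sign
relations, degree `k` therefore splits into pieces indexed by `p + q = k`, and the theorem reduces
to one statement about a fixed pair of configurations `α`, `β`: under the isomorphism of fields on
`X₁ ⊔ X₂` with the tensor product, the space spanned by diagrams with blobs `α ⊔ β` is the tensor
product of the spaces for `α` and for `β`.

One inclusion is `IsBlobDiagram.union`: glue up `X₁` while `X₂` stays at its initial stage, then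
glue up `X₂`.

The other inclusion, `IsBlobDiagram.mem_span_fiberUnion`, is the core. A gluing decomposition of `X₁
⊔ X₂` splits stage by stage over the two parts, and gluing with fixed boundary conditions becomes a
tensor product of injective linear maps (`exists_glueLinear_union`). The field on a stage is only a
sum of pure tensors, so its restriction to a part makes no sense directly. Instead it is contracted
with linear forms on the other factor. If the field restricts into `U` on a ball in one part, all of
its slices do (`BallComponent.exists_restrict`). Since forms extend along injections, the conditions
at all twig blobs become conditions on slices of the initial tensor: its left slices lie in a
subspace `T₁`, its right slices in `T₂`. Then the tensor lies in the span of the `t ⊗ t'` with `t ∈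
T₁`, `t' ∈ T₂` (`mem_span_tmul_of_tensorSlice_mem`), and each such `t` and `t'` glues up to a blob
diagram on its own part.

The inverse of juxtaposition sorts the blobs, records the sign and decomposes the field;
`unjuxtTerm_eq` makes it independent of the sorting. The Koszul sign appears because a blob of the
second block is preceded by all the blobs of the first. The geometric input is that clopen parts of
manifolds are manifolds, that disjoint unions exist, and that boundaries and gluing maps are
compatible with both; it rests on connectedness of balls and on `IsPL.exists_factor`, which inverts
injective piecewise linear maps. -/

namespace IsConvexPolyhedron

theorem isClosed {N : ℕ} {C : Set (Fin N → ℝ)} (hC : IsConvexPolyhedron C) : IsClosed C := by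
  obtain ⟨S, -, rfl⟩ := hC
  simp only [Set.ofPred_forall]
  exact isClosed_biInter fun φ _ =>
    isClosed_le (AffineMap.continuous_of_finiteDimensional φ) continuous_const

theorem convex {E : Type*} [AddCommGroup E] [Module ℝ E] {C : Set E}
    (hC : IsConvexPolyhedron C) : Convex ℝ C := by
  obtain ⟨S, -, rfl⟩ := hC
  simp only [Set.ofPred_forall]
  exact convex_iInter₂ fun φ _ => (convex_Iic (0 : ℝ)).affine_preimage φ

theorem setOf_affine_eq_zero {E : Type*} [AddCommGroup E] [Module ℝ E] {N : ℕ}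
    (T : E →ᵃ[ℝ] (Fin N → ℝ)) : IsConvexPolyhedron {x | T x = 0} := by
  let φ : Fin N → E →ᵃ[ℝ] ℝ := fun i => (LinearMap.proj i).toAffineMap.comp T
  refine ⟨Set.range φ ∪ Set.range (fun i => -φ i),
    (Set.finite_range _).union (Set.finite_range _), ?_⟩
  ext x
  constructor
  · rintro hx ψ (⟨i, rfl⟩ | ⟨i, rfl⟩)
    · simp [φ, show T x = 0 from hx]
    · simp [φ, show T x = 0 from hx]
  · intro hx
    funext i
    have h₁ := hx (φ i) (Or.inl ⟨i, rfl⟩)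
    have h₂ := hx (-φ i) (Or.inr ⟨i, rfl⟩)
    simp only [φ, AffineMap.coe_neg, Pi.neg_apply, AffineMap.comp_apply, LinearMap.coe_toAffineMap,
      LinearMap.proj_apply] at h₁ h₂
    simp only [Pi.zero_apply]
    linarith

/-- The image is cut out by affine conditions: `B y` lies in `C`, and `y` is fixed by `A ∘ B`. -/
theorem image_affine {N M : ℕ} {C : Set (Fin N → ℝ)} (hC : IsConvexPolyhedron C)
    (A : (Fin N → ℝ) →ᵃ[ℝ] (Fin M → ℝ)) (B : (Fin M → ℝ) →ᵃ[ℝ] (Fin N → ℝ))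
    (hB : ∀ x, B (A x) = x) : IsConvexPolyhedron (A '' C) := by
  convert (hC.preimage B).inter
    (setOf_affine_eq_zero (A.comp B - AffineMap.id ℝ (Fin M → ℝ))) using 1
  ext y
  constructor
  · rintro ⟨x, hx, rfl⟩
    refine ⟨?_, by simp [hB]⟩
    change B (A x) ∈ C
    rwa [hB]
  · rintro ⟨hy, hfix⟩
    exact ⟨B y, hy, by simpa [sub_eq_zero] using hfix⟩

end IsConvexPolyhedron

/-- The span of the differences of elements of a convex set consists of multiples of
differences. -/
theorem Convex.exists_smul_sub_eq {E : Type*} [AddCommGroup E] [Module ℝ E] {C : Set E}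
    (hC : Convex ℝ C) {x₀ : E} (hx₀ : x₀ ∈ C) {w : E}
    (hw : w ∈ Submodule.span ℝ ((fun x => x - x₀) '' C)) :
    ∃ t : ℝ, 0 ≤ t ∧ ∃ x ∈ C, ∃ y ∈ C, w = t • (x - y) := by
  induction hw using Submodule.span_induction with
  | zero => exact ⟨0, le_rfl, x₀, hx₀, x₀, hx₀, by simp⟩
  | mem w hw =>
    obtain ⟨x, hx, rfl⟩ := hw
    exact ⟨1, zero_le_one, x, hx, x₀, hx₀, by simp⟩
  | smul a w _ hw =>
    obtain ⟨t, ht, x, hx, y, hy, rfl⟩ := hw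
    rcases le_total 0 a with ha | ha
    · exact ⟨a * t, mul_nonneg ha ht, x, hx, y, hy, by rw [smul_smul]⟩
    · refine ⟨-a * t, mul_nonneg (neg_nonneg.2 ha) ht, y, hy, x, hx, ?_⟩
      module
  | add v w _ _ hv hw =>
    obtain ⟨t, ht, x, hx, y, hy, rfl⟩ := hv
    obtain ⟨t', ht', x', hx', y', hy', rfl⟩ := hw
    rcases (add_nonneg ht ht').eq_or_lt with h | h
    · have h₁ : t = 0 := by linarith
      have h₂ : t' = 0 := by linarith
      exact ⟨0, le_rfl, x₀, hx₀, x₀, hx₀, by simp [h₁, h₂]⟩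
    -- The sum is `t + t'` times the difference of two convex combinations, both with weights `t /
    -- (t + t')` and `t' / (t + t')`.
    · have hsum : t / (t + t') + t' / (t + t') = 1 := by field_simp
      refine ⟨t + t', h.le, _, hC hx hx' (div_nonneg ht h.le) (div_nonneg ht' h.le) hsum,
        _, hC hy hy' (div_nonneg ht h.le) (div_nonneg ht' h.le) hsum, ?_⟩
      have h₁ : (t + t') * (t / (t + t')) = t := by field_simp
      have h₂ : (t + t') * (t' / (t + t')) = t' := by field_simp
      simp only [smul_sub, smul_add, smul_smul, h₁, h₂]
      abel

/-- An affine map which is injective on a convex set has an affine left inverse there. -/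
theorem AffineMap.exists_leftInvOn {E F : Type*} [AddCommGroup E] [Module ℝ E]
    [AddCommGroup F] [Module ℝ F] {C : Set E} (hC : Convex ℝ C) (A : E →ᵃ[ℝ] F)
    (hA : Set.InjOn A C) : ∃ B : F →ᵃ[ℝ] E, ∀ x ∈ C, B (A x) = x := by
  rcases C.eq_empty_or_nonempty with rfl | ⟨x₀, hx₀⟩
  · exact ⟨AffineMap.const ℝ F 0, by simp⟩
  have hlin : ∀ x y, A.linear (x - y) = A x - A y := fun x y => by
    simpa using A.linearMap_vsub x y
  let W := Submodule.span ℝ ((fun x => x - x₀) '' C)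
  -- Every vector of `W` is a multiple of a difference of two points of `C`, so injectivity of `A`
  -- on `C` alone makes its linear part injective on `W`.
  have hker : LinearMap.ker (A.linear.domRestrict W) = ⊥ := by
    refine LinearMap.ker_eq_bot'.2 fun ⟨w, hw⟩ h => ?_
    obtain ⟨t, -, x, hx, y, hy, rfl⟩ := hC.exists_smul_sub_eq hx₀ hw
    have h' : t • (A x - A y) = 0 := by simpa [hlin] using h
    rcases smul_eq_zero.1 h' with h₀ | h₀
    · simp [h₀]
    · simp [hA hx hy (sub_eq_zero.1 h₀)]
  obtain ⟨g, hg⟩ := LinearMap.exists_leftInverse_of_injective _ hker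
  let L : F →ₗ[ℝ] E := W.subtype ∘ₗ g
  refine ⟨L.toAffineMap + AffineMap.const ℝ F (x₀ - L (A x₀)), fun x hx => ?_⟩
  have hW : x - x₀ ∈ W := Submodule.subset_span ⟨x, hx, rfl⟩
  have : L (A x - A x₀) = x - x₀ := by
    rw [← hlin]
    exact congrArg Subtype.val (LinearMap.congr_fun hg ⟨_, hW⟩)
  rw [map_sub] at this
  simp only [AffineMap.coe_add, Pi.add_apply, LinearMap.coe_toAffineMap, AffineMap.const_apply]
  rw [add_sub_left_comm, this]
  abel

namespace IsCompactPolyhedron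

variable {N : ℕ} {P : Set (Fin N → ℝ)}

theorem isCompact (hP : IsCompactPolyhedron P) : IsCompact P := by
  obtain ⟨𝒞, hfin, h𝒞, rfl⟩ := hP
  exact hfin.isCompact_sUnion fun C hC => (h𝒞 C hC).2

theorem empty : IsCompactPolyhedron (∅ : Set (Fin N → ℝ)) :=
  ⟨∅, Set.finite_empty, by simp, by simp⟩

end IsCompactPolyhedron

/-- A preconnected subset of a subspace lies in a clopen set as soon as it meets it. -/
theorem IsPreconnected.subset_isClopen_subtype {T : Type*} [TopologicalSpace T] {P C : Set T}
    (hC : IsPreconnected C) (hCP : C ⊆ P) {A : Set P} (hA : IsClopen A) {x : P} (hx : x ∈ A)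
    (hxC : (x : T) ∈ C) : ∀ y : P, (y : T) ∈ C → y ∈ A := by
  have hpre : IsPreconnected (Subtype.val ⁻¹' C : Set P) := by
    refine Topology.IsInducing.subtypeVal.isPreconnected_image.1 ?_
    rwa [Subtype.image_preimage_coe, Set.inter_eq_right.2 hCP]
  exact fun y hy => hpre.subset_isClopen hA ⟨x, hxC, hx⟩ hy

/-- A clopen subset of a compact polyhedron is a compact polyhedron. -/
theorem IsCompactPolyhedron.isClopen {N : ℕ} {P : Set (Fin N → ℝ)} (hP : IsCompactPolyhedron P)
    {A : Set P} (hA : IsClopen A) : IsCompactPolyhedron (Subtype.val '' A) := by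
  obtain ⟨𝒞, hfin, h𝒞, hP⟩ := hP
  -- Convex cells are connected, so a cell which meets `A` is contained in it; these cells cover
  -- `A`.
  refine ⟨{C ∈ 𝒞 | C ⊆ Subtype.val '' A}, hfin.subset fun C hC => hC.1,
    fun C hC => h𝒞 C hC.1, Set.Subset.antisymm ?_ (Set.sUnion_subset fun C hC => hC.2)⟩
  rintro _ ⟨x, hx, rfl⟩
  have hxP : (x : Fin N → ℝ) ∈ ⋃₀ 𝒞 := hP ▸ x.2
  obtain ⟨C, hC, hxC⟩ := hxP
  have hCP : C ⊆ P := hP ▸ Set.subset_sUnion_of_mem hC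
  exact ⟨C, ⟨hC, fun y hy => ⟨⟨y, hCP hy⟩,
    (h𝒞 C hC).1.convex.isPreconnected.subset_isClopen_subtype hCP hA hx hxC _ hy, rfl⟩⟩, hxC⟩

namespace IsPL

/-- Affine maps in finite dimension are continuous, and they paste along a finite closed cover. -/
theorem continuous {N M : ℕ} {s : Set (Fin N → ℝ)} {t : Set (Fin M → ℝ)} {f : s → t}
    (hf : IsPL f) : Continuous f := by
  obtain ⟨𝒞, hfin, hpoly, hcov, haff⟩ := hf
  have := hfin.to_subtype
  refine continuous_induced_rng.2 ((locallyFinite_of_finite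
    (fun p : 𝒞 => (Subtype.val ⁻¹' p.1.1 : Set s))).continuous ?_ ?_ ?_)
  · refine Set.eq_univ_of_forall fun x => ?_
    obtain ⟨p, hp, hx⟩ := hcov x
    exact Set.mem_iUnion.2 ⟨⟨p, hp⟩, hx⟩
  · exact fun p => (hpoly _ p.2).isClosed.preimage continuous_subtype_val
  · intro p
    refine ContinuousOn.congr (f := fun x : s => p.1.2 x) ?_ fun x hx => haff _ p.2 x hx
    exact ((AffineMap.continuous_of_finiteDimensional p.1.2).comp
      continuous_subtype_val).continuousOn

/-- The restriction of a piecewise linear map to smaller source and target. -/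
theorem restrict {E F : Type*} [AddCommGroup E] [Module ℝ E] [AddCommGroup F] [Module ℝ F]
    {s s' : Set E} {t t' : Set F} {f : s → t} (hf : IsPL f) {g : s' → t'} (φ : s' → s)
    (hφ : ∀ x, (φ x : E) = x) (hg : ∀ x, (g x : F) = f (φ x)) : IsPL g := by
  obtain ⟨𝒞, hfin, hpoly, hcov, haff⟩ := hf
  refine ⟨𝒞, hfin, hpoly, fun x => ?_, fun p hp x hx => ?_⟩
  · obtain ⟨p, hp, hx⟩ := hcov (φ x)
    exact ⟨p, hp, by rwa [hφ] at hx⟩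
  · rw [hg, haff p hp (φ x) (by rwa [hφ]), hφ]

theorem of_affine {E F : Type*} [AddCommGroup E] [Module ℝ E] [AddCommGroup F] [Module ℝ F]
    {s : Set E} {t : Set F} {f : s → t} (A : E →ᵃ[ℝ] F) (h : ∀ x, (f x : F) = A x) : IsPL f :=
  ⟨{(Set.univ, A)}, Set.finite_singleton _, by simpa using IsConvexPolyhedron.univ, by simp,
    by simpa using h⟩

theorem of_isEmpty {E F : Type*} [AddCommGroup E] [Module ℝ E] [AddCommGroup F] [Module ℝ F]
    {s : Set E} {t : Set F} [IsEmpty s] (f : s → t) : IsPL f :=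
  of_affine (AffineMap.const ℝ E 0) isEmptyElim

/-- A piecewise linear map factors through every injective piecewise linear map which is defined
on a compact polyhedron and has a large enough image. -/
theorem exists_factor {N M L : ℕ} {s : Set (Fin N → ℝ)} {t : Set (Fin M → ℝ)}
    {w : Set (Fin L → ℝ)} (hs : IsCompactPolyhedron s) {g : s → t} (hg : IsPL g)
    (hinj : Function.Injective g) {f : w → t} (hf : IsPL f) (hr : ∀ x, ∃ y, g y = f x) :
    ∃ h : w → s, IsPL h ∧ ∀ x, g (h x) = f x := by
  obtain ⟨𝒮, hfinS, hpolyS, hsS⟩ := hs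
  obtain ⟨𝒞, hfin, hpoly, hcov, haff⟩ := hg
  obtain ⟨𝒟, hfin', hpoly', hcov', haff'⟩ := hf
  choose h hh using hr
  refine ⟨h, ?_, hh⟩
  have hsub : ∀ C ∈ 𝒮, C ⊆ s := fun C hC => hsS ▸ Set.subset_sUnion_of_mem hC
  -- Injectivity of `g` is known only on `s`, which need not be convex, and the polyhedra on which
  -- `g` is affine may leave `s`. Affine left inverses are therefore taken on intersections of such
  -- a polyhedron with a convex cell of `s`.
  have hB : ∀ q : (Set (Fin N → ℝ) × ((Fin N → ℝ) →ᵃ[ℝ] (Fin M → ℝ))) × Set (Fin N → ℝ),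
      ∃ B : (Fin M → ℝ) →ᵃ[ℝ] (Fin N → ℝ), q.1 ∈ 𝒞 → q.2 ∈ 𝒮 →
        ∀ x ∈ q.1.1 ∩ q.2, B (q.1.2 x) = x := by
    rintro ⟨q, C⟩
    by_cases hq : q ∈ 𝒞 ∧ C ∈ 𝒮
    · obtain ⟨B, hB⟩ := AffineMap.exists_leftInvOn
        ((hpoly q hq.1).convex.inter (hpolyS C hq.2).1.convex) q.2 (fun x hx y hy hxy => by
          have := hinj (a₁ := ⟨x, hsub C hq.2 hx.2⟩) (a₂ := ⟨y, hsub C hq.2 hy.2⟩)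
            (Subtype.ext (by rw [haff q hq.1 _ hx.1, haff q hq.1 _ hy.1]; exact hxy))
          exact congrArg Subtype.val this)
      exact ⟨B, fun _ _ => hB⟩
    · exact ⟨AffineMap.const ℝ _ 0, fun h₁ h₂ => absurd ⟨h₁, h₂⟩ hq⟩
  choose B hB using hB
  -- For pairs taken from the two covers, `Q q` is the image of the convex piece `q.1.1 ∩ q.2` under
  -- its affine map, described through the left inverse so that it is visibly a polyhedron.
  let Q : (Set (Fin N → ℝ) × ((Fin N → ℝ) →ᵃ[ℝ] (Fin M → ℝ))) × Set (Fin N → ℝ) →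
      Set (Fin M → ℝ) :=
    fun q => (B q ⁻¹' (q.1.1 ∩ q.2)) ∩ {y | (q.1.2.comp (B q) - AffineMap.id ℝ (Fin M → ℝ)) y = 0}
  have hQ : ∀ q, q.1 ∈ 𝒞 → q.2 ∈ 𝒮 → IsConvexPolyhedron (Q q) := fun q h₁ h₂ =>
    (((hpoly _ h₁).inter (hpolyS _ h₂).1).preimage _).inter
      (IsConvexPolyhedron.setOf_affine_eq_zero _)
  refine ⟨Set.image2 (fun p q => (p.1 ∩ p.2 ⁻¹' Q q, (B q).comp p.2)) 𝒟 (𝒞 ×ˢ 𝒮),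
    hfin'.image2 _ (hfin.prod hfinS), ?_, ?_, ?_⟩
  · rintro _ ⟨p, hp, q, hq, rfl⟩
    exact (hpoly' p hp).inter ((hQ q hq.1 hq.2).preimage p.2)
  · intro x
    obtain ⟨p, hp, hxp⟩ := hcov' x
    obtain ⟨q, hq, hyq⟩ := hcov (h x)
    have hy : ((h x : s) : Fin N → ℝ) ∈ ⋃₀ 𝒮 := hsS ▸ (h x).2
    obtain ⟨C, hC, hyC⟩ := hy
    refine ⟨_, ⟨p, hp, (q, C), ⟨hq, hC⟩, rfl⟩, hxp, (?_ : p.2 x ∈ Q (q, C))⟩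
    have hval : p.2 x = q.2 (h x) := by rw [← haff' p hp x hxp, ← haff q hq _ hyq, hh]
    have hBy : B (q, C) (p.2 x) = h x := by
      rw [hval]; exact hB (q, C) hq hC _ ⟨hyq, hyC⟩
    refine ⟨?_, ?_⟩
    · change B (q, C) (p.2 x) ∈ q.1 ∩ C
      rw [hBy]
      exact Set.mem_inter hyq hyC
    · simp [hBy, ← hval]
  · rintro _ ⟨p, hp, ⟨q, C⟩, ⟨hq, hC⟩, rfl⟩ x ⟨hxp, ⟨hxq, hxC⟩, hfix⟩
    have hfix' : q.2 (B (q, C) (p.2 x)) = p.2 x := by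
      simpa [sub_eq_zero] using hfix
    have : h x = ⟨B (q, C) (p.2 x), hsub C hC hxC⟩ := by
      refine hinj (Subtype.ext ?_)
      rw [hh, haff' p hp x hxp, haff q hq _ hxq]
      exact hfix'.symm
    rw [this]
    rfl

end IsPL

/-- An injective piecewise linear map defined on a compact polyhedron restricts to piecewise linear
homeomorphisms onto images. -/
theorem PLHomeo.exists_of_injective {N M : ℕ} {s : Set (Fin N → ℝ)} {t : Set (Fin M → ℝ)}
    (hs : IsCompactPolyhedron s) {g : s → t} (hg : IsPL g) (hinj : Function.Injective g)
    {V : Set (Fin N → ℝ)} (hV : V ⊆ s) {V' : Set (Fin M → ℝ)} (hV' : V' ⊆ t)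
    (hmem : ∀ x : s, (g x : Fin M → ℝ) ∈ V' ↔ (x : Fin N → ℝ) ∈ V)
    (hsurj : ∀ y : V', ∃ x : s, (g x : Fin M → ℝ) = y) :
    ∃ e : PLHomeo V V', ∀ x : V, (e x : Fin M → ℝ) = g ⟨x, hV x.2⟩ := by
  let f : V → V' := fun x => ⟨g ⟨x, hV x.2⟩, (hmem _).2 x.2⟩
  have hf : IsPL f := hg.restrict (fun x => ⟨x, hV x.2⟩) (fun _ => rfl) (fun _ => rfl)
  let ι : V' → t := fun y => ⟨y, hV' y.2⟩
  have hι : IsPL ι := IsPL.of_affine (AffineMap.id ℝ _) (fun _ => rfl)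
  -- Factoring the inclusion of `V'` through `g` produces the inverse, already piecewise linear.
  obtain ⟨h, hh, hgh⟩ := IsPL.exists_factor hs hg hinj hι fun y => by
    obtain ⟨x, hx⟩ := hsurj y
    exact ⟨x, Subtype.ext hx⟩
  have hhV : ∀ y, (h y : Fin N → ℝ) ∈ V := fun y => by
    rw [← hmem, hgh]
    exact y.2
  refine ⟨{ toFun := f
            invFun := fun y => ⟨h y, hhV y⟩
            left_inv := fun x => ?_
            right_inv := fun y => ?_
            isPL := hf
            isPL_symm := hh.restrict (fun y => y) (fun _ => rfl) (fun _ => rfl) },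
    fun _ => rfl⟩
  · have : h (f x) = ⟨x, hV x.2⟩ := hinj (hgh (f x))
    exact Subtype.ext (congrArg (fun z : s => (z : Fin N → ℝ)) this)
  · exact Subtype.ext (congrArg (fun z : t => (z : Fin M → ℝ)) (hgh y))

/-! ## Clopen parts and disjoint unions of manifolds -/

/-- The inverse of a piecewise linear homeomorphism. -/
def PLHomeo.symm {E F : Type*} [AddCommGroup E] [Module ℝ E] [AddCommGroup F] [Module ℝ F]
    {s : Set E} {t : Set F} (f : PLHomeo s t) : PLHomeo t s where
  toEquiv := f.toEquiv.symm
  isPL := f.isPL_symm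
  isPL_symm := f.isPL

theorem PLHomeo.isPreconnected_of_unitCube {N m : ℕ} {V : Set (Fin N → ℝ)}
    (h : PLHomeo V (unitCube m)) : _root_.IsPreconnected V := by
  have hcube : PreconnectedSpace (unitCube m) :=
    Subtype.preconnectedSpace (convex_Icc (0 : Fin m → ℝ) 1).isPreconnected
  have : PreconnectedSpace V :=
    h.toEquiv.symm.surjective.denseRange.preconnectedSpace h.isPL_symm.continuous
  exact isPreconnected_iff_preconnectedSpace.2 this

theorem PLHomeo.nonempty_of_unitCube {N m : ℕ} {V : Set (Fin N → ℝ)}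
    (h : PLHomeo V (unitCube m)) : Nonempty V :=
  ⟨h.toEquiv.symm ⟨0, le_rfl, zero_le_one⟩⟩

namespace PLManifold

variable {d e : ℤ}

theorem compactSpace (X : PLManifold d) : CompactSpace X :=
  isCompact_iff_compactSpace.1 X.isCompactPolyhedron.isCompact

/-- The clopen subset `A` of `X`, as a manifold. -/
def part (X : PLManifold d) (A : Set X) (hA : IsClopen A) : PLManifold d where
  N := X.N
  carrier := Subtype.val '' A
  isCompactPolyhedron := X.isCompactPolyhedron.isClopen hA
  locally_ball := by
    rintro _ ⟨x, hx, rfl⟩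
    obtain ⟨hd, V, hV, hnhds, ⟨h⟩⟩ := X.locally_ball x x.2
    -- The ball `V` is connected and meets `A`, so it survives as a ball neighbourhood inside the
    -- part.
    have hVA : V ⊆ Subtype.val '' A := fun y hy => ⟨⟨y, hV hy⟩,
      h.isPreconnected_of_unitCube.subset_isClopen_subtype hV hA hx
        (mem_of_mem_nhdsWithin x.2 hnhds) _ hy, rfl⟩
    exact ⟨hd, V, hVA, nhdsWithin_mono _ (Subtype.coe_image_subset _ _) hnhds, ⟨h⟩⟩

theorem exists_part (X : PLManifold d) {A : Set X} (hA : IsClopen A) :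
    ∃ (X₁ : PLManifold d) (j : X₁ → X), IsPL j ∧ Function.Injective j ∧ Set.range j = A := by
  refine ⟨X.part A hA,
    fun x => ⟨x.1, by obtain ⟨_, y, _, rfl⟩ := x; exact y.2⟩,
    IsPL.of_affine (AffineMap.id ℝ _) (fun _ => rfl), fun x y hxy => ?_, ?_⟩
  · exact Subtype.ext (congrArg (fun z : X => (z : Fin X.N → ℝ)) hxy)
  · ext x
    constructor
    · rintro ⟨⟨_, y, hy, rfl⟩, rfl⟩
      exact hy
    · exact fun hx => ⟨⟨x.1, x, hx, rfl⟩, rfl⟩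

theorem exists_disjointUnion_of_isClopen (X : PLManifold d) {A : Set X} (hA : IsClopen A) :
    ∃ (X₁ X₂ : PLManifold d) (J : DisjointUnion X₁ X₂ X), Set.range J.inl = A := by
  obtain ⟨X₁, i, hi, hi', hiA⟩ := X.exists_part hA
  obtain ⟨X₂, j, hj, hj', hjA⟩ := X.exists_part hA.compl
  exact ⟨X₁, X₂, ⟨i, j, hi, hj, hi', hj', by rw [hiA, hjA]; exact isCompl_compl⟩, hiA⟩

theorem isClosed_range {X Y : PLManifold d} {f : X → Y} (hf : IsPL f) :
    IsClosed (Set.range f) :=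
  have := X.compactSpace
  (isCompact_range hf.continuous).isClosed

/-- The empty manifold. -/
def empty (d : ℤ) : PLManifold d where
  N := 0
  carrier := ∅
  isCompactPolyhedron := IsCompactPolyhedron.empty
  locally_ball := by simp

instance : IsEmpty (empty d) := ⟨fun x => x.2⟩

/-- Interior points are detected on clopen parts. -/
theorem isInteriorPoint_iff_of_isClopen {X₁ X : PLManifold d} {g : X₁ → X} (hg : IsPL g)
    (hinj : Function.Injective g) (hr : IsClopen (Set.range g)) (x : X₁) :
    X.IsInteriorPoint (g x) ↔ X₁.IsInteriorPoint x := by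
  have := X₁.compactSpace
  constructor
  · rintro ⟨V, hV, hnhds, h, hx, hint⟩
    -- A ball neighbourhood of `g x` is connected, hence contained in the clopen range of `g`; it
    -- can be pulled back whole.
    have hsub := h.isPreconnected_of_unitCube.subset_isClopen_subtype hV hr
      (Set.mem_range_self x) hx
    let V₁ : Set (Fin X₁.N → ℝ) := Subtype.val '' {y : X₁ | (g y : Fin X.N → ℝ) ∈ V}
    have hV₁ : V₁ ⊆ X₁.carrier := Subtype.coe_image_subset _ _
    obtain ⟨k, hk⟩ := PLHomeo.exists_of_injective X₁.isCompactPolyhedron hg hinj hV₁ hV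
      (fun y => by simp [V₁])
      (fun y => by
        obtain ⟨z, hz⟩ := hsub ⟨y, hV y.2⟩ y.2
        exact ⟨z, by rw [hz]⟩)
    have hxV : (x : Fin X₁.N → ℝ) ∈ V₁ := ⟨x, hx, rfl⟩
    refine ⟨V₁, hV₁, ?_, k.trans h, hxV, ?_⟩
    · rw [← preimage_coe_mem_nhds_subtype, Set.preimage_image_eq _ Subtype.val_injective]
      rw [← preimage_coe_mem_nhds_subtype] at hnhds
      exact hg.continuous.continuousAt hnhds
    · have : k ⟨x, hxV⟩ = ⟨g x, hx⟩ := Subtype.ext (hk _)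
      change (h (k ⟨x, hxV⟩) : Fin d.toNat → ℝ) ∈ _
      rwa [this]
  · rintro ⟨V₁, hV₁, hnhds, h, hx, hint⟩
    let V : Set (Fin X.N → ℝ) := Subtype.val '' (g '' (Subtype.val ⁻¹' V₁))
    have hV : V ⊆ X.carrier := Subtype.coe_image_subset _ _
    obtain ⟨k, hk⟩ := PLHomeo.exists_of_injective X₁.isCompactPolyhedron hg hinj hV₁ hV
      (fun y => by simp [V, hinj.eq_iff])
      (fun y => by
        obtain ⟨_, _, ⟨z, hz, rfl⟩, rfl⟩ := y
        exact ⟨z, rfl⟩)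
    have hxV : (g x : Fin X.N → ℝ) ∈ V := ⟨g x, ⟨x, hx, rfl⟩, rfl⟩
    refine ⟨V, hV, ?_, k.symm.trans h, hxV, ?_⟩
    · rw [← preimage_coe_mem_nhds_subtype, Set.preimage_image_eq _ Subtype.val_injective]
      rw [← preimage_coe_mem_nhds_subtype] at hnhds
      -- Openness of the range is what makes the pushed-forward ball a neighbourhood in `X`.
      have hopen : IsOpenEmbedding g :=
        ⟨(hg.continuous.isClosedEmbedding hinj).isEmbedding, hr.isOpen⟩
      exact hopen.image_mem_nhds.2 hnhds
    · have : k.symm ⟨g x, hxV⟩ = ⟨x, hx⟩ :=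
        (Equiv.symm_apply_eq k.toEquiv).2 (Subtype.ext (hk ⟨x, hx⟩).symm)
      change (h (k.symm ⟨g x, hxV⟩) : Fin d.toNat → ℝ) ∈ _
      rwa [this]

end PLManifold

/-! ### Maps into and out of a disjoint union -/

namespace DisjointUnion

variable {d e : ℤ} {X₁ X₂ X : PLManifold d}

/-- The disjoint union with the two parts exchanged. -/
def symm (J : DisjointUnion X₁ X₂ X) : DisjointUnion X₂ X₁ X :=
  ⟨J.inr, J.inl, J.isPL_inr, J.isPL_inl, J.injective_inr, J.injective_inl, J.isCompl.symm⟩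

theorem isClopen_range_inl (J : DisjointUnion X₁ X₂ X) : IsClopen (Set.range J.inl) :=
  ⟨PLManifold.isClosed_range J.isPL_inl, by
    rw [← isClosed_compl_iff, J.isCompl.compl_eq]
    exact PLManifold.isClosed_range J.isPL_inr⟩

theorem inl_ne_inr (J : DisjointUnion X₁ X₂ X) (x : X₁) (y : X₂) : J.inl x ≠ J.inr y :=
  fun h => Set.disjoint_left.1 J.isCompl.disjoint ⟨x, rfl⟩ ⟨y, h.symm⟩

theorem inl_or_inr (J : DisjointUnion X₁ X₂ X) (x : X) :
    (∃ y, J.inl y = x) ∨ ∃ y, J.inr y = x := by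
  have : x ∈ Set.range J.inl ∪ Set.range J.inr := by
    have h : Set.range J.inl ⊔ Set.range J.inr = Set.univ := J.isCompl.sup_eq_top
    exact (h.symm ▸ Set.mem_univ x : x ∈ Set.range J.inl ⊔ Set.range J.inr)
  exact this

theorem forall_iff (J : DisjointUnion X₁ X₂ X) {p : X → Prop} :
    (∀ x, p x) ↔ (∀ x, p (J.inl x)) ∧ ∀ x, p (J.inr x) := by
  refine ⟨fun h => ⟨fun x => h _, fun x => h _⟩, fun h x => ?_⟩
  rcases J.inl_or_inr x with ⟨y, rfl⟩ | ⟨y, rfl⟩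
  exacts [h.1 y, h.2 y]

/-- The map on a disjoint union with given restrictions to the two parts. -/
theorem exists_desc (J : DisjointUnion X₁ X₂ X) {T : Sort*} (f : X₁ → T) (g : X₂ → T) :
    ∃ h : X → T, (∀ x, h (J.inl x) = f x) ∧ ∀ x, h (J.inr x) = g x := by
  have : ∀ x : X, ∃ t, (∀ y, J.inl y = x → t = f y) ∧ ∀ y, J.inr y = x → t = g y := by
    rw [J.forall_iff]
    refine ⟨fun x => ⟨f x, fun y hy => ?_, fun y hy => (J.inl_ne_inr _ _ hy.symm).elim⟩,
      fun x => ⟨g x, fun y hy => (J.inl_ne_inr _ _ hy).elim, fun y hy => ?_⟩⟩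
    · rw [J.injective_inl hy]
    · rw [J.injective_inr hy]
  choose h hl hr using this
  exact ⟨h, fun x => hl _ x rfl, fun x => hr _ x rfl⟩

theorem isInteriorPoint_inl (J : DisjointUnion X₁ X₂ X) (x : X₁) :
    X.IsInteriorPoint (J.inl x) ↔ X₁.IsInteriorPoint x :=
  PLManifold.isInteriorPoint_iff_of_isClopen J.isPL_inl J.injective_inl J.isClopen_range_inl x

theorem inl_mem_boundary (J : DisjointUnion X₁ X₂ X) (x : X₁) :
    J.inl x ∈ X.boundary ↔ x ∈ X₁.boundary :=
  not_congr (J.isInteriorPoint_inl x)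

theorem exists_factor_inl (J : DisjointUnion X₁ X₂ X) {Y : PLManifold e} {f : Y → X}
    (hf : IsPL f) (hr : ∀ y, f y ∈ Set.range J.inl) :
    ∃ h : Y → X₁, IsPL h ∧ ∀ y, J.inl (h y) = f y :=
  IsPL.exists_factor X₁.isCompactPolyhedron J.isPL_inl J.injective_inl hf hr

theorem exists_factor_inr (J : DisjointUnion X₁ X₂ X) {Y : PLManifold e} {f : Y → X}
    (hf : IsPL f) (hr : ∀ y, f y ∈ Set.range J.inr) :
    ∃ h : Y → X₂, IsPL h ∧ ∀ y, J.inr (h y) = f y :=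
  J.symm.exists_factor_inl hf hr

/-- For pasting, `f` must be affine at every point of `X` in each polyhedron, not only at the points
of `X₁`. Intersecting with the convex cells of `X` contained in the image of `X₁` ensures this, and
by connectedness those cells cover that image. -/
theorem exists_finite_cover_inl (J : DisjointUnion X₁ X₂ X) {N : ℕ} {t : Set (Fin N → ℝ)}
    {f : X → t} (h₁ : IsPL fun x => f (J.inl x)) :
    ∃ 𝒞 : Set (Set (Fin X.N → ℝ) × ((Fin X.N → ℝ) →ᵃ[ℝ] (Fin N → ℝ))), 𝒞.Finite ∧
      (∀ p ∈ 𝒞, IsConvexPolyhedron p.1) ∧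
      (∀ x : X₁, ∃ p ∈ 𝒞, (J.inl x : Fin X.N → ℝ) ∈ p.1) ∧
      ∀ p ∈ 𝒞, ∀ x : X, (x : Fin X.N → ℝ) ∈ p.1 → (f x : Fin N → ℝ) = p.2 x := by
  obtain ⟨𝒮, hfinS, hpolyS, hS⟩ := X.isCompactPolyhedron
  let W : Set (Fin X.N → ℝ) := Subtype.val '' Set.range J.inl
  have hW : W ⊆ X.carrier := Subtype.coe_image_subset _ _
  obtain ⟨h, hPL, hh⟩ := IsPL.exists_factor (w := W) (f := fun x => (⟨x, hW x.2⟩ : X))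
    X₁.isCompactPolyhedron J.isPL_inl J.injective_inl
    (IsPL.of_affine (AffineMap.id ℝ _) fun _ => rfl)
    (fun x => by obtain ⟨_, _, ⟨y, rfl⟩, rfl⟩ := x; exact ⟨y, rfl⟩)
  obtain ⟨𝒞, hfin, hpoly, hcov, haff⟩ := h₁.comp hPL
  refine ⟨Set.image2 (fun C p => (C ∩ p.1, p.2)) {C ∈ 𝒮 | C ⊆ W} 𝒞,
    (hfinS.subset fun C hC => hC.1).image2 _ hfin, ?_, fun x => ?_, ?_⟩
  · rintro _ ⟨C, hC, p, hp, rfl⟩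
    exact (hpolyS C hC.1).1.inter (hpoly p hp)
  · have hxS : (J.inl x : Fin X.N → ℝ) ∈ ⋃₀ 𝒮 := hS ▸ (J.inl x).2
    obtain ⟨C, hC, hxC⟩ := hxS
    obtain ⟨p, hp, hxp⟩ := hcov ⟨J.inl x, J.inl x, ⟨x, rfl⟩, rfl⟩
    have hCX : C ⊆ X.carrier := hS ▸ Set.subset_sUnion_of_mem hC
    exact ⟨_, ⟨C, ⟨hC, fun y hy => ⟨⟨y, hCX hy⟩,
      (hpolyS C hC).1.convex.isPreconnected.subset_isClopen_subtype hCX J.isClopen_range_inl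
        (Set.mem_range_self x) hxC _ hy, rfl⟩⟩, p, hp, rfl⟩, hxC, hxp⟩
  · rintro _ ⟨C, hC, p, hp, rfl⟩ x ⟨hxC, hxp⟩
    have := haff p hp ⟨x, hC.2 hxC⟩ hxp
    dsimp only at this
    rwa [hh] at this

/-- A map on a disjoint union is piecewise linear if its restrictions to the two parts are. -/
theorem isPL_of_comp (J : DisjointUnion X₁ X₂ X) {N : ℕ} {t : Set (Fin N → ℝ)} {f : X → t}
    (h₁ : IsPL fun x => f (J.inl x)) (h₂ : IsPL fun x => f (J.inr x)) : IsPL f := by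
  obtain ⟨𝒞, hfin, hpoly, hcov, haff⟩ := J.exists_finite_cover_inl h₁
  obtain ⟨𝒞', hfin', hpoly', hcov', haff'⟩ := J.symm.exists_finite_cover_inl h₂
  refine ⟨𝒞 ∪ 𝒞', hfin.union hfin', ?_, ?_, ?_⟩
  · rintro p (hp | hp)
    exacts [hpoly p hp, hpoly' p hp]
  · rw [J.forall_iff]
    refine ⟨fun x => ?_, fun x => ?_⟩
    · obtain ⟨p, hp, hx⟩ := hcov x
      exact ⟨p, Or.inl hp, hx⟩
    · obtain ⟨p, hp, hx⟩ := hcov' x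
      exact ⟨p, Or.inr hp, hx⟩
  · rintro p (hp | hp)
    exacts [haff p hp, haff' p hp]

end DisjointUnion

/-! ### Existence of disjoint unions -/

namespace PLManifold

variable {d e : ℤ}

/-- The set `T` stands for the image of the other manifold. As it is closed and disjoint from the
image of `X`, removing it from an open set shows that the image of a ball neighbourhood is still a
neighbourhood in the union. -/
theorem locally_ball_image (X : PLManifold d) {M : ℕ} (A : (Fin X.N → ℝ) →ᵃ[ℝ] (Fin M → ℝ))
    (B : (Fin M → ℝ) →ᵃ[ℝ] (Fin X.N → ℝ)) (hB : ∀ x, B (A x) = x) {T : Set (Fin M → ℝ)}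
    (hT : IsClosed T) (hdisj : Disjoint (A '' X.carrier) T) :
    ∀ x ∈ A '' X.carrier, 0 ≤ d ∧ ∃ V ⊆ A '' X.carrier ∪ T, V ∈ 𝓝[A '' X.carrier ∪ T] x ∧
      Nonempty (PLHomeo V (unitCube d.toNat)) := by
  rintro _ ⟨x, hx, rfl⟩
  obtain ⟨hd, V, hV, hnhds, ⟨h⟩⟩ := X.locally_ball x hx
  obtain ⟨O, hO, hxO, hOV⟩ := mem_nhdsWithin.1 hnhds
  refine ⟨hd, A '' V, (Set.image_mono hV).trans Set.subset_union_left, ?_, ⟨?_⟩⟩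
  · refine mem_nhdsWithin.2 ⟨B ⁻¹' O ∩ Tᶜ,
      (hO.preimage (AffineMap.continuous_of_finiteDimensional B)).inter hT.isOpen_compl,
      ⟨by rwa [Set.mem_preimage, hB], Set.disjoint_left.1 hdisj ⟨x, hx, rfl⟩⟩, ?_⟩
    rintro y ⟨⟨hyO, hyT⟩, ⟨z, hz, rfl⟩ | hy⟩
    · rw [Set.mem_preimage, hB] at hyO
      exact ⟨z, hOV ⟨hyO, hz⟩, rfl⟩
    · exact (hyT hy).elim
  · refine PLHomeo.trans ⟨⟨fun y => ⟨B y, ?_⟩, fun y => ⟨A y, y, y.2, rfl⟩, ?_, ?_⟩,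
      IsPL.of_affine B fun _ => rfl, IsPL.of_affine A fun _ => rfl⟩ h
    · obtain ⟨_, z, hz, rfl⟩ := y
      rwa [hB]
    · rintro ⟨_, z, hz, rfl⟩
      simp [hB]
    · rintro y
      simp [hB]

theorem isCompactPolyhedron_image (X : PLManifold d) {M : ℕ}
    (A : (Fin X.N → ℝ) →ᵃ[ℝ] (Fin M → ℝ)) (B : (Fin M → ℝ) →ᵃ[ℝ] (Fin X.N → ℝ))
    (hB : ∀ x, B (A x) = x) : IsCompactPolyhedron (A '' X.carrier) := by
  obtain ⟨𝒞, hfin, h𝒞, hX⟩ := X.isCompactPolyhedron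
  refine ⟨(fun C => A '' C) '' 𝒞, hfin.image _, ?_, ?_⟩
  · rintro _ ⟨C, hC, rfl⟩
    exact ⟨(h𝒞 C hC).1.image_affine A B hB,
      (h𝒞 C hC).2.image (AffineMap.continuous_of_finiteDimensional A)⟩
  · rw [hX, Set.image_sUnion]

/-- Any two manifolds have a disjoint union. -/
theorem exists_disjointUnion (X₁ X₂ : PLManifold d) :
    ∃ X : PLManifold d, Nonempty (DisjointUnion X₁ X₂ X) := by
  -- The last coordinate is a height: `X₁` is placed at height `0` and `X₂` at height `1`, which
  -- makes the images disjoint.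
  let E := ((Fin X₁.N → ℝ) × (Fin X₂.N → ℝ)) × ℝ
  let M := Module.finrank ℝ E
  let k : E ≃ₗ[ℝ] (Fin M → ℝ) := (Module.finBasis ℝ E).equivFun
  let A₁ : (Fin X₁.N → ℝ) →ᵃ[ℝ] (Fin M → ℝ) :=
    (k.toLinearMap ∘ₗ LinearMap.inl ℝ _ _ ∘ₗ LinearMap.inl ℝ _ _).toAffineMap
  let B₁ : (Fin M → ℝ) →ᵃ[ℝ] (Fin X₁.N → ℝ) :=
    (LinearMap.fst ℝ _ _ ∘ₗ LinearMap.fst ℝ _ _ ∘ₗ k.symm.toLinearMap).toAffineMap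
  let A₂ : (Fin X₂.N → ℝ) →ᵃ[ℝ] (Fin M → ℝ) :=
    (k.toLinearMap ∘ₗ LinearMap.inl ℝ _ _ ∘ₗ LinearMap.inr ℝ _ _).toAffineMap +
      AffineMap.const ℝ _ (k (0, 1))
  let B₂ : (Fin M → ℝ) →ᵃ[ℝ] (Fin X₂.N → ℝ) :=
    (LinearMap.snd ℝ _ _ ∘ₗ LinearMap.fst ℝ _ _ ∘ₗ k.symm.toLinearMap).toAffineMap
  have hB₁ : ∀ x, B₁ (A₁ x) = x := fun x => by
    simp [A₁, B₁]
    rfl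
  have hB₂ : ∀ x, B₂ (A₂ x) = x := fun x => by
    simp [A₂, B₂]
    exact add_zero x
  have hd : Disjoint (A₁ '' X₁.carrier) (A₂ '' X₂.carrier) := by
    refine Set.disjoint_left.2 ?_
    rintro _ ⟨x, -, rfl⟩ ⟨y, -, hy⟩
    have := congrArg (fun z => (k.symm z).2) hy
    simp [A₁, A₂] at this
    change (0 : ℝ) + 1 = 0 at this
    norm_num at this
  have hc₁ := X₁.isCompactPolyhedron_image A₁ B₁ hB₁
  have hc₂ := X₂.isCompactPolyhedron_image A₂ B₂ hB₂
  let X : PLManifold d :=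
    { N := M
      carrier := A₁ '' X₁.carrier ∪ A₂ '' X₂.carrier
      isCompactPolyhedron := by
        obtain ⟨𝒞, hfin, h𝒞, h₁⟩ := hc₁
        obtain ⟨𝒟, hfin', h𝒟, h₂⟩ := hc₂
        refine ⟨𝒞 ∪ 𝒟, hfin.union hfin', ?_, by rw [Set.sUnion_union, ← h₁, ← h₂]⟩
        rintro C (hC | hC)
        exacts [h𝒞 C hC, h𝒟 C hC]
      locally_ball := by
        rintro x (hx | hx)
        · exact X₁.locally_ball_image A₁ B₁ hB₁ hc₂.isCompact.isClosed hd x hx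
        · rw [Set.union_comm]
          exact X₂.locally_ball_image A₂ B₂ hB₂ hc₁.isCompact.isClosed hd.symm x hx }
  refine ⟨X, ⟨⟨fun x => ⟨A₁ x, Or.inl ⟨x, x.2, rfl⟩⟩, fun x => ⟨A₂ x, Or.inr ⟨x, x.2, rfl⟩⟩,
    IsPL.of_affine A₁ fun _ => rfl, IsPL.of_affine A₂ fun _ => rfl, fun x y hxy => ?_,
    fun x y hxy => ?_, ?_⟩⟩⟩
  · have := congrArg (fun z : X => B₁ z) hxy
    exact Subtype.ext (by simpa [hB₁] using this)
  · have := congrArg (fun z : X => B₂ z) hxy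
    exact Subtype.ext (by simpa [hB₂] using this)
  · refine IsCompl.of_eq ?_ ?_
    · refine Set.eq_empty_of_forall_notMem ?_
      rintro _ ⟨⟨z, rfl⟩, ⟨w, hw⟩⟩
      exact Set.disjoint_left.1 hd ⟨z, z.2, rfl⟩
        ⟨w, w.2, congrArg (fun z : X => (z : Fin M → ℝ)) hw⟩
    · refine Set.eq_univ_of_forall fun x => ?_
      obtain ⟨_, ⟨z, hz, rfl⟩ | ⟨z, hz, rfl⟩⟩ := x
      · exact Or.inl ⟨⟨z, hz⟩, rfl⟩
      · exact Or.inr ⟨⟨z, hz⟩, rfl⟩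

end PLManifold

/-! ### Boundaries and associativity of disjoint unions -/

namespace DisjointUnion

variable {d e : ℤ} {X₁ X₂ X : PLManifold d}

/-- The boundary of a disjoint union is the disjoint union of the boundaries of the parts. -/
theorem exists_boundary_split (J : DisjointUnion X₁ X₂ X) {Z : PLManifold e}
    (ζ : BoundaryOf Z X) :
    ∃ (Z₁ Z₂ : PLManifold e) (J' : DisjointUnion Z₁ Z₂ Z) (ζ₁ : BoundaryOf Z₁ X₁)
      (ζ₂ : BoundaryOf Z₂ X₂), (∀ z, ζ.incl (J'.inl z) = J.inl (ζ₁.incl z)) ∧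
      ∀ z, ζ.incl (J'.inr z) = J.inr (ζ₂.incl z) := by
  obtain ⟨Z₁, Z₂, J', hJ'⟩ := Z.exists_disjointUnion_of_isClopen
    (J.isClopen_range_inl.preimage ζ.isPL.continuous)
  have hJ'r : Set.range J'.inr = ζ.incl ⁻¹' Set.range J.inr := by
    rw [← J'.isCompl.compl_eq, hJ', ← Set.preimage_compl, J.isCompl.compl_eq]
  obtain ⟨h₁, hPL₁, hh₁⟩ := J.exists_factor_inl (ζ.isPL.comp J'.isPL_inl)
    fun z => (hJ' ▸ Set.mem_range_self z : J'.inl z ∈ ζ.incl ⁻¹' Set.range J.inl)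
  obtain ⟨h₂, hPL₂, hh₂⟩ := J.exists_factor_inr (ζ.isPL.comp J'.isPL_inr)
    fun z => (hJ'r ▸ Set.mem_range_self z : J'.inr z ∈ ζ.incl ⁻¹' Set.range J.inr)
  have key : ∀ x, x ∈ X.boundary ↔ ∃ z, ζ.incl z = x := fun x => by rw [← ζ.range_eq]; rfl
  refine ⟨Z₁, Z₂, J', ⟨h₁, hPL₁, fun z w hzw => ?_, ?_⟩, ⟨h₂, hPL₂, fun z w hzw => ?_, ?_⟩,
    fun z => (hh₁ z).symm, fun z => (hh₂ z).symm⟩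
  · exact J'.injective_inl (ζ.injective (by rw [← hh₁, ← hh₁, hzw]))
  · ext x
    rw [← J.inl_mem_boundary, key]
    constructor
    · rintro ⟨z, rfl⟩
      exact ⟨J'.inl z, (hh₁ z).symm⟩
    · rintro ⟨z, hz⟩
      have : z ∈ Set.range J'.inl := hJ' ▸ ⟨x, hz.symm⟩
      obtain ⟨w, rfl⟩ := this
      exact ⟨w, J.injective_inl (by rw [hh₁, hz])⟩
  · exact J'.injective_inr (ζ.injective (by rw [← hh₂, ← hh₂, hzw]))
  · ext x
    have hx := J.symm.inl_mem_boundary x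
    change J.inr x ∈ _ ↔ _ at hx
    rw [← hx, key]
    constructor
    · rintro ⟨z, rfl⟩
      exact ⟨J'.inr z, (hh₂ z).symm⟩
    · rintro ⟨z, hz⟩
      have : z ∈ Set.range J'.inr := hJ'r ▸ ⟨x, hz.symm⟩
      obtain ⟨w, rfl⟩ := this
      exact ⟨w, J.injective_inr (by rw [hh₂, hz])⟩

/-- A disjoint union of boundaries is the boundary of the disjoint union. -/
theorem exists_boundary_union (J : DisjointUnion X₁ X₂ X) {Z₁ Z₂ : PLManifold e}
    (ζ₁ : BoundaryOf Z₁ X₁) (ζ₂ : BoundaryOf Z₂ X₂) :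
    ∃ (Z : PLManifold e) (J' : DisjointUnion Z₁ Z₂ Z) (ζ : BoundaryOf Z X),
      (∀ z, ζ.incl (J'.inl z) = J.inl (ζ₁.incl z)) ∧
      ∀ z, ζ.incl (J'.inr z) = J.inr (ζ₂.incl z) := by
  obtain ⟨Z, ⟨J'⟩⟩ := Z₁.exists_disjointUnion Z₂
  obtain ⟨h, hl, hr⟩ := J'.exists_desc (fun z => J.inl (ζ₁.incl z)) fun z => J.inr (ζ₂.incl z)
  have key₁ : ∀ x, x ∈ X₁.boundary ↔ ∃ z, ζ₁.incl z = x := fun x => by rw [← ζ₁.range_eq]; rfl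
  have key₂ : ∀ x, x ∈ X₂.boundary ↔ ∃ z, ζ₂.incl z = x := fun x => by rw [← ζ₂.range_eq]; rfl
  refine ⟨Z, J', ⟨h, J'.isPL_of_comp ?_ ?_, ?_, ?_⟩, hl, hr⟩
  · simpa only [hl] using J.isPL_inl.comp ζ₁.isPL
  · simpa only [hr] using J.isPL_inr.comp ζ₂.isPL
  · intro z w
    rcases J'.inl_or_inr z with ⟨z, rfl⟩ | ⟨z, rfl⟩ <;>
      rcases J'.inl_or_inr w with ⟨w, rfl⟩ | ⟨w, rfl⟩ <;> simp only [hl, hr] <;> intro hzw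
    · rw [ζ₁.injective (J.injective_inl hzw)]
    · exact (J.inl_ne_inr _ _ hzw).elim
    · exact (J.inl_ne_inr _ _ hzw.symm).elim
    · rw [ζ₂.injective (J.injective_inr hzw)]
  · ext x
    rcases J.inl_or_inr x with ⟨x, rfl⟩ | ⟨x, rfl⟩
    · rw [J.inl_mem_boundary, key₁]
      constructor
      · rintro ⟨z, hz⟩
        rcases J'.inl_or_inr z with ⟨z, rfl⟩ | ⟨z, rfl⟩
        · exact ⟨z, J.injective_inl (by rw [← hz, hl])⟩
        · exact (J.inl_ne_inr _ _ (by rw [← hz, hr])).elim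
      · rintro ⟨z, rfl⟩
        exact ⟨J'.inl z, hl z⟩
    · have hx := J.symm.inl_mem_boundary x
      change J.inr x ∈ _ ↔ _ at hx
      rw [hx, key₂]
      constructor
      · rintro ⟨z, hz⟩
        rcases J'.inl_or_inr z with ⟨z, rfl⟩ | ⟨z, rfl⟩
        · exact (J.inl_ne_inr _ _ ((hl z).symm.trans hz)).elim
        · exact ⟨z, J.injective_inr (by rw [← hz, hr])⟩
      · rintro ⟨z, rfl⟩
        exact ⟨J'.inr z, hr z⟩

/-- A part of `X` which lies in `X₁` is a part of `X₁`. -/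
theorem exists_assoc {B R : PLManifold d} (J : DisjointUnion X₁ X₂ X)
    (C : DisjointUnion B R X) (h : ∀ b, C.inl b ∈ Set.range J.inl) :
    ∃ (R₁ : PLManifold d) (C₁ : DisjointUnion B R₁ X₁) (K : DisjointUnion R₁ X₂ R),
      (∀ b, J.inl (C₁.inl b) = C.inl b) ∧ (∀ x, J.inl (C₁.inr x) = C.inr (K.inl x)) ∧
      ∀ x, J.inr x = C.inr (K.inr x) := by
  -- The complement `R` of `B` is cut along `X₁`. The second piece `R₂` is discarded: since `B` lies
  -- in `X₁`, all of `X₂` embeds in `R` and takes its place.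
  obtain ⟨R₁, R₂, K, hK⟩ := R.exists_disjointUnion_of_isClopen
    (J.isClopen_range_inl.preimage C.isPL_inr.continuous)
  obtain ⟨i, hi, hi'⟩ := J.exists_factor_inl C.isPL_inl h
  obtain ⟨r, hr, hr'⟩ := J.exists_factor_inl (C.isPL_inr.comp K.isPL_inl)
    fun x => (hK ▸ Set.mem_range_self x : K.inl x ∈ C.inr ⁻¹' Set.range J.inl)
  have hnot : ∀ x, J.inr x ∈ Set.range C.inr := fun x => by
    rcases C.inl_or_inr (J.inr x) with ⟨b, hb⟩ | h'
    · obtain ⟨y, hy⟩ := h b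
      exact (J.inl_ne_inr _ _ (hy.trans hb)).elim
    · exact h'
  obtain ⟨s, hs, hs'⟩ := C.exists_factor_inr J.isPL_inr hnot
  refine ⟨R₁, ⟨i, r, hi, hr, fun x y hxy => ?_, fun x y hxy => ?_, ?_⟩,
    ⟨K.inl, s, K.isPL_inl, hs, K.injective_inl, fun x y hxy => ?_, ?_⟩, hi', hr',
    fun x => (hs' x).symm⟩
  · exact C.injective_inl (by rw [← hi', ← hi', hxy])
  · exact K.injective_inl (C.injective_inr (by rw [← hr', ← hr', hxy]))
  · refine IsCompl.of_eq ?_ ?_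
    · refine Set.eq_empty_of_forall_notMem ?_
      rintro _ ⟨⟨b, rfl⟩, ⟨x, hx⟩⟩
      exact C.inl_ne_inr b (K.inl x) (by rw [← hi', ← hr', hx])
    · refine Set.eq_univ_of_forall fun x => ?_
      rcases C.inl_or_inr (J.inl x) with ⟨b, hb⟩ | ⟨y, hy⟩
      · exact Or.inl ⟨b, J.injective_inl (by rw [hi', hb])⟩
      · have : y ∈ Set.range K.inl := hK ▸ ⟨x, hy.symm⟩
        obtain ⟨z, rfl⟩ := this
        exact Or.inr ⟨z, J.injective_inl (by rw [hr', hy])⟩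
  · exact J.injective_inr (by rw [← hs', ← hs', hxy])
  · refine IsCompl.of_eq ?_ ?_
    · refine Set.eq_empty_of_forall_notMem ?_
      rintro _ ⟨⟨z, rfl⟩, ⟨x, hx⟩⟩
      exact J.inl_ne_inr (r z) x (by rw [← hs', hr', hx])
    · refine Set.eq_univ_of_forall fun x => ?_
      rcases J.inl_or_inr (C.inr x) with ⟨y, hy⟩ | ⟨y, hy⟩
      · have : x ∈ Set.range K.inl := hK ▸ ⟨y, hy⟩
        exact Or.inl this
      · exact Or.inr ⟨y, C.injective_inr (by rw [hs', hy])⟩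

end DisjointUnion

/-! ## Gluing maps and disjoint unions -/

namespace IsGluingMap

variable {d : ℤ} {X₁ X₂ X X₁' X₂' X' : PLManifold d}

/-- The gluing is along the empty manifold of dimension `d - 1`. This allows identities and
homeomorphisms as steps of a decomposition. -/
theorem of_bijective {π : X → X'} (h : IsPL π) (hb : Function.Bijective π) : IsGluingMap π := by
  refine ⟨d - 1, PLManifold.empty _, isEmptyElim, isEmptyElim, by ring, IsPL.of_isEmpty _,
    IsPL.of_isEmpty _, fun x => isEmptyElim x, fun x => isEmptyElim x, fun x => isEmptyElim x,
    fun x => isEmptyElim x, ?_, h, hb.2, fun x x' => ?_⟩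
  · simp [Set.range_eq_empty]
  · simp [hb.1.eq_iff]

theorem of_homeo (f : X.Homeo X') : IsGluingMap f :=
  of_bijective f.isPL f.toEquiv.bijective

theorem isPL {π : X → X'} (h : IsGluingMap π) : IsPL π := by
  obtain ⟨_, _, _, _, h⟩ := h
  exact h.isPL

/-- The disjoint union of a gluing map and a bijection is a gluing map. -/
theorem sum_bijective (J : DisjointUnion X₁ X₂ X) (J' : DisjointUnion X₁' X₂' X')
    {π₁ : X₁ → X₁'} {π₂ : X₂ → X₂'} {π : X → X'} (h₁ : IsGluingMap π₁) (h₂ : IsPL π₂)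
    (hb : Function.Bijective π₂) (hl : ∀ x, π (J.inl x) = J'.inl (π₁ x))
    (hr : ∀ x, π (J.inr x) = J'.inr (π₂ x)) : IsGluingMap π := by
  obtain ⟨e, Y, a, b, h⟩ := h₁
  refine ⟨e, Y, fun y => J.inl (a y), fun y => J.inl (b y), h.dim, J.isPL_inl.comp h.isPL_left,
    J.isPL_inl.comp h.isPL_right, J.injective_inl.comp h.injective_left,
    J.injective_inl.comp h.injective_right, fun y => (J.inl_mem_boundary _).2 (h.left_mem y),
    fun y => (J.inl_mem_boundary _).2 (h.right_mem y), ?_, J.isPL_of_comp ?_ ?_, ?_, ?_⟩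
  · refine Set.disjoint_left.2 ?_
    rintro _ ⟨y, rfl⟩ ⟨z, hz⟩
    exact Set.disjoint_left.1 h.disjoint ⟨y, rfl⟩ ⟨z, J.injective_inl hz⟩
  · simpa only [hl] using J'.isPL_inl.comp h.isPL
  · simpa only [hr] using J'.isPL_inr.comp h₂
  · rw [Function.Surjective, J'.forall_iff]
    refine ⟨fun x => ?_, fun x => ?_⟩
    · obtain ⟨y, rfl⟩ := h.surjective x
      exact ⟨_, hl y⟩
    · obtain ⟨y, rfl⟩ := hb.2 x
      exact ⟨_, hr y⟩
  · intro x x'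
    rcases J.inl_or_inr x with ⟨x, rfl⟩ | ⟨x, rfl⟩ <;>
      rcases J.inl_or_inr x' with ⟨x', rfl⟩ | ⟨x', rfl⟩
    · simp only [hl, J'.injective_inl.eq_iff, J.injective_inl.eq_iff]
      exact h.eq_iff x x'
    · simp [hl, hr, J.inl_ne_inr, J'.inl_ne_inr, (J.inl_ne_inr _ _).symm]
    · simp [hl, hr, (J'.inl_ne_inr _ _).symm, (J.inl_ne_inr _ _).symm]
    · simp [hr, J'.injective_inr.eq_iff, J.injective_inr.eq_iff, hb.1.eq_iff,
        (J.inl_ne_inr _ _).symm]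

/-- The restriction of a gluing map to a part of a disjoint union is a gluing map. -/
theorem restrict (J : DisjointUnion X₁ X₂ X) (J' : DisjointUnion X₁' X₂' X')
    {π₁ : X₁ → X₁'} {π₂ : X₂ → X₂'} {π : X → X'} (hπ : IsGluingMap π)
    (hl : ∀ x, π (J.inl x) = J'.inl (π₁ x)) (hr : ∀ x, π (J.inr x) = J'.inr (π₂ x)) :
    IsGluingMap π₁ := by
  obtain ⟨e, Y, a, b, h⟩ := hπ
  have hab : ∀ y, π (a y) = π (b y) := fun y => (h.eq_iff _ _).2 (Or.inr ⟨y, Or.inl ⟨rfl, rfl⟩⟩)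
  have hiff : ∀ x, x ∈ Set.range J.inl ↔ π x ∈ Set.range J'.inl := by
    rw [J.forall_iff]
    refine ⟨fun x => ?_, fun x => ?_⟩
    · simp [hl]
    · simp [hr, J.inl_ne_inr, J'.inl_ne_inr]
  -- Because `π` identifies `a y` with `b y` and respects the parts, the two copies of `y` lie in
  -- the same part. Cutting `Y` by the position of `a y` thus cuts both copies consistently.
  obtain ⟨Y₁, j, hj, hinj, hjr⟩ :=
    Y.exists_part (J.isClopen_range_inl.preimage h.isPL_left.continuous)
  have hja : ∀ y, a (j y) ∈ Set.range J.inl := fun y =>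
    (hjr ▸ Set.mem_range_self y : j y ∈ a ⁻¹' Set.range J.inl)
  have hjb : ∀ y, b (j y) ∈ Set.range J.inl := fun y => by
    rw [hiff, ← hab, ← hiff]
    exact hja y
  obtain ⟨a₁, ha₁, ha₁'⟩ := J.exists_factor_inl (h.isPL_left.comp hj) hja
  obtain ⟨b₁, hb₁, hb₁'⟩ := J.exists_factor_inl (h.isPL_right.comp hj) hjb
  obtain ⟨π₁', hπ₁, hπ₁'⟩ := J'.exists_factor_inl (h.isPL.comp J.isPL_inl)
    fun x => ⟨π₁ x, (hl x).symm⟩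
  obtain rfl : π₁' = π₁ := funext fun x => J'.injective_inl ((hπ₁' x).trans (hl x))
  refine ⟨e, Y₁, a₁, b₁, h.dim, ha₁, hb₁, fun x y hxy => ?_, fun x y hxy => ?_, fun y => ?_,
    fun y => ?_, ?_, hπ₁, fun x => ?_, fun x x' => ?_⟩
  · exact hinj (h.injective_left (by rw [← ha₁', ← ha₁', hxy]))
  · exact hinj (h.injective_right (by rw [← hb₁', ← hb₁', hxy]))
  · rw [← J.inl_mem_boundary, ha₁']
    exact h.left_mem _
  · rw [← J.inl_mem_boundary, hb₁']
    exact h.right_mem _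
  · refine Set.disjoint_left.2 ?_
    rintro _ ⟨y, rfl⟩ ⟨z, hz⟩
    exact Set.disjoint_left.1 h.disjoint ⟨j y, rfl⟩ ⟨j z, by rw [← hb₁', ← ha₁', hz]⟩
  · obtain ⟨z, hz⟩ := h.surjective (J'.inl x)
    obtain ⟨w, rfl⟩ := (hiff z).2 ⟨x, hz.symm⟩
    exact ⟨w, J'.injective_inl (by rw [hπ₁', hz])⟩
  · rw [← J'.injective_inl.eq_iff, hπ₁', hπ₁', h.eq_iff, J.injective_inl.eq_iff]
    refine or_congr_right ⟨?_, ?_⟩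
    · rintro ⟨y, hy⟩
      have : y ∈ Set.range j := by
        rw [hjr]
        rcases hy with ⟨hy, -⟩ | ⟨-, hy⟩
        exacts [⟨x, hy⟩, ⟨x', hy⟩]
      obtain ⟨z, rfl⟩ := this
      refine ⟨z, ?_⟩
      rwa [← ha₁', ← hb₁', J.injective_inl.eq_iff, J.injective_inl.eq_iff, J.injective_inl.eq_iff,
        J.injective_inl.eq_iff] at hy
    · rintro ⟨y, hy⟩
      refine ⟨j y, ?_⟩
      rwa [← ha₁', ← hb₁', J.injective_inl.eq_iff, J.injective_inl.eq_iff, J.injective_inl.eq_iff,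
        J.injective_inl.eq_iff]

end IsGluingMap

/-! ## Slices of tensors -/

section Slice

variable {𝕜 : Type*} [Field 𝕜] {V W V' W' : Type*} [AddCommGroup V] [Module 𝕜 V]
  [AddCommGroup W] [Module 𝕜 W] [AddCommGroup V'] [Module 𝕜 V'] [AddCommGroup W'] [Module 𝕜 W']

/-- The contraction of the second factor of a tensor with a linear form. -/
noncomputable def tensorSlice (φ : Module.Dual 𝕜 W) : V ⊗[𝕜] W →ₗ[𝕜] V :=
  (TensorProduct.rid 𝕜 V).toLinearMap ∘ₗ LinearMap.lTensor V φ

@[simp]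
theorem tensorSlice_tmul (φ : Module.Dual 𝕜 W) (v : V) (w : W) :
    tensorSlice φ (v ⊗ₜ[𝕜] w) = φ w • v := by
  simp [tensorSlice]

/-- Contraction is natural. This carries conditions on slices of a glued field back to slices of the
field before gluing. -/
theorem tensorSlice_map (H : V →ₗ[𝕜] V') (H' : W →ₗ[𝕜] W') (φ : Module.Dual 𝕜 W')
    (ρ : V ⊗[𝕜] W) :
    tensorSlice φ (TensorProduct.map H H' ρ) = H (tensorSlice (φ ∘ₗ H') ρ) := by
  have : tensorSlice φ ∘ₗ TensorProduct.map H H' = H ∘ₗ tensorSlice (φ ∘ₗ H') :=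
    TensorProduct.ext' fun v w => by simp
  exact LinearMap.congr_fun this ρ

/-- The coordinates of a tensor relative to a basis of `W` are its slices along the coordinate
forms. -/
theorem eq_of_tensorSlice_eq {ρ ρ' : V ⊗[𝕜] W}
    (h : ∀ φ : Module.Dual 𝕜 W, tensorSlice φ ρ = tensorSlice φ ρ') : ρ = ρ' := by
  classical
  let b := Module.Basis.ofVectorSpace 𝕜 W
  have key : ∀ i, (Finsupp.lapply i ∘ₗ
      (TensorProduct.equivFinsuppOfBasisRight b).toLinearMap : V ⊗[𝕜] W →ₗ[𝕜] V) =
        tensorSlice (b.coord i) := fun i =>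
    TensorProduct.ext' fun v w => by simp
  refine (TensorProduct.equivFinsuppOfBasisRight b).injective (Finsupp.ext fun i => ?_)
  have h₁ := LinearMap.congr_fun (key i) ρ
  have h₂ := LinearMap.congr_fun (key i) ρ'
  exact h₁.trans ((h _).trans h₂.symm)

theorem Submodule.exists_projection (T : Submodule 𝕜 V) :
    ∃ p : V →ₗ[𝕜] V, (∀ v, p v ∈ T) ∧ ∀ v ∈ T, p v = v := by
  obtain ⟨g, hg⟩ := LinearMap.exists_leftInverse_of_injective T.subtype T.ker_subtype
  exact ⟨T.subtype ∘ₗ g, fun v => (g v).2,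
    fun v hv => congrArg Subtype.val (LinearMap.congr_fun hg ⟨v, hv⟩)⟩

/-- A tensor all of whose slices lie in `T` and `T'` is a combination of tensors of elements of `T`
and `T'`. -/
theorem mem_span_tmul_of_tensorSlice_mem {T : Submodule 𝕜 V} {T' : Submodule 𝕜 W}
    {ρ : V ⊗[𝕜] W} (h : ∀ φ, tensorSlice φ ρ ∈ T)
    (h' : ∀ φ, tensorSlice φ (TensorProduct.comm 𝕜 V W ρ) ∈ T') :
    ρ ∈ Submodule.span 𝕜 {z | ∃ t ∈ T, ∃ t' ∈ T', z = t ⊗ₜ[𝕜] t'} := by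
  -- A projection onto `T` fixes every slice of `ρ`, so tensoring it with the identity fixes `ρ`;
  -- likewise for `T'` on the other side. Hence `p ⊗ p'` fixes `ρ`, and its range is spanned by the
  -- required tensors.
  obtain ⟨p, hp, hpT⟩ := T.exists_projection
  obtain ⟨p', hp', hpT'⟩ := T'.exists_projection
  have h₁ : TensorProduct.map p LinearMap.id ρ = ρ := eq_of_tensorSlice_eq fun φ => by
    rw [tensorSlice_map, LinearMap.comp_id, hpT _ (h φ)]
  have h₂ : TensorProduct.map LinearMap.id p' ρ = ρ := by
    refine (TensorProduct.comm 𝕜 V W).injective (eq_of_tensorSlice_eq fun φ => ?_)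
    rw [← TensorProduct.map_comm, tensorSlice_map, LinearMap.comp_id, hpT' _ (h' φ)]
  have h₃ : TensorProduct.map p p' ρ = ρ := by
    conv_rhs => rw [← h₁, ← h₂]
    rw [← LinearMap.comp_apply, ← TensorProduct.map_comp, LinearMap.comp_id, LinearMap.id_comp]
  have key : ∀ ρ : V ⊗[𝕜] W, TensorProduct.map p p' ρ ∈
      Submodule.span 𝕜 {z | ∃ t ∈ T, ∃ t' ∈ T', z = t ⊗ₜ[𝕜] t'} := fun ρ => by
    induction ρ using TensorProduct.induction_on with
    | zero => simp
    | tmul v w => exact Submodule.subset_span ⟨p v, hp v, p' w, hp' w, by simp⟩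
    | add x y hx hy => rw [map_add]; exact add_mem hx hy
  rw [← h₃]
  exact key ρ

end Slice

/-! ## Fields on disjoint unions -/

section Fields

variable {𝕜 : Type u} [Field 𝕜] {n : ℕ}

namespace BMfd

/-- The disjoint union with the two parts exchanged. -/
def DisjointUnion.symm {X₁ X₂ X : BMfd n} (J : DisjointUnion X₁ X₂ X) : DisjointUnion X₂ X₁ X :=
  ⟨J.sum.symm, J.sumBdry.symm, J.inr_comm, J.inl_comm⟩

theorem exists_disjointUnion (X₁ X₂ : BMfd n) : ∃ X, Nonempty (DisjointUnion X₁ X₂ X) := by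
  obtain ⟨X, ⟨J⟩⟩ := X₁.X.exists_disjointUnion X₂.X
  obtain ⟨Z, J', ζ, hl, hr⟩ := J.exists_boundary_union X₁.bdry X₂.bdry
  exact ⟨⟨X, Z, ζ⟩, ⟨⟨J, J', hl, hr⟩⟩⟩

theorem exists_disjointUnion_of_isClopen (X : BMfd n) {A : Set X.X} (hA : IsClopen A) :
    ∃ (X₁ X₂ : BMfd n) (J : DisjointUnion X₁ X₂ X), Set.range J.sum.inl = A := by
  obtain ⟨X₁, X₂, J, hJ⟩ := X.X.exists_disjointUnion_of_isClopen hA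
  obtain ⟨Z₁, Z₂, J', ζ₁, ζ₂, hl, hr⟩ := J.exists_boundary_split X.bdry
  exact ⟨⟨X₁, Z₁, ζ₁⟩, ⟨X₂, Z₂, ζ₂⟩, ⟨J, J', hl, hr⟩, hJ⟩

end BMfd

namespace SystemOfFields

variable (S : SystemOfFields.{u} 𝕜 n)

theorem res_union_bMfd {X₁ X₂ X : BMfd n} (J : BMfd.DisjointUnion X₁ X₂ X) (x₁ : S.Fld 0 X₁.X)
    (x₂ : S.Fld 0 X₂.X) : S.res X.bdry (S.union J.sum x₁ x₂) =
      S.union J.sumBdry (S.res X₁.bdry x₁) (S.res X₂.bdry x₂) :=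
  S.res_union _ _ _ _ _ J.inl_comm J.inr_comm _ _

theorem exists_union_eq {X₁ X₂ X : BMfd n} (J : BMfd.DisjointUnion X₁ X₂ X) (c : S.Fld 1 X.Z) :
    ∃ c₁ c₂, S.union J.sumBdry c₁ c₂ = c := by
  obtain ⟨⟨c₁, c₂⟩, h⟩ := (S.union_bijective J.sumBdry).2 c
  exact ⟨c₁, c₂, h⟩

/-- Below the top dimension a disjoint union of fields determines its two components. -/
theorem res_eq_of_union {X₁ X₂ X : BMfd n} (J : BMfd.DisjointUnion X₁ X₂ X)
    {c₁ : S.Fld 1 X₁.Z} {c₂ : S.Fld 1 X₂.Z} {x₁ : S.Fld 0 X₁.X} {x₂ : S.Fld 0 X₂.X}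
    (h : S.res X.bdry (S.union J.sum x₁ x₂) = S.union J.sumBdry c₁ c₂) :
    S.res X₁.bdry x₁ = c₁ ∧ S.res X₂.bdry x₂ = c₂ := by
  rw [res_union_bMfd] at h
  have := (S.union_bijective J.sumBdry).1 (a₁ := (S.res X₁.bdry x₁, S.res X₂.bdry x₂))
    (a₂ := (c₁, c₂)) h
  exact Prod.ext_iff.1 this

/-- The disjoint union of fields with fixed boundary conditions. -/
noncomputable def fiberUnion {X₁ X₂ X : BMfd n} (J : BMfd.DisjointUnion X₁ X₂ X)
    (c₁ : S.Fld 1 X₁.Z) (c₂ : S.Fld 1 X₂.Z) :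
    S.Fiber X₁.bdry c₁ ⊗[𝕜] S.Fiber X₂.bdry c₂ ≃ₗ[𝕜]
      S.Fiber X.bdry (S.union J.sumBdry c₁ c₂) :=
  (S.union_tensor J.sum J.sumBdry X₁.bdry X₂.bdry X.bdry J.inl_comm J.inr_comm c₁ c₂).choose

theorem fiberUnion_tmul {X₁ X₂ X : BMfd n} (J : BMfd.DisjointUnion X₁ X₂ X)
    {c₁ : S.Fld 1 X₁.Z} {c₂ : S.Fld 1 X₂.Z} (x₁ : S.Fiber X₁.bdry c₁)
    (x₂ : S.Fiber X₂.bdry c₂) :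
    (S.fiberUnion J c₁ c₂ (x₁ ⊗ₜ x₂)).1 = S.union J.sum x₁.1 x₂.1 :=
  (S.union_tensor J.sum J.sumBdry X₁.bdry X₂.bdry X.bdry J.inl_comm J.inr_comm
    c₁ c₂).choose_spec x₁ x₂

/-- Equal boundary conditions have the same vector space of fields. -/
theorem exists_fiberCast {Z : Mfd n 1} {X : Mfd n 0} (ζ : BoundaryOf Z X) {c c' : S.Fld 1 Z}
    (h : c = c') : ∃ L : S.Fiber ζ c →ₗ[𝕜] S.Fiber ζ c', ∀ x, (L x).1 = x.1 := by
  subst h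
  exact ⟨LinearMap.id, fun _ => rfl⟩

/-- This transfers statements about the first part to the second; the two fibers have boundary
conditions which are equal only by `union_comm`, so the values are compared as fields. -/
theorem fiberUnion_symm {X₁ X₂ X : BMfd n} (J : BMfd.DisjointUnion X₁ X₂ X)
    (c₁ : S.Fld 1 X₁.Z) (c₂ : S.Fld 1 X₂.Z) (ρ : S.Fiber X₁.bdry c₁ ⊗[𝕜] S.Fiber X₂.bdry c₂) :
    (S.fiberUnion J.symm c₂ c₁ (TensorProduct.comm 𝕜 _ _ ρ)).1 = (S.fiberUnion J c₁ c₂ ρ).1 := by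
  obtain ⟨L, hL⟩ := S.exists_fiberCast X.bdry
    (S.union_comm J.sumBdry J.symm.sumBdry rfl rfl c₁ c₂)
  have : L ∘ₗ (S.fiberUnion J.symm c₂ c₁).toLinearMap ∘ₗ
      (TensorProduct.comm 𝕜 _ _).toLinearMap = (S.fiberUnion J c₁ c₂).toLinearMap :=
    TensorProduct.ext' fun x₁ x₂ => Subtype.ext <| by
      simp only [LinearMap.comp_apply, LinearEquiv.coe_coe, TensorProduct.comm_tmul, hL,
        fiberUnion_tmul]
      exact S.union_comm J.sum J.symm.sum rfl rfl _ _
  rw [← hL]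
  exact congrArg Subtype.val (LinearMap.congr_fun this ρ)

theorem exists_glueLinear {X X' : BMfd n} {π : X.X → X'.X} (hπ : IsGluingMap π)
    {c : S.Fld 1 X.Z} {c' : S.Fld 1 X'.Z} (x₀ : S.Fiber X.bdry c) (x₀' : S.Fiber X'.bdry c')
    (h : S.Glue π x₀.1 x₀'.1) : ∃ L : S.Fiber X.bdry c →ₗ[𝕜] S.Fiber X'.bdry c',
      Function.Injective L ∧ ∀ x, S.Glue π x.1 (L x).1 := by
  obtain ⟨x₀, rfl⟩ := x₀
  obtain ⟨x₀', rfl⟩ := x₀'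
  exact S.glue_linear X.bdry X'.bdry hπ x₀ x₀' h

/-- Gluing of fields with fixed boundary condition along a disjoint union of gluing maps is the
tensor product of the gluings along the parts. -/
theorem exists_glueLinear_union {X₁ X₂ X X₁' X₂' X' : BMfd n} (J : BMfd.DisjointUnion X₁ X₂ X)
    (J' : BMfd.DisjointUnion X₁' X₂' X') {π₁ : X₁.X → X₁'.X} {π₂ : X₂.X → X₂'.X}
    {π : X.X → X'.X} (h₁ : IsGluingMap π₁) (h₂ : IsGluingMap π₂) (hπ : IsGluingMap π)
    (hl : ∀ x, π (J.sum.inl x) = J'.sum.inl (π₁ x)) (hr : ∀ x, π (J.sum.inr x) = J'.sum.inr (π₂ x))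
    {c₁ : S.Fld 1 X₁.Z} {c₂ : S.Fld 1 X₂.Z} {c₁' : S.Fld 1 X₁'.Z} {c₂' : S.Fld 1 X₂'.Z}
    {x : S.Fld 0 X.X} {x' : S.Fld 0 X'.X} (hx : S.Glue π x x')
    (hc : S.union J.sumBdry c₁ c₂ = S.res X.bdry x)
    (hc' : S.union J'.sumBdry c₁' c₂' = S.res X'.bdry x') :
    ∃ (G₁ : S.Fiber X₁.bdry c₁ →ₗ[𝕜] S.Fiber X₁'.bdry c₁')
      (G₂ : S.Fiber X₂.bdry c₂ →ₗ[𝕜] S.Fiber X₂'.bdry c₂'),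
      Function.Injective G₁ ∧ Function.Injective G₂ ∧ (∀ u, S.Glue π₁ u.1 (G₁ u).1) ∧
      (∀ u, S.Glue π₂ u.1 (G₂ u).1) ∧
      ∀ ρ, S.Glue π (S.fiberUnion J c₁ c₂ ρ).1
        (S.fiberUnion J' c₁' c₂' (TensorProduct.map G₁ G₂ ρ)).1 := by
  obtain ⟨L, -, hL⟩ := S.exists_glueLinear hπ (⟨x, hc.symm⟩ : S.Fiber X.bdry _)
    (⟨x', hc'.symm⟩ : S.Fiber X'.bdry _) hx
  -- The field `x` need not be a disjoint union of fields, so it says nothing directly about gluing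
  -- on the parts. The pair of zero fields does form a disjoint union, with the same boundary
  -- condition as `x`; hence it glues, and it supplies the base points for linear gluing on each
  -- part.
  have h0 := hL (S.fiberUnion J c₁ c₂ (0 ⊗ₜ 0))
  rw [fiberUnion_tmul, S.glue_union J.sum J'.sum h₁ h₂ hπ hl hr] at h0
  obtain ⟨u, v, hu, hv, huv⟩ := h0
  have hres : S.res X'.bdry (S.union J'.sum u v) = S.union J'.sumBdry c₁' c₂' := by
    rw [← huv]
    exact (L _).2
  obtain ⟨hu', hv'⟩ := S.res_eq_of_union J' hres
  obtain ⟨G₁, hinj₁, hG₁⟩ := S.exists_glueLinear h₁ 0 (⟨u, hu'⟩ : S.Fiber X₁'.bdry _) hu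
  obtain ⟨G₂, hinj₂, hG₂⟩ := S.exists_glueLinear h₂ 0 (⟨v, hv'⟩ : S.Fiber X₂'.bdry _) hv
  refine ⟨G₁, G₂, hinj₁, hinj₂, hG₁, hG₂, fun ρ => ?_⟩
  have : L ∘ₗ (S.fiberUnion J c₁ c₂).toLinearMap =
      (S.fiberUnion J' c₁' c₂').toLinearMap ∘ₗ TensorProduct.map G₁ G₂ :=
    TensorProduct.ext' fun x₁ x₂ => Subtype.ext <| by
      refine S.glue_unique hπ (hL _) ?_
      simp only [LinearMap.comp_apply, LinearEquiv.coe_coe, TensorProduct.map_tmul,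
        fiberUnion_tmul]
      rw [S.glue_union J.sum J'.sum h₁ h₂ hπ hl hr]
      exact ⟨_, _, hG₁ _, hG₂ _, rfl⟩
  have h := hL (S.fiberUnion J c₁ c₂ ρ)
  rwa [show L (S.fiberUnion J c₁ c₂ ρ) = _ from LinearMap.congr_fun this ρ] at h

end SystemOfFields

/-! ## Restrictions to ball components -/

/-- The fields with boundary condition `c` whose restriction to the ball component `C` lies
in `U`. -/
def restrictionSpace (S : SystemOfFields.{u} 𝕜 n) (U : ∀ B : Mfd n 0, Set (S.Fld 0 B))
    {Z : Mfd n 1} {M : Mfd n 0} (ζ : BoundaryOf Z M) (C : BallComponent M) (c : S.Fld 1 Z) :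
    Submodule 𝕜 (S.Fiber ζ c) :=
  Submodule.span 𝕜 {y | ∃ u ∈ U C.B, ∃ v, y.1 = S.union C.sum u v}

/-- In `RestrictsInto` the boundary condition is that of the field itself. Fixing it in advance
turns the condition into membership in a subspace, to which linear maps can be applied. -/
theorem restrictsInto_iff {S : SystemOfFields.{u} 𝕜 n} {U : ∀ B : Mfd n 0, Set (S.Fld 0 B)}
    {Z : Mfd n 1} {M : Mfd n 0} {ζ : BoundaryOf Z M} {C : BallComponent M} {c : S.Fld 1 Z}
    (x : S.Fiber ζ c) : RestrictsInto S U ζ C x.1 ↔ x ∈ restrictionSpace S U ζ C c := by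
  obtain ⟨x, rfl⟩ := x
  rfl

namespace DisjointUnion

/-- A part of a part of `X` is a part of `X`. -/
theorem exists_assoc' {d : ℤ} {X₁ X₂ X B R : PLManifold d} (J : DisjointUnion X₁ X₂ X)
    (C : DisjointUnion B R X₁) :
    ∃ (R' : PLManifold d) (K : DisjointUnion R X₂ R') (C' : DisjointUnion B R' X),
      (∀ b, C'.inl b = J.inl (C.inl b)) ∧ (∀ x, C'.inr (K.inl x) = J.inl (C.inr x)) ∧
      ∀ x, C'.inr (K.inr x) = J.inr x := by
  obtain ⟨R', ⟨K⟩⟩ := R.exists_disjointUnion X₂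
  obtain ⟨h, hl, hr⟩ := K.exists_desc (fun x => J.inl (C.inr x)) J.inr
  refine ⟨R', K, ⟨fun b => J.inl (C.inl b), h, J.isPL_inl.comp C.isPL_inl,
    K.isPL_of_comp ?_ ?_, J.injective_inl.comp C.injective_inl, ?_, IsCompl.of_eq ?_ ?_⟩,
    fun _ => rfl, hl, hr⟩
  · simpa only [hl] using J.isPL_inl.comp C.isPL_inr
  · simpa only [hr] using J.isPL_inr
  · intro x y
    rcases K.inl_or_inr x with ⟨x, rfl⟩ | ⟨x, rfl⟩ <;>
      rcases K.inl_or_inr y with ⟨y, rfl⟩ | ⟨y, rfl⟩ <;> simp only [hl, hr] <;> intro hxy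
    · rw [C.injective_inr (J.injective_inl hxy)]
    · exact (J.inl_ne_inr _ _ hxy).elim
    · exact (J.inl_ne_inr _ _ hxy.symm).elim
    · rw [J.injective_inr hxy]
  · refine Set.eq_empty_of_forall_notMem ?_
    rintro _ ⟨⟨b, rfl⟩, ⟨x, hx⟩⟩
    rcases K.inl_or_inr x with ⟨x, rfl⟩ | ⟨x, rfl⟩
    · rw [hl] at hx
      exact C.inl_ne_inr _ _ (J.injective_inl hx).symm
    · rw [hr] at hx
      exact J.inl_ne_inr _ _ hx.symm
  · refine Set.eq_univ_of_forall fun x => ?_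
    rcases J.inl_or_inr x with ⟨x, rfl⟩ | ⟨x, rfl⟩
    · rcases C.inl_or_inr x with ⟨b, rfl⟩ | ⟨x, rfl⟩
      · exact Or.inl ⟨b, rfl⟩
      · exact Or.inr ⟨K.inl x, hl x⟩
    · exact Or.inr ⟨K.inr x, hr x⟩

end DisjointUnion

/-- A ball component of a part of `N` is a ball component of `N`, and the restriction of a disjoint
union of fields to it is the restriction of the field on the part. -/
theorem BallComponent.exists_extend {S : SystemOfFields.{u} 𝕜 n}
    {U : ∀ B : Mfd n 0, Set (S.Fld 0 B)} {N₁ N₂ N : BMfd n}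
    (K : BMfd.DisjointUnion N₁ N₂ N) (C : BallComponent N₁.X) :
    ∃ C' : BallComponent N.X,
      Set.range C'.sum.inl = Set.range (fun b => K.sum.inl (C.sum.inl b)) ∧
      ∀ r t, RestrictsInto S U N₁.bdry C r →
        RestrictsInto S U N.bdry C' (S.union K.sum r t) := by
  obtain ⟨R', K', C', hl, hlr, hr⟩ := K.sum.exists_assoc' C.sum
  refine ⟨⟨C.B, R', C', C.isBall⟩, congrArg Set.range (funext hl), fun r t h => ?_⟩
  let y : S.Fiber N₁.bdry (S.res N₁.bdry r) := ⟨r, rfl⟩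
  let w : S.Fiber N₂.bdry (S.res N₂.bdry t) := ⟨t, rfl⟩
  have hmem : ∀ y ∈ restrictionSpace S U N₁.bdry C (S.res N₁.bdry r),
      S.fiberUnion K _ _ (y ⊗ₜ w) ∈
        restrictionSpace S U N.bdry ⟨C.B, R', C', C.isBall⟩ _ := by
    intro y hy
    induction hy using Submodule.span_induction with
    | zero => rw [TensorProduct.zero_tmul, map_zero]; exact zero_mem _
    | add y z _ _ hy hz => rw [TensorProduct.add_tmul, map_add]; exact add_mem hy hz
    | smul a y _ hy =>
      rw [← TensorProduct.smul_tmul', map_smul]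
      exact Submodule.smul_mem _ _ hy
    | mem y hy =>
      obtain ⟨u, hu, v, hv⟩ := hy
      refine Submodule.subset_span ⟨u, hu, S.union K' v t, ?_⟩
      rw [S.fiberUnion_tmul, hv]
      -- On a generator this is `(u ⊔ v) ⊔ t = u ⊔ (v ⊔ t)`: the field `t` is absorbed into the
      -- rest.
      exact S.union_assoc C.sum K.sum K' C' (fun b => (hl b).symm) (fun x => (hlr x).symm)
        (fun x => (hr x).symm) u v t
  have := (restrictsInto_iff _).2 (hmem y h)
  rwa [S.fiberUnion_tmul] at this

/-- A ball component of `N` which lies in a part of `N` is a ball component of that part, and the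
restriction of a disjoint union of fields to it is the restriction of the field on the part. -/
theorem BallComponent.exists_restrict {S : SystemOfFields.{u} 𝕜 n}
    {U : ∀ B : Mfd n 0, Set (S.Fld 0 B)} {N₁ N₂ N : BMfd n}
    (K : BMfd.DisjointUnion N₁ N₂ N) (C : BallComponent N.X)
    (h : ∀ b, C.sum.inl b ∈ Set.range K.sum.inl) :
    ∃ C₁ : BallComponent N₁.X,
      Set.range (fun b => K.sum.inl (C₁.sum.inl b)) = Set.range C.sum.inl ∧
      ∀ (c₁ : S.Fld 1 N₁.Z) (c₂ : S.Fld 1 N₂.Z) (ρ : S.Fiber N₁.bdry c₁ ⊗[𝕜] S.Fiber N₂.bdry c₂),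
        RestrictsInto S U N.bdry C (S.fiberUnion K c₁ c₂ ρ).1 →
        ∀ φ, tensorSlice φ ρ ∈ restrictionSpace S U N₁.bdry C₁ c₁ := by
  obtain ⟨R₁, C₁, K', hl, hlr, hr⟩ := K.sum.exists_assoc C.sum h
  refine ⟨⟨C.B, R₁, C₁, C.isBall⟩, congrArg Set.range (funext hl), fun c₁ c₂ ρ hρ φ => ?_⟩
  let W := restrictionSpace S U N₁.bdry ⟨C.B, R₁, C₁, C.isBall⟩ c₁
  rw [restrictsInto_iff] at hρ
  suffices hle : restrictionSpace S U N.bdry C (S.union K.sumBdry c₁ c₂) ≤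
      W.comap (tensorSlice φ ∘ₗ (S.fiberUnion K c₁ c₂).symm.toLinearMap) by
    have := hle hρ
    rwa [Submodule.mem_comap, LinearMap.comp_apply, LinearEquiv.coe_coe,
      LinearEquiv.symm_apply_apply] at this
  refine Submodule.span_le.2 ?_
  rintro y ⟨u, hu, v, hy⟩
  obtain ⟨ZB, ZR, JZ, ζB, ζR, hBl, hBr⟩ := C.sum.exists_boundary_split N.bdry
  obtain ⟨Z₁, Z₂, KZ, ζ₁, ζ₂, hZl, hZr⟩ := K'.exists_boundary_split ζR
  let KR : BMfd.DisjointUnion (⟨R₁, Z₁, ζ₁⟩ : BMfd n) ⟨N₂.X, Z₂, ζ₂⟩ ⟨C.rest, ZR, ζR⟩ :=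
    ⟨K', KZ, hZl, hZr⟩
  let KC : BMfd.DisjointUnion (⟨C.B, ZB, ζB⟩ : BMfd n) ⟨C.rest, ZR, ζR⟩ N := ⟨C.sum, JZ, hBl, hBr⟩
  -- The rest of the ball in `N` is `R₁ ⊔ N₂`, so `v` is a combination of fields `v₁ ⊔ w` with
  -- boundary conditions `d₁` and `d₂`.
  obtain ⟨d₁, d₂, hd⟩ := S.exists_union_eq KR (S.res ζR v)
  have hcy : S.union JZ (S.res ζB u) (S.union KZ d₁ d₂) = S.union K.sumBdry c₁ c₂ := by
    rw [show S.union KZ d₁ d₂ = _ from hd, ← y.2, hy]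
    exact (S.res_union_bMfd KC u v).symm
  obtain ⟨T, hT⟩ := S.exists_fiberCast N.bdry hcy
  let u' : S.Fiber ζB (S.res ζB u) := ⟨u, rfl⟩
  let v' : S.Fiber ζR (S.union KZ d₁ d₂) := ⟨v, hd.symm⟩
  -- Adding the fixed field `u` is linear in the field on the rest, so the claim for `v` follows
  -- from the pure tensors `v₁ ⊗ w`. There reassociation gives `(u ⊔ v₁) ⊔ w`, whose slice is a
  -- multiple of `u ⊔ v₁`.
  let Q : S.Fiber ζR (S.union KZ d₁ d₂) →ₗ[𝕜] S.Fiber N.bdry (S.union K.sumBdry c₁ c₂) :=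
    T ∘ₗ (S.fiberUnion KC _ _).toLinearMap ∘ₗ TensorProduct.mk 𝕜 _ _ u'
  have hQ : ∀ w, (Q w).1 = S.union C.sum u w.1 := fun w => (hT _).trans (S.fiberUnion_tmul KC _ _)
  have hyQ : y = Q v' := Subtype.ext (hy.trans (hQ v').symm)
  have key : ∀ τ, Q (S.fiberUnion KR d₁ d₂ τ) ∈
      W.comap (tensorSlice φ ∘ₗ (S.fiberUnion K c₁ c₂).symm.toLinearMap) := by
    intro τ
    induction τ using TensorProduct.induction_on with
    | zero => rw [map_zero, map_zero]; exact zero_mem _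
    | add τ τ' h h' => rw [map_add, map_add]; exact add_mem h h'
    | tmul v₁ w =>
      have hval : (Q (S.fiberUnion KR d₁ d₂ (v₁ ⊗ₜ w))).1 =
          S.union K.sum (S.union C₁ u v₁.1) w.1 := by
        rw [hQ, S.fiberUnion_tmul]
        exact (S.union_assoc C₁ K.sum K' C.sum hl hlr hr u v₁.1 w.1).symm
      -- The field `w` was given a boundary condition for the presentation `ζ₂`, not for `N₂.bdry`;
      -- the conditions `c₁`, `c₂` are recovered from that of the whole field.
      obtain ⟨hc₁, hc₂⟩ := S.res_eq_of_union K ((congrArg _ hval).symm.trans (Q _).2)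
      let a : S.Fiber N₁.bdry c₁ := ⟨_, hc₁⟩
      let b : S.Fiber N₂.bdry c₂ := ⟨_, hc₂⟩
      have : Q (S.fiberUnion KR d₁ d₂ (v₁ ⊗ₜ w)) = S.fiberUnion K c₁ c₂ (a ⊗ₜ b) :=
        Subtype.ext (hval.trans (S.fiberUnion_tmul K a b).symm)
      rw [Submodule.mem_comap, LinearMap.comp_apply, this, LinearEquiv.coe_coe,
        LinearEquiv.symm_apply_apply, tensorSlice_tmul]
      exact Submodule.smul_mem _ _ (Submodule.subset_span ⟨u, hu, v₁.1, rfl⟩)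
  have := key ((S.fiberUnion KR d₁ d₂).symm v')
  rw [LinearEquiv.apply_symm_apply] at this
  rw [hyQ]
  exact this

end Fields

/-! ## Juxtaposition of configurations -/

/-- The ordered union of `p` and `q` indices. -/
def finSumEquiv {p q k : ℕ} (h : p + q = k) : Fin p ⊕ Fin q ≃ Fin k :=
  finSumFinEquiv.trans (finCongr h)

theorem finSumEquiv_inl_val {p q k : ℕ} (h : p + q = k) (i : Fin p) :
    (finSumEquiv h (Sum.inl i) : ℕ) = i := rfl

theorem finSumEquiv_inr_val {p q k : ℕ} (h : p + q = k) (i : Fin q) :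
    (finSumEquiv h (Sum.inr i) : ℕ) = p + i := rfl

section Blob

variable {𝕜 : Type u} [Field 𝕜] {n : ℕ} {S : SystemOfFields.{u} 𝕜 n} (U : LocalRelation S)

/-- The juxtaposition of configurations of blobs. -/
def BMfd.DisjointUnion.blobs {X₁ X₂ X : BMfd n} (J : BMfd.DisjointUnion X₁ X₂ X) {p q k : ℕ}
    (h : p + q = k) (α : Fin p → Set X₁.X) (β : Fin q → Set X₂.X) (i : Fin k) : Set X.X :=
  Sum.elim (fun i => J.sum.inl '' α i) (fun i => J.sum.inr '' β i) ((finSumEquiv h).symm i)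

section

variable {X₁ X₂ X : BMfd n} (J : BMfd.DisjointUnion X₁ X₂ X) {p q k : ℕ}
    (h : p + q = k) (α : Fin p → Set X₁.X) (β : Fin q → Set X₂.X)

@[simp]
theorem BMfd.DisjointUnion.blobs_inl (i : Fin p) :
    J.blobs h α β (finSumEquiv h (Sum.inl i)) = J.sum.inl '' α i := by
  simp [blobs]

@[simp]
theorem BMfd.DisjointUnion.blobs_inr (i : Fin q) :
    J.blobs h α β (finSumEquiv h (Sum.inr i)) = J.sum.inr '' β i := by
  simp [blobs]

theorem forall_fin_iff {P : Fin k → Prop} : (∀ i, P i) ↔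
    (∀ i, P (finSumEquiv h (Sum.inl i))) ∧ ∀ i, P (finSumEquiv h (Sum.inr i)) := by
  rw [← (finSumEquiv h).forall_congr_right, Sum.forall]

end

/-! ## Stages of gluing decompositions -/

/-- A field on a manifold with a map to `X`. -/
structure BlobStage (S : SystemOfFields.{u} 𝕜 n) (X : Mfd n 0) where
  M : BMfd n
  toX : M.X → X
  fld : S.Fld 0 M.X

namespace BlobStage

/-- The stage `t` is glued from the stage `s`. -/
def Step {X : Mfd n 0} (s t : BlobStage S X) : Prop :=
  ∃ π : s.M.X → t.M.X, IsGluingMap π ∧ (∀ x, t.toX (π x) = s.toX x) ∧ S.Glue π s.fld t.fld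

/-- The last stage. -/
def last (X : BMfd n) (x : S.Fld 0 X.X) : BlobStage S X.X := ⟨X, fun x => x, x⟩

theorem glue_id {k : ℕ} {X : Mfd n k} (x : S.Fld k X) : S.Glue (fun y : X => y) x x :=
  (S.glue_homeo (PLHomeo.refl X.carrier) x x).2 (S.map_refl x).symm

theorem isGluingMap_id {d : ℤ} (X : PLManifold d) : IsGluingMap (fun y : X => y) :=
  IsGluingMap.of_bijective (IsPL.id _) Function.bijective_id

theorem step_last_last (X : BMfd n) (x : S.Fld 0 X.X) : (last X x).Step (last X x) :=
  ⟨fun y => y, isGluingMap_id _, fun _ => rfl, glue_id x⟩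

end BlobStage

/-- Blob diagrams from sequences of stages. -/
theorem IsBlobDiagram.of_stages {X : BMfd n} {k : ℕ} {β : Fin k → Set X.X} {x : S.Fld 0 X.X}
    (m : ℕ) (st : ∀ l, l ≤ m → BlobStage S X.X)
    (hstep : ∀ l (hl : l + 1 ≤ m), (st l (Nat.le_of_succ_le hl)).Step (st (l + 1) hl))
    (hlast : (st m le_rfl).Step (BlobStage.last X x))
    (hβ : ∀ i, ∃ l, ∃ hl : l ≤ m, ∃ C : BallComponent (st l hl).M.X,
      Set.range (fun b => (st l hl).toX (C.sum.inl b)) = β i ∧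
      ((∀ j, ¬ β j ⊂ β i) → RestrictsInto S U.U (st l hl).M.bdry C (st l hl).fld)) :
    IsBlobDiagram U β x := by
  -- After stage `m` the sequence is continued constantly by `X` itself. The decomposition has
  -- length `m + 1`, so the last map to `X` may be any gluing map and the concluding homeomorphism
  -- is the identity.
  let s : ℕ → BlobStage S X.X := fun l => if hl : l ≤ m then st l hl else BlobStage.last X x
  have hs : ∀ l (hl : l ≤ m), s l = st l hl := fun l hl => dif_pos hl
  have hs' : ∀ l, m < l → s l = BlobStage.last X x := fun l hl => dif_neg (not_le.2 hl)
  have hall : ∀ l, (s l).Step (s (l + 1)) := fun l => by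
    rcases lt_trichotomy l m with hl | rfl | hl
    · rw [hs l hl.le, hs (l + 1) hl]
      exact hstep l hl
    · rw [hs l le_rfl, hs' (l + 1) (Nat.lt_succ_self l)]
      exact hlast
    · rw [hs' l hl, hs' (l + 1) (hl.trans (Nat.lt_succ_self l))]
      exact BlobStage.step_last_last X x
  choose π hπ hcomm hglue using hall
  have htop : ∃ top : (s (m + 1)).M.X.Homeo X.X, (∀ y, (s (m + 1)).toX y = top y) ∧
      S.map top (s (m + 1)).fld = x := by
    rw [hs' (m + 1) (Nat.lt_succ_self m)]
    exact ⟨PLHomeo.refl _, fun _ => rfl, S.map_refl x⟩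
  obtain ⟨top, htop, hx⟩ := htop
  refine ⟨⟨m + 1, fun l => (s l).M.X, fun l => (s l).M.Z, fun l => (s l).M.bdry, π,
    fun l _ => hπ l, top, fun l => (s l).toX, htop, fun l _ => hcomm l⟩, fun l => (s l).fld,
    ⟨fun l _ => hglue l, hx⟩, fun i => ?_⟩
  obtain ⟨l, hl, hC⟩ := hβ i
  refine ⟨l, hl.trans (Nat.le_succ m), ?_⟩
  rw [← hs l hl] at hC
  exact hC

/-- Gluing one part of a disjoint union. -/
theorem exists_glue_part {N₁ N₂ N N₁' N₂' N' : BMfd n} (K : BMfd.DisjointUnion N₁ N₂ N)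
    (K' : BMfd.DisjointUnion N₁' N₂' N') {π₁ : N₁.X → N₁'.X} {π₂ : N₂.X → N₂'.X}
    (h₁ : IsGluingMap π₁) (h₂ : IsPL π₂) (hb : Function.Bijective π₂) {r₁ : S.Fld 0 N₁.X}
    {r₂ : S.Fld 0 N₂.X} {r₁' : S.Fld 0 N₁'.X} {r₂' : S.Fld 0 N₂'.X} (hr₁ : S.Glue π₁ r₁ r₁')
    (hr₂ : S.Glue π₂ r₂ r₂') :
    ∃ π : N.X → N'.X, IsGluingMap π ∧ (∀ x, π (K.sum.inl x) = K'.sum.inl (π₁ x)) ∧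
      (∀ x, π (K.sum.inr x) = K'.sum.inr (π₂ x)) ∧
      S.Glue π (S.union K.sum r₁ r₂) (S.union K'.sum r₁' r₂') := by
  obtain ⟨π, hl, hr⟩ := K.sum.exists_desc (fun x => K'.sum.inl (π₁ x))
    fun x => K'.sum.inr (π₂ x)
  have hπ : IsGluingMap π := IsGluingMap.sum_bijective K.sum K'.sum h₁ h₂ hb hl hr
  exact ⟨π, hπ, hl, hr, (S.glue_union K.sum K'.sum h₁ (IsGluingMap.of_bijective h₂ hb) hπ hl hr
    _ _ _).2 ⟨_, _, hr₁, hr₂, rfl⟩⟩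

/-- The juxtaposition of blob diagrams is a blob diagram. -/
theorem IsBlobDiagram.union {X₁ X₂ X : BMfd n} (J : BMfd.DisjointUnion X₁ X₂ X) {p q k : ℕ}
    (h : p + q = k) {α : Fin p → Set X₁.X} {β : Fin q → Set X₂.X} {x₁ : S.Fld 0 X₁.X}
    {x₂ : S.Fld 0 X₂.X} (h₁ : IsBlobDiagram U α x₁) (h₂ : IsBlobDiagram U β x₂) :
    IsBlobDiagram U (J.blobs h α β) (S.union J.sum x₁ x₂) := by
  obtain ⟨D₁, r₁, hr₁, hα⟩ := h₁
  obtain ⟨D₂, r₂, hr₂, hβ⟩ := h₂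
  have hN : ∀ i j, ∃ (N : BMfd n), Nonempty (BMfd.DisjointUnion
      (⟨D₁.M i, D₁.bdryM i, D₁.bdry i⟩ : BMfd n) ⟨D₂.M j, D₂.bdryM j, D₂.bdry j⟩ N) :=
    fun i j => BMfd.exists_disjointUnion _ _
  choose N K using hN
  let K := fun i j => (K i j).some
  have htoX : ∀ i j, ∃ t : (N i j).X → X.X,
      (∀ y, t ((K i j).sum.inl y) = J.sum.inl (D₁.toX i y)) ∧
      ∀ y, t ((K i j).sum.inr y) = J.sum.inr (D₂.toX j y) :=
    fun i j => (K i j).sum.exists_desc _ _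
  choose t htl htr using htoX
  -- The stages of the two decompositions form a grid; one step in either direction glues one part
  -- and leaves the other fixed.
  let stage : ℕ → ℕ → BlobStage S X.X := fun i j =>
    ⟨N i j, t i j, S.union (K i j).sum (r₁ i) (r₂ j)⟩
  have step₁ : ∀ i j, i < D₁.m → (stage i j).Step (stage (i + 1) j) := fun i j hi => by
    obtain ⟨π, hπ, hl, hr, hg⟩ := exists_glue_part (K i j) (K (i + 1) j) (D₁.isGluingMap i hi)
      (IsPL.id _) Function.bijective_id (hr₁.glue i hi) (BlobStage.glue_id (r₂ j))
    refine ⟨π, hπ, ((K i j).sum.forall_iff).2 ⟨fun y => ?_, fun y => ?_⟩, hg⟩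
    · change t (i + 1) j (π _) = t i j _
      rw [hl, htl, htl, D₁.toX_step i hi]
    · change t (i + 1) j (π _) = t i j _
      rw [hr, htr, htr]
  have step₂ : ∀ i j, j < D₂.m → (stage i j).Step (stage i (j + 1)) := fun i j hj => by
    obtain ⟨π, hπ, hl, hr, hg⟩ := exists_glue_part (K i j).symm (K i (j + 1)).symm
      (D₂.isGluingMap j hj) (IsPL.id _) Function.bijective_id (hr₂.glue j hj)
      (BlobStage.glue_id (r₁ i))
    rw [S.union_comm (K i j).sum (K i j).symm.sum rfl rfl,
      S.union_comm (K i (j + 1)).sum (K i (j + 1)).symm.sum rfl rfl] at hg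
    refine ⟨π, hπ, ((K i j).sum.forall_iff).2 ⟨fun y => ?_, fun y => ?_⟩, hg⟩
    · change t i (j + 1) (π _) = t i j _
      rw [show π ((K i j).sum.inl y) = (K i (j + 1)).sum.inl y from hr y, htl, htl]
    · change t i (j + 1) (π _) = t i j _
      rw [show π ((K i j).sum.inr y) = (K i (j + 1)).sum.inr (D₂.π j y) from hl y, htr, htr,
        D₂.toX_step j hj]
  have hstrict : ∀ {A : Type} {f : A → X.X}, Function.Injective f → ∀ {s t : Set A}, s ⊂ t →
      f '' s ⊂ f '' t := fun hf _ _ hst => hf.image_strictMono hst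
  -- The path through the grid runs along `j = 0` until `i = D₁.m`, and then in the direction of
  -- `j`; truncated subtraction keeps `j` at `0` during the first leg.
  refine IsBlobDiagram.of_stages U (D₁.m + D₂.m) (fun l _ => stage (min l D₁.m) (l - D₁.m))
    (fun l hl => ?_) ?_ ((forall_fin_iff h).2 ⟨fun i => ?_, fun i => ?_⟩)
  · rcases lt_or_ge l D₁.m with h' | h'
    · rw [min_eq_left h'.le, min_eq_left h', Nat.sub_eq_zero_of_le h'.le,
        Nat.sub_eq_zero_of_le h']
      exact step₁ _ _ h'
    · rw [min_eq_right h', min_eq_right (h'.trans (Nat.le_succ l)), Nat.sub_add_comm h']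
      exact step₂ _ _ (by omega)
  · rw [min_eq_right (Nat.le_add_right _ _), Nat.add_sub_cancel_left]
    obtain ⟨π, hπ, hl, hr, hg⟩ := exists_glue_part (K D₁.m D₂.m) J
      (N₁ := ⟨_, _, D₁.bdry _⟩) (N₂ := ⟨_, _, D₂.bdry _⟩)
      (IsGluingMap.of_homeo D₁.top) D₂.top.isPL D₂.top.toEquiv.bijective
      ((S.glue_homeo D₁.top _ _).2 hr₁.top.symm) ((S.glue_homeo D₂.top _ _).2 hr₂.top.symm)
    refine ⟨π, hπ, ((K D₁.m D₂.m).sum.forall_iff).2 ⟨fun y => ?_, fun y => ?_⟩, hg⟩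
    · exact (hl y).trans ((congrArg J.sum.inl (D₁.toX_top y)).symm.trans (htl _ _ y).symm)
    · exact (hr y).trans ((congrArg J.sum.inr (D₂.toX_top y)).symm.trans (htr _ _ y).symm)
  · obtain ⟨l, hl, C, hC, hU⟩ := hα i
    -- A ball of stage `l` of the first decomposition appears at position `(l, 0)` of the grid.
    obtain ⟨C', hC', hres⟩ := BallComponent.exists_extend (S := S) (U := U.U) (K l 0) C
    refine ⟨l, hl.trans (Nat.le_add_right _ _), ?_⟩
    rw [min_eq_left hl, Nat.sub_eq_zero_of_le hl]
    refine ⟨C', ?_, fun hj => hres _ _ (hU fun j hj' => ?_)⟩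
    · change Set.range (t l 0 ∘ C'.sum.inl) = _
      rw [Set.range_comp, hC', ← Set.range_comp, J.blobs_inl, ← hC, GluingDecomposition.image,
        ← Set.range_comp]
      exact congrArg Set.range (funext fun b => htl l 0 _)
    · refine hj (finSumEquiv h (Sum.inl j)) ?_
      rw [J.blobs_inl, J.blobs_inl]
      exact hstrict J.sum.injective_inl hj'
  · obtain ⟨l, hl, C, hC, hU⟩ := hβ i
    -- A ball of stage `l` of the second decomposition appears once the first part is completely
    -- glued, at position `(D₁.m, l)`.
    obtain ⟨C', hC', hres⟩ := BallComponent.exists_extend (S := S) (U := U.U) (K D₁.m l).symm C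
    refine ⟨D₁.m + l, Nat.add_le_add_left hl _, ?_⟩
    rw [min_eq_right (Nat.le_add_right _ _), Nat.add_sub_cancel_left]
    refine ⟨C', ?_, fun hj => ?_⟩
    · change Set.range (t D₁.m l ∘ C'.sum.inl) = _
      rw [Set.range_comp, hC', ← Set.range_comp, J.blobs_inr, ← hC, GluingDecomposition.image,
        ← Set.range_comp]
      exact congrArg Set.range (funext fun b => htr D₁.m l _)
    · have := hres (r₂ l) (r₁ D₁.m) (hU fun j hj' => ?_)
      · rwa [S.union_comm (K D₁.m l).sum (K D₁.m l).symm.sum rfl rfl] at this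
      · refine hj (finSumEquiv h (Sum.inr j)) ?_
        rw [J.blobs_inr, J.blobs_inr]
        exact hstrict J.sum.injective_inr hj'

theorem fiberUnion_mem_blobSpace {X₁ X₂ X : BMfd n} (J : BMfd.DisjointUnion X₁ X₂ X) {p q k : ℕ}
    (h : p + q = k) {c₁ : S.Fld 1 X₁.Z} {c₂ : S.Fld 1 X₂.Z} {α : Fin p → Set X₁.X}
    {β : Fin q → Set X₂.X} {x₁ : S.Fiber X₁.bdry c₁} {x₂ : S.Fiber X₂.bdry c₂}
    (h₁ : x₁ ∈ blobSpace U X₁ c₁ α) (h₂ : x₂ ∈ blobSpace U X₂ c₂ β) :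
    S.fiberUnion J c₁ c₂ (x₁ ⊗ₜ x₂) ∈
      blobSpace U X (S.union J.sumBdry c₁ c₂) (J.blobs h α β) := by
  induction h₁ using Submodule.span_induction with
  | zero => rw [TensorProduct.zero_tmul, map_zero]; exact zero_mem _
  | add y z _ _ hy hz => rw [TensorProduct.add_tmul, map_add]; exact add_mem hy hz
  | smul a y _ hy =>
    rw [← TensorProduct.smul_tmul', map_smul]
    exact Submodule.smul_mem _ _ hy
  | mem y hy =>
    induction h₂ using Submodule.span_induction with
    | zero => rw [TensorProduct.tmul_zero, map_zero]; exact zero_mem _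
    | add z w _ _ hz hw => rw [TensorProduct.tmul_add, map_add]; exact add_mem hz hw
    | smul a z _ hz =>
      rw [TensorProduct.tmul_smul, map_smul]
      exact Submodule.smul_mem _ _ hz
    | mem z hz =>
      refine Submodule.subset_span ?_
      change IsBlobDiagram U _ _
      rw [S.fiberUnion_tmul]
      exact IsBlobDiagram.union U J h hy hz

end Blob

/-! ## Splitting blob diagrams on disjoint unions -/

/-- Every linear form extends along an injection. Since gluing is injective, every form on fields at
the initial stage comes from a form at any later stage, so all slices of the initial tensor are
controlled. -/
theorem Module.Dual.exists_comp_eq {𝕜 V W : Type*} [Field 𝕜] [AddCommGroup V] [Module 𝕜 V]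
    [AddCommGroup W] [Module 𝕜 W] {H : V →ₗ[𝕜] W} (hH : Function.Injective H)
    (φ : Module.Dual 𝕜 V) : ∃ ψ : Module.Dual 𝕜 W, ψ ∘ₗ H = φ := by
  obtain ⟨g, hg⟩ := LinearMap.exists_leftInverse_of_injective H (LinearMap.ker_eq_bot.2 hH)
  exact ⟨φ ∘ₗ g, by rw [LinearMap.comp_assoc, hg, LinearMap.comp_id]⟩

/-- The composites of a sequence of linear maps. -/
def LinearMap.iterComp {R : Type*} [Semiring R] {V : ℕ → Type*} [∀ l, AddCommMonoid (V l)]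
    [∀ l, Module R (V l)] (G : ∀ l, V l →ₗ[R] V (l + 1)) : ∀ l, V 0 →ₗ[R] V l
  | 0 => LinearMap.id
  | l + 1 => G l ∘ₗ LinearMap.iterComp G l

section Blob

variable {𝕜 : Type u} [Field 𝕜] {n : ℕ} {S : SystemOfFields.{u} 𝕜 n} (U : LocalRelation S)

theorem GluingDecomposition.isPL_toX {X : Mfd n 0} (D : GluingDecomposition X) {l : ℕ}
    (hl : l ≤ D.m) : IsPL (D.toX l) := by
  induction hl using Nat.decreasingInduction with
  | self =>
    rw [show D.toX D.m = D.top from funext D.toX_top]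
    exact D.top.isPL
  | of_succ l hl ih =>
    rw [show D.toX l = fun x => D.toX (l + 1) (D.π l x) from
      funext fun x => (D.toX_step l hl x).symm]
    exact ih.comp (D.isGluingMap l hl).isPL

theorem IsBlobDiagram.nonempty {X : Mfd n 0} {k : ℕ} {β : Fin k → Set X} {x : S.Fld 0 X}
    (h : IsBlobDiagram U β x) (i : Fin k) : (β i).Nonempty := by
  obtain ⟨D, r, -, hβ⟩ := h
  obtain ⟨l, -, C, hC, -⟩ := hβ i
  obtain ⟨b⟩ := C.isBall.2.some.nonempty_of_unitCube
  exact hC ▸ ⟨_, b, rfl⟩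

/-- The fields which can be glued to blob diagrams with given blobs contain a subspace which is
detected by the restrictions to the twig blobs. -/
theorem exists_subspace_isBlobDiagram {X₁ : BMfd n} (m : ℕ) (A : ℕ → BMfd n)
    (t : ∀ l, l ≤ m → (A l).X → X₁.X) (c : ∀ l, S.Fld 1 (A l).Z)
    (G : ∀ l, S.Fiber (A l).bdry (c l) →ₗ[𝕜] S.Fiber (A (l + 1)).bdry (c (l + 1)))
    (hG : ∀ l (hl : l + 1 ≤ m), ∃ π : (A l).X → (A (l + 1)).X, IsGluingMap π ∧
      (∀ y, t (l + 1) hl (π y) = t l (Nat.le_of_succ_le hl) y) ∧ ∀ u, S.Glue π u.1 (G l u).1)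
    {c₁ : S.Fld 1 X₁.Z} (F : S.Fiber (A m).bdry (c m) →ₗ[𝕜] S.Fiber X₁.bdry c₁)
    (ht : IsGluingMap (t m le_rfl)) (hF : ∀ u, S.Glue (t m le_rfl) u.1 (F u).1)
    {p : ℕ} {α : Fin p → Set X₁.X} {V : Type*} [AddCommGroup V] [Module 𝕜 V]
    (ρ : S.Fiber (A 0).bdry (c 0) ⊗[𝕜] V)
    (hα : ∀ i, ∃ l, ∃ hl : l ≤ m, ∃ C : BallComponent (A l).X,
      Set.range (fun b => t l hl (C.sum.inl b)) = α i ∧ ((∀ j, ¬ α j ⊂ α i) → ∀ φ,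
        LinearMap.iterComp G l (tensorSlice φ ρ) ∈
          restrictionSpace S U.U (A l).bdry C (c l))) :
    ∃ T : Submodule 𝕜 (S.Fiber (A 0).bdry (c 0)), (∀ φ, tensorSlice φ ρ ∈ T) ∧
      ∀ u ∈ T, IsBlobDiagram U α (F (LinearMap.iterComp G m u)).1 := by
  choose l hl C hC hU using hα
  -- Each twig blob imposes a linear condition at its own stage; `T` collects these conditions,
  -- pulled back to stage `0` along the iterated gluings.
  refine ⟨⨅ i, ⨅ _ : ∀ j, ¬ α j ⊂ α i, (restrictionSpace S U.U (A (l i)).bdry (C i)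
    (c (l i))).comap (LinearMap.iterComp G (l i)), fun φ => ?_, fun u hu => ?_⟩
  · simp only [Submodule.mem_iInf]
    exact fun i hi => hU i hi φ
  · simp only [Submodule.mem_iInf] at hu
    refine IsBlobDiagram.of_stages U m (fun l hl => ⟨A l, t l hl, (LinearMap.iterComp G l u).1⟩)
      (fun l hl => ?_) ⟨_, ht, fun _ => rfl, hF _⟩ fun i => ?_
    · obtain ⟨π, hπ, hcomm, hglue⟩ := hG l hl
      exact ⟨π, hπ, hcomm, hglue _⟩
    · exact ⟨l i, hl i, C i, hC i, fun hi => (restrictsInto_iff _).2 (hu i hi)⟩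

/-- A gluing map over a disjoint union restricts to the preimages of the parts. -/
theorem exists_restrict_over {N₁ N₂ N N₁' N₂' N' : BMfd n} (K : BMfd.DisjointUnion N₁ N₂ N)
    (K' : BMfd.DisjointUnion N₁' N₂' N') {π : N.X → N'.X} (hπ : IsGluingMap π)
    (h : ∀ x, π x ∈ Set.range K'.sum.inl ↔ x ∈ Set.range K.sum.inl) :
    ∃ (π₁ : N₁.X → N₁'.X) (π₂ : N₂.X → N₂'.X), IsGluingMap π₁ ∧ IsGluingMap π₂ ∧
      (∀ x, π (K.sum.inl x) = K'.sum.inl (π₁ x)) ∧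
      ∀ x, π (K.sum.inr x) = K'.sum.inr (π₂ x) := by
  have h₁ : ∀ x, ∃ y, π (K.sum.inl x) = K'.sum.inl y := fun x => by
    obtain ⟨y, hy⟩ := (h _).2 ⟨x, rfl⟩
    exact ⟨y, hy.symm⟩
  have h₂ : ∀ x, ∃ y, π (K.sum.inr x) = K'.sum.inr y := fun x => by
    rcases K'.sum.inl_or_inr (π (K.sum.inr x)) with hy | ⟨y, hy⟩
    · obtain ⟨z, hz⟩ := (h _).1 hy
      exact (K.sum.inl_ne_inr _ _ hz).elim
    · exact ⟨y, hy.symm⟩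
  choose π₁ hπ₁ using h₁
  choose π₂ hπ₂ using h₂
  exact ⟨π₁, π₂, IsGluingMap.restrict K.sum K'.sum hπ hπ₁ hπ₂,
    IsGluingMap.restrict K.sum.symm K'.sum.symm hπ hπ₂ hπ₁, hπ₁, hπ₂⟩

/-- A blob diagram on a disjoint union whose blobs are the juxtaposition of configurations on the
parts is a combination of juxtapositions of blob diagrams. -/
theorem IsBlobDiagram.mem_span_fiberUnion {X₁ X₂ X : BMfd n} (J : BMfd.DisjointUnion X₁ X₂ X)
    {p q k : ℕ} (h : p + q = k) {c₁ : S.Fld 1 X₁.Z} {c₂ : S.Fld 1 X₂.Z}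
    {α : Fin p → Set X₁.X} {β : Fin q → Set X₂.X}
    {x : S.Fiber X.bdry (S.union J.sumBdry c₁ c₂)} (hx : IsBlobDiagram U (J.blobs h α β) x.1) :
    x ∈ Submodule.span 𝕜 {z | ∃ (x₁ : S.Fiber X₁.bdry c₁) (x₂ : S.Fiber X₂.bdry c₂),
      IsBlobDiagram U α x₁.1 ∧ IsBlobDiagram U β x₂.1 ∧
        z = S.fiberUnion J c₁ c₂ (x₁ ⊗ₜ x₂)} := by
  obtain ⟨D, r, hr, hblob⟩ := hx
  let M : ℕ → BMfd n := fun l => ⟨D.M l, D.bdryM l, D.bdry l⟩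
  -- Each stage is cut along the preimage of the two parts of `X`. Beyond `D.m` the decomposition
  -- carries no information and an arbitrary splitting is chosen.
  have hsplit : ∀ l, ∃ (N₁ N₂ : BMfd n) (K : BMfd.DisjointUnion N₁ N₂ (M l)), l ≤ D.m →
      ∀ y, y ∈ Set.range K.sum.inl ↔ D.toX l y ∈ Set.range J.sum.inl := fun l => by
    by_cases hl : l ≤ D.m
    · obtain ⟨N₁, N₂, K, hK⟩ := (M l).exists_disjointUnion_of_isClopen
        (J.sum.isClopen_range_inl.preimage (D.isPL_toX hl).continuous)
      exact ⟨N₁, N₂, K, fun _ y => by rw [hK]; rfl⟩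
    · obtain ⟨N₁, N₂, K, -⟩ := (M l).exists_disjointUnion_of_isClopen isClopen_univ
      exact ⟨N₁, N₂, K, fun h => absurd h hl⟩
  choose A₁ A₂ K hK using hsplit
  have ht₁ : ∀ l (_ : l ≤ D.m) (y : (A₁ l).X),
      ∃ z, J.sum.inl z = D.toX l ((K l).sum.inl y) := fun l hl y => (hK l hl _).1 ⟨y, rfl⟩
  have ht₂ : ∀ l (_ : l ≤ D.m) (y : (A₂ l).X),
      ∃ z, J.sum.inr z = D.toX l ((K l).sum.inr y) := fun l hl y => by
    rcases J.sum.inl_or_inr (D.toX l ((K l).sum.inr y)) with hz | hz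
    · obtain ⟨z, hz⟩ := (hK l hl _).2 hz
      exact ((K l).sum.inl_ne_inr _ _ hz).elim
    · exact hz
  choose t₁ ht₁ using ht₁
  choose t₂ ht₂ using ht₂
  choose d₁ d₂ hd using fun l => S.exists_union_eq (K l) (S.res (D.bdry l) (r l))
  have hG : ∀ l, ∃ (G₁ : S.Fiber (A₁ l).bdry (d₁ l) →ₗ[𝕜] S.Fiber (A₁ (l + 1)).bdry (d₁ (l + 1)))
      (G₂ : S.Fiber (A₂ l).bdry (d₂ l) →ₗ[𝕜] S.Fiber (A₂ (l + 1)).bdry (d₂ (l + 1))),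
      ∀ hl : l + 1 ≤ D.m, Function.Injective G₁ ∧ Function.Injective G₂ ∧
        (∃ π, IsGluingMap π ∧ (∀ y, t₁ (l + 1) hl (π y) = t₁ l (Nat.le_of_succ_le hl) y) ∧
          ∀ u, S.Glue π u.1 (G₁ u).1) ∧
        (∃ π, IsGluingMap π ∧ (∀ y, t₂ (l + 1) hl (π y) = t₂ l (Nat.le_of_succ_le hl) y) ∧
          ∀ u, S.Glue π u.1 (G₂ u).1) ∧
        ∀ ρ, S.Glue (D.π l) (S.fiberUnion (K l) _ _ ρ).1
          (S.fiberUnion (K (l + 1)) _ _ (TensorProduct.map G₁ G₂ ρ)).1 := fun l => by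
    by_cases hl : l + 1 ≤ D.m
    · obtain ⟨π₁, π₂, hπ₁, hπ₂, hl₁, hl₂⟩ := exists_restrict_over (K l) (K (l + 1))
        (D.isGluingMap l hl) fun y => by
          rw [hK (l + 1) hl, hK l (Nat.le_of_succ_le hl), D.toX_step l hl]
      obtain ⟨G₁, G₂, hi₁, hi₂, hG₁, hG₂, hG⟩ := S.exists_glueLinear_union (K l) (K (l + 1))
        hπ₁ hπ₂ (D.isGluingMap l hl) hl₁ hl₂ (hr.glue l hl) (hd l) (hd (l + 1))
      refine ⟨G₁, G₂, fun _ => ⟨hi₁, hi₂, ⟨π₁, hπ₁, fun y => J.sum.injective_inl ?_, hG₁⟩,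
        ⟨π₂, hπ₂, fun y => J.sum.injective_inr ?_, hG₂⟩, hG⟩⟩
      · rw [ht₁, ht₁, ← hl₁, D.toX_step l hl]
      · rw [ht₂, ht₂, ← hl₂, D.toX_step l hl]
    · exact ⟨0, 0, fun h => absurd h hl⟩
  choose G₁ G₂ hG using hG
  -- The concluding homeomorphism onto `X` is treated as one more gluing, so it too decomposes as a
  -- tensor product `F₁ ⊗ F₂`.
  have htop : (fun y => D.toX D.m y) = D.top := funext D.toX_top
  have htopg : IsGluingMap (X := (M D.m).X) (D.toX D.m) := by
    rw [show D.toX D.m = D.top from htop]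
    exact IsGluingMap.of_homeo _
  have hglue : S.Glue (D.toX D.m) (r D.m) x.1 := by
    rw [show D.toX D.m = D.top from htop]
    exact (S.glue_homeo D.top _ _).2 hr.top.symm
  obtain ⟨F₁, F₂, ht₁g, ht₂g, hF₁, hF₂, hF⟩ : ∃ (F₁ : S.Fiber (A₁ D.m).bdry (d₁ D.m) →ₗ[𝕜]
      S.Fiber X₁.bdry c₁) (F₂ : S.Fiber (A₂ D.m).bdry (d₂ D.m) →ₗ[𝕜] S.Fiber X₂.bdry c₂),
      IsGluingMap (t₁ D.m le_rfl) ∧ IsGluingMap (t₂ D.m le_rfl) ∧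
      (∀ u, S.Glue (t₁ D.m le_rfl) u.1 (F₁ u).1) ∧ (∀ u, S.Glue (t₂ D.m le_rfl) u.1 (F₂ u).1) ∧
      ∀ ρ, S.Glue (D.toX D.m) (S.fiberUnion (K D.m) _ _ ρ).1
        (S.fiberUnion J _ _ (TensorProduct.map F₁ F₂ ρ)).1 := by
    have h₁ := IsGluingMap.restrict (K D.m).sum J.sum htopg (fun y => (ht₁ _ le_rfl y).symm)
      fun y => (ht₂ _ le_rfl y).symm
    have h₂ := IsGluingMap.restrict (K D.m).sum.symm J.sum.symm htopg
      (fun y => (ht₂ _ le_rfl y).symm) fun y => (ht₁ _ le_rfl y).symm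
    obtain ⟨F₁, F₂, -, -, hF₁, hF₂, hF⟩ := S.exists_glueLinear_union (K D.m) J h₁ h₂ htopg
      (fun y => (ht₁ _ le_rfl y).symm) (fun y => (ht₂ _ le_rfl y).symm) hglue (hd D.m) x.2.symm
    exact ⟨F₁, F₂, h₁, h₂, hF₁, hF₂, hF⟩
  let H₁ := LinearMap.iterComp G₁
  let H₂ := LinearMap.iterComp G₂
  -- The initial field, as a tensor, determines all the others: by uniqueness of gluing the field on
  -- stage `l` corresponds to its image under `H₁ l ⊗ H₂ l`.
  let ρ := (S.fiberUnion (K 0) (d₁ 0) (d₂ 0)).symm ⟨r 0, (hd 0).symm⟩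
  have hH : ∀ l, l ≤ D.m → Function.Injective (H₁ l) ∧ Function.Injective (H₂ l) ∧
      (S.fiberUnion (K l) (d₁ l) (d₂ l) (TensorProduct.map (H₁ l) (H₂ l) ρ)).1 = r l := by
    intro l
    induction l with
    | zero =>
      refine fun _ => ⟨Function.injective_id, Function.injective_id, ?_⟩
      change (S.fiberUnion (K 0) (d₁ 0) (d₂ 0)
        (TensorProduct.map LinearMap.id LinearMap.id ρ)).1 = r 0
      rw [TensorProduct.map_id, LinearMap.id_apply]
      exact congrArg Subtype.val ((S.fiberUnion (K 0) (d₁ 0) (d₂ 0)).apply_symm_apply _)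
    | succ l ih =>
      intro hl
      obtain ⟨h₁, h₂, h₃⟩ := ih (Nat.le_of_succ_le hl)
      obtain ⟨hi₁, hi₂, -, -, hg⟩ := hG l hl
      refine ⟨hi₁.comp h₁, hi₂.comp h₂, S.glue_unique (D.isGluingMap l hl) ?_ (hr.glue l hl)⟩
      have := hg (TensorProduct.map (H₁ l) (H₂ l) ρ)
      rw [h₃] at this
      change S.Glue (D.π l) (r l) (S.fiberUnion (K (l + 1)) _ _
        (TensorProduct.map (G₁ l ∘ₗ H₁ l) (G₂ l ∘ₗ H₂ l) ρ)).1
      rwa [TensorProduct.map_comp]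
  have hxρ : x = S.fiberUnion J c₁ c₂
      (TensorProduct.map F₁ F₂ (TensorProduct.map (H₁ D.m) (H₂ D.m) ρ)) := by
    refine Subtype.ext (S.glue_unique htopg hglue ?_)
    have := hF (TensorProduct.map (H₁ D.m) (H₂ D.m) ρ)
    rwa [(hH D.m le_rfl).2.2] at this
  have hne := IsBlobDiagram.nonempty U ⟨D, r, hr, hblob⟩
  obtain ⟨T₁, hT₁, hblob₁⟩ := exists_subspace_isBlobDiagram U D.m A₁ t₁ d₁ G₁
    (fun l hl => (hG l hl).2.2.1) F₁ ht₁g hF₁ (α := α) ρ fun i => by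
      obtain ⟨l, hl, C, hC, hU⟩ := hblob (finSumEquiv h (Sum.inl i))
      rw [J.blobs_inl] at hC
      obtain ⟨C₁, hC₁, hres⟩ := BallComponent.exists_restrict (S := S) (U := U.U) (K l) C
        fun b => (hK l hl _).2 (Set.image_subset_range _ (α i) (hC ▸ ⟨b, rfl⟩ :
          D.toX l (C.sum.inl b) ∈ J.sum.inl '' α i))
      refine ⟨l, hl, C₁, J.sum.injective_inl.image_injective ?_, fun hi φ => ?_⟩
      · refine (Eq.trans ?_ (congrArg (D.toX l '' ·) hC₁)).trans ((Set.range_comp _ _).symm.trans hC)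
        rw [← Set.range_comp, ← Set.range_comp]
        exact congrArg Set.range (funext fun b => ht₁ l hl _)
      · obtain ⟨h₁, h₂, h₃⟩ := hH l hl
        -- Extending `φ` along `H₂ l` identifies the glued slice of `ρ` with a slice of the field on
        -- stage `l`, where the restriction to the blob is known to lie in `U`.
        obtain ⟨ψ, rfl⟩ := Module.Dual.exists_comp_eq h₂ φ
        rw [← tensorSlice_map]
        refine hres _ _ _ ?_ ψ
        rw [h₃]
        -- A twig of `α` is still a twig among all blobs: a blob of the second block is nonempty and
        -- disjoint from `X₁`, so it cannot lie inside a blob of the first.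
        refine hU ((forall_fin_iff h).2 ⟨fun j hj => hi j ?_, fun j hj => ?_⟩)
        · rw [J.blobs_inl, J.blobs_inl] at hj
          exact (J.sum.injective_inl.injOn.image_ssubset_image_iff (Set.subset_univ _)
            (Set.subset_univ _)).1 hj
        · rw [J.blobs_inl] at hj
          have hj' := hne (finSumEquiv h (Sum.inr j))
          rw [J.blobs_inr] at hj hj'
          obtain ⟨_, z, hz, rfl⟩ := hj'
          obtain ⟨w, -, hw⟩ := hj.1 ⟨z, hz, rfl⟩
          exact J.sum.inl_ne_inr _ _ hw
  obtain ⟨T₂, hT₂, hblob₂⟩ := exists_subspace_isBlobDiagram U D.m A₂ t₂ d₂ G₂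
    (fun l hl => (hG l hl).2.2.2.1) F₂ ht₂g hF₂ (α := β) (TensorProduct.comm 𝕜 _ _ ρ) fun i => by
      obtain ⟨l, hl, C, hC, hU⟩ := hblob (finSumEquiv h (Sum.inr i))
      rw [J.blobs_inr] at hC
      obtain ⟨C₂, hC₂, hres⟩ := BallComponent.exists_restrict (S := S) (U := U.U) (K l).symm C
        fun b => ((K l).sum.inl_or_inr _).resolve_left fun hb => by
          obtain ⟨z, hz⟩ := (hK l hl _).1 hb
          have hb' : D.toX l (C.sum.inl b) ∈ J.sum.inr '' β i := hC ▸ Set.mem_range_self b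
          obtain ⟨w, -, hw⟩ := hb'
          exact J.sum.inl_ne_inr _ _ (hz.trans hw.symm)
      refine ⟨l, hl, C₂, J.sum.injective_inr.image_injective ?_, fun hi φ => ?_⟩
      · refine (Eq.trans ?_ (congrArg (D.toX l '' ·) hC₂)).trans ((Set.range_comp _ _).symm.trans hC)
        rw [← Set.range_comp, ← Set.range_comp]
        exact congrArg Set.range (funext fun b => ht₂ l hl _)
      · obtain ⟨h₁, h₂, h₃⟩ := hH l hl
        obtain ⟨ψ, rfl⟩ := Module.Dual.exists_comp_eq h₁ φ
        rw [← tensorSlice_map, TensorProduct.map_comm]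
        refine hres _ _ _ ?_ ψ
        rw [S.fiberUnion_symm, h₃]
        refine hU ((forall_fin_iff h).2 ⟨fun j hj => ?_, fun j hj => hi j ?_⟩)
        · rw [J.blobs_inr] at hj
          have hj' := hne (finSumEquiv h (Sum.inl j))
          rw [J.blobs_inl] at hj hj'
          obtain ⟨_, z, hz, rfl⟩ := hj'
          obtain ⟨w, -, hw⟩ := hj.1 ⟨z, hz, rfl⟩
          exact J.sum.inl_ne_inr _ _ hw.symm
        · rw [J.blobs_inr, J.blobs_inr] at hj
          exact (J.sum.injective_inr.injOn.image_ssubset_image_iff (Set.subset_univ _)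
            (Set.subset_univ _)).1 hj
  have hρ := mem_span_tmul_of_tensorSlice_mem hT₁ hT₂
  rw [hxρ]
  -- The whole gluing process is one linear map applied to `ρ`; on `t ⊗ t'` it is the disjoint union
  -- of the two glued fields.
  let Ξ := (S.fiberUnion J c₁ c₂).toLinearMap ∘ₗ TensorProduct.map F₁ F₂ ∘ₗ
    TensorProduct.map (H₁ D.m) (H₂ D.m)
  have hle : Submodule.span 𝕜 {z | ∃ t ∈ T₁, ∃ t' ∈ T₂, z = t ⊗ₜ[𝕜] t'} ≤
      (Submodule.span 𝕜 {z | ∃ (x₁ : S.Fiber X₁.bdry c₁) (x₂ : S.Fiber X₂.bdry c₂),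
        IsBlobDiagram U α x₁.1 ∧ IsBlobDiagram U β x₂.1 ∧
          z = S.fiberUnion J c₁ c₂ (x₁ ⊗ₜ x₂)}).comap Ξ := by
    refine Submodule.span_le.2 ?_
    rintro _ ⟨t, ht, t', ht', rfl⟩
    exact Submodule.subset_span ⟨_, _, hblob₁ t ht, hblob₂ t' ht', rfl⟩
  exact hle hρ

end Blob

/-! ## Permutations of configurations -/

/-- Permutations of two blocks of indices. -/
def blockPerm {p q k : ℕ} (h : p + q = k) (τ₁ : Equiv.Perm (Fin p)) (τ₂ : Equiv.Perm (Fin q)) :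
    Equiv.Perm (Fin k) :=
  (finSumEquiv h).permCongr (Equiv.Perm.sumCongr τ₁ τ₂)

theorem sign_blockPerm {p q k : ℕ} (h : p + q = k) (τ₁ : Equiv.Perm (Fin p))
    (τ₂ : Equiv.Perm (Fin q)) :
    Equiv.Perm.sign (blockPerm h τ₁ τ₂) = Equiv.Perm.sign τ₁ * Equiv.Perm.sign τ₂ := by
  rw [blockPerm, Equiv.Perm.sign_permCongr, Equiv.Perm.sign_sumCongr]

theorem blockPerm_inl {p q k : ℕ} (h : p + q = k) (τ₁ : Equiv.Perm (Fin p))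
    (τ₂ : Equiv.Perm (Fin q)) (i : Fin p) :
    blockPerm h τ₁ τ₂ (finSumEquiv h (Sum.inl i)) = finSumEquiv h (Sum.inl (τ₁ i)) := by
  simp [blockPerm, Equiv.permCongr_apply]

theorem blockPerm_inr {p q k : ℕ} (h : p + q = k) (τ₁ : Equiv.Perm (Fin p))
    (τ₂ : Equiv.Perm (Fin q)) (i : Fin q) :
    blockPerm h τ₁ τ₂ (finSumEquiv h (Sum.inr i)) = finSumEquiv h (Sum.inr (τ₂ i)) := by
  simp [blockPerm, Equiv.permCongr_apply]

/-- By finiteness a permutation which maps the first block into itself also preserves the second. -/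
theorem exists_eq_blockPerm {p q k : ℕ} (h : p + q = k) {ρ : Equiv.Perm (Fin k)}
    (hρ : ∀ i, ∃ j, ρ (finSumEquiv h (Sum.inl i)) = finSumEquiv h (Sum.inl j)) :
    ∃ τ₁ τ₂, ρ = blockPerm h τ₁ τ₂ := by
  have := Equiv.Perm.mem_sumCongrHom_range_of_perm_mapsTo_inl
    (σ := (finSumEquiv h).symm.permCongr ρ) (by
      rintro _ ⟨i, rfl⟩
      obtain ⟨j, hj⟩ := hρ i
      exact ⟨j, by simp [Equiv.permCongr_apply, hj]⟩)
  obtain ⟨⟨τ₁, τ₂⟩, hτ⟩ := this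
  refine ⟨τ₁, τ₂, ?_⟩
  have h' : Equiv.Perm.sumCongr τ₁ τ₂ = (finSumEquiv h).symm.permCongr ρ := hτ
  rw [blockPerm, h']
  ext i
  simp [Equiv.permCongr_apply]

section Blob

variable {𝕜 : Type u} [Field 𝕜] {n : ℕ} {S : SystemOfFields.{u} 𝕜 n} (U : LocalRelation S)

/-! ### Sorting configurations of blobs -/

namespace BMfd.DisjointUnion

variable {X₁ X₂ X : BMfd n} (J : BMfd.DisjointUnion X₁ X₂ X) {p q k : ℕ}
    (h : p + q = k) {α : Fin p → Set X₁.X} {β : Fin q → Set X₂.X}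

theorem blobs_comp_blockPerm (τ₁ : Equiv.Perm (Fin p)) (τ₂ : Equiv.Perm (Fin q)) :
    J.blobs h α β ∘ blockPerm h τ₁ τ₂ = J.blobs h (α ∘ τ₁) (β ∘ τ₂) := by
  refine funext ((forall_fin_iff h).2 ⟨fun i => ?_, fun i => ?_⟩)
  · simp [blockPerm_inl]
  · simp [blockPerm_inr]

theorem blobs_injective {α' : Fin p → Set X₁.X} {β' : Fin q → Set X₂.X}
    (hαβ : J.blobs h α β = J.blobs h α' β') : α = α' ∧ β = β' := by
  refine ⟨funext fun i => ?_, funext fun i => ?_⟩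
  · have := congrFun hαβ (finSumEquiv h (Sum.inl i))
    rw [blobs_inl, blobs_inl] at this
    exact J.sum.injective_inl.image_injective this
  · have := congrFun hαβ (finSumEquiv h (Sum.inr i))
    rw [blobs_inr, blobs_inr] at this
    exact J.sum.injective_inr.image_injective this

/-- Nonemptiness is essential: an empty blob would lie in both parts and its block could not be
recognised. -/
theorem blobs_subset_iff (hβ : ∀ i, (β i).Nonempty) (i : Fin k) :
    J.blobs h α β i ⊆ Set.range J.sum.inl ↔ ∃ j, finSumEquiv h (Sum.inl j) = i := by
  revert i
  refine (forall_fin_iff h).2 ⟨fun i => ?_, fun i => ?_⟩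
  · simp
  · simp only [blobs_inr, EmbeddingLike.apply_eq_iff_eq, reduceCtorEq, exists_false, iff_false]
    intro hi
    obtain ⟨z, hz⟩ := hβ i
    obtain ⟨w, hw⟩ := hi ⟨z, hz, rfl⟩
    exact J.sum.inl_ne_inr _ _ hw

/-- A permutation which sorts a configuration of nonempty blobs on a disjoint union. -/
def IsSorting (γ : Fin k → Set X.X) (σ : Equiv.Perm (Fin k)) (α : Fin p → Set X₁.X)
    (β : Fin q → Set X₂.X) : Prop :=
  γ ∘ σ = J.blobs h α β ∧ (∀ i, (α i).Nonempty) ∧ ∀ i, (β i).Nonempty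

variable {J h}

theorem IsSorting.comp {γ : Fin k → Set X.X} {σ : Equiv.Perm (Fin k)}
    (hγ : J.IsSorting h γ σ α β) (τ : Equiv.Perm (Fin k)) :
    J.IsSorting h (γ ∘ τ) (τ⁻¹ * σ) α β := by
  refine ⟨?_, hγ.2⟩
  rw [← hγ.1]
  funext i
  simp

/-- The permutation `σ⁻¹ * σ'` carries one sorted configuration to another, so it preserves the
positions of the blobs in `X₁`. The argument allows repeated blobs. -/
theorem IsSorting.exists_blockPerm {γ : Fin k → Set X.X} {σ σ' : Equiv.Perm (Fin k)}
    {α' : Fin p → Set X₁.X} {β' : Fin q → Set X₂.X}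
    (hγ : J.IsSorting h γ σ α β) (hγ' : J.IsSorting h γ σ' α' β') :
    ∃ τ₁ τ₂, σ' = σ * blockPerm h τ₁ τ₂ ∧ α' = α ∘ τ₁ ∧ β' = β ∘ τ₂ := by
  have hρ : J.blobs h α β ∘ (σ⁻¹ * σ') = J.blobs h α' β' := by
    rw [← hγ.1, ← hγ'.1]
    funext i
    simp
  obtain ⟨τ₁, τ₂, hτ⟩ := exists_eq_blockPerm h (ρ := σ⁻¹ * σ') fun i => by
    have : J.blobs h α β ((σ⁻¹ * σ') (finSumEquiv h (Sum.inl i))) ⊆ Set.range J.sum.inl := by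
      rw [show J.blobs h α β ((σ⁻¹ * σ') (finSumEquiv h (Sum.inl i))) = _ from congrFun hρ _,
        blobs_inl]
      exact Set.image_subset_range _ _
    obtain ⟨j, hj⟩ := (J.blobs_subset_iff h hγ.2.2 _).1 this
    exact ⟨j, hj.symm⟩
  rw [hτ, J.blobs_comp_blockPerm] at hρ
  obtain ⟨h₁, h₂⟩ := J.blobs_injective h hρ
  exact ⟨τ₁, τ₂, by rw [← hτ, mul_inv_cancel_left], h₁.symm, h₂.symm⟩

/-- The length of the first block is the number of indices whose blob lies in `X₁`, which depends on
`γ` alone. -/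
theorem IsSorting.eq_left {p' q' : ℕ} {h' : p' + q' = k} {γ : Fin k → Set X.X}
    {σ σ' : Equiv.Perm (Fin k)} {α' : Fin p' → Set X₁.X} {β' : Fin q' → Set X₂.X}
    (hγ : J.IsSorting h γ σ α β) (hγ' : J.IsSorting h' γ σ' α' β') : p = p' := by
  have key : ∀ {p q : ℕ} {h : p + q = k} {σ : Equiv.Perm (Fin k)} {α : Fin p → Set X₁.X}
      {β : Fin q → Set X₂.X}, J.IsSorting h γ σ α β →
      Nat.card {i // γ i ⊆ Set.range J.sum.inl} = p := by
    intro p q h σ α β hγ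
    rw [← Nat.card_congr (σ.subtypeEquiv (p := fun i => γ (σ i) ⊆ Set.range J.sum.inl)
      fun i => Iff.rfl)]
    have : ∀ i, γ (σ i) ⊆ Set.range J.sum.inl ↔ i ∈ Set.range (finSumEquiv h ∘ Sum.inl) :=
      fun i => by
        rw [show γ (σ i) = _ from congrFun hγ.1 i, J.blobs_subset_iff h hγ.2.2]
        rfl
    rw [Nat.card_congr (Equiv.subtypeEquivRight this)]
    have hc := Nat.card_range_of_injective
      ((finSumEquiv h).injective.comp (Sum.inl_injective (α := Fin p) (β := Fin q)))
    rw [Nat.card_fin] at hc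
    exact hc
  exact (key hγ).symm.trans (key hγ')

/-- Configurations of blobs each of which lies in one part can be sorted. -/
theorem exists_sorting (J : BMfd.DisjointUnion X₁ X₂ X) {γ : Fin k → Set X.X}
    (hγ : ∀ i, γ i ⊆ Set.range J.sum.inl ∨ γ i ⊆ Set.range J.sum.inr) :
    ∃ (p q : ℕ) (h : p + q = k) (σ : Equiv.Perm (Fin k)) (α : Fin p → Set X₁.X)
      (β : Fin q → Set X₂.X), γ ∘ σ = J.blobs h α β := by
  classical
  let P : Fin k → Prop := fun i => γ i ⊆ Set.range J.sum.inl
  let e : Fin (Fintype.card {i // P i}) ⊕ Fin (Fintype.card {i // ¬ P i}) ≃ Fin k :=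
    (Equiv.sumCongr (Fintype.equivFin _).symm (Fintype.equivFin _).symm).trans (Equiv.sumCompl P)
  have h : Fintype.card {i // P i} + Fintype.card {i // ¬ P i} = k := by
    simpa using Fintype.card_congr e
  refine ⟨_, _, h, (finSumEquiv h).symm.trans e, fun i => J.sum.inl ⁻¹' γ (e (Sum.inl i)),
    fun i => J.sum.inr ⁻¹' γ (e (Sum.inr i)), funext ((forall_fin_iff h).2 ⟨fun i => ?_,
      fun i => ?_⟩)⟩
  · have hi : P (e (Sum.inl i)) := ((Fintype.equivFin {i // P i}).symm i).2
    rw [blobs_inl, Set.image_preimage_eq_inter_range, Set.inter_eq_left.2 hi]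
    simp
  · have hi : ¬ P (e (Sum.inr i)) := ((Fintype.equivFin {i // ¬ P i}).symm i).2
    rw [blobs_inr, Set.image_preimage_eq_inter_range,
      Set.inter_eq_left.2 ((hγ _).resolve_left hi)]
    simp

end BMfd.DisjointUnion

/-- A blob is a continuous image of a connected ball, and both parts are clopen. -/
theorem IsBlobDiagram.subset_range {X₁ X₂ X : BMfd n} (J : BMfd.DisjointUnion X₁ X₂ X) {k : ℕ}
    {γ : Fin k → Set X.X} {x : S.Fld 0 X.X} (h : IsBlobDiagram U γ x) (i : Fin k) :
    γ i ⊆ Set.range J.sum.inl ∨ γ i ⊆ Set.range J.sum.inr := by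
  obtain ⟨D, r, -, hβ⟩ := h
  obtain ⟨l, hl, C, hC, -⟩ := hβ i
  have hball : PreconnectedSpace C.B :=
    isPreconnected_iff_preconnectedSpace.1 C.isBall.2.some.isPreconnected_of_unitCube
  have hpre : _root_.IsPreconnected (γ i) := by
    rw [← hC]
    exact isPreconnected_range ((D.isPL_toX hl).comp C.sum.isPL_inl).continuous
  obtain ⟨b⟩ := C.isBall.2.some.nonempty_of_unitCube
  have hb : D.toX l (C.sum.inl b) ∈ γ i := hC ▸ ⟨b, rfl⟩
  rcases J.sum.inl_or_inr (D.toX l (C.sum.inl b)) with hz | hz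
  · exact Or.inl (hpre.subset_isClopen J.sum.isClopen_range_inl ⟨_, hb, hz⟩)
  · exact Or.inr (hpre.subset_isClopen J.sum.symm.isClopen_range_inl ⟨_, hb, hz⟩)

theorem IsBlobDiagram.comp_perm {X : Mfd n 0} {k : ℕ} {β : Fin k → Set X} {x : S.Fld 0 X}
    (h : IsBlobDiagram U β x) (σ : Equiv.Perm (Fin k)) : IsBlobDiagram U (β ∘ σ) x := by
  obtain ⟨D, r, hr, hβ⟩ := h
  refine ⟨D, r, hr, fun i => ?_⟩
  obtain ⟨l, hl, C, hC, hU⟩ := hβ (σ i)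
  refine ⟨l, hl, C, hC, fun hj => hU fun j => ?_⟩
  have := hj (σ.symm j)
  simpa using this

/-- The conditions on a blob diagram, including which blobs are twigs, do not depend on the order of
the blobs. -/
theorem blobSpace_comp_perm (X : BMfd n) (c : S.Fld 1 X.Z) {k : ℕ} (β : Fin k → Set X.X)
    (σ : Equiv.Perm (Fin k)) : blobSpace U X c (β ∘ σ) = blobSpace U X c β := by
  refine le_antisymm (Submodule.span_mono fun x hx => ?_)
    (Submodule.span_mono fun x hx => IsBlobDiagram.comp_perm U hx σ)
  have := IsBlobDiagram.comp_perm U (hx : IsBlobDiagram U (β ∘ σ) x.1) σ⁻¹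
  have hβ : (β ∘ σ) ∘ (σ⁻¹ : Equiv.Perm (Fin k)) = β := funext fun i => by simp
  rwa [hβ] at this

/-! ## Classes of blob diagrams -/

/-- The class of the projection of a field to the space of blob diagrams with blobs `β`. -/
noncomputable def projClass (X : BMfd n) (c : S.Fld 1 X.Z) {k : ℕ} (β : Fin k → Set X.X) :
    S.Fiber X.bdry c →ₗ[𝕜] BlobModule U X c k :=
  Submodule.mkQ _ ∘ₗ LinearMap.codRestrict (orderedBlobs U X c k)
    -- A chosen projection onto the blob space extends the class to a linear map on all fields.
    -- Linear constructions can then be made without carrying membership proofs; on blob diagrams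
    -- the choice has no effect.
    (Finsupp.lsingle β ∘ₗ (blobSpace U X c β).exists_projection.choose)
    fun x => single_mem_orderedBlobs U ((blobSpace U X c β).exists_projection.choose_spec.1 x)

variable {X : BMfd n} {c : S.Fld 1 X.Z}

theorem blobClass_congr {k : ℕ} {β β' : Fin k → Set X.X} {x x' : S.Fiber X.bdry c} (hβ : β = β')
    (hxx' : x = x') (hx : x ∈ blobSpace U X c β) (hx' : x' ∈ blobSpace U X c β') :
    blobClass U X c β x hx = blobClass U X c β' x' hx' := by
  subst hβ hxx'
  rfl

theorem projClass_eq_blobClass {k : ℕ} (β : Fin k → Set X.X) (x : S.Fiber X.bdry c) :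
    projClass U X c β x = blobClass U X c β _
      ((blobSpace U X c β).exists_projection.choose_spec.1 x) := rfl

theorem projClass_of_mem {k : ℕ} {β : Fin k → Set X.X} {x : S.Fiber X.bdry c}
    (hx : x ∈ blobSpace U X c β) : projClass U X c β x = blobClass U X c β x hx :=
  (projClass_eq_blobClass U β x).trans (blobClass_congr U rfl
    ((blobSpace U X c β).exists_projection.choose_spec.2 x hx) _ _)

theorem blobClass_comp_perm {k : ℕ} {β : Fin k → Set X.X} {x : S.Fiber X.bdry c}
    (hx : x ∈ blobSpace U X c β) (σ : Equiv.Perm (Fin k)) (hx' : x ∈ blobSpace U X c (β ∘ σ)) :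
    blobClass U X c (β ∘ σ) x hx' =
      ((Equiv.Perm.sign σ : ℤ) : 𝕜) • blobClass U X c β x hx :=
  (Submodule.Quotient.eq _).2 (Submodule.subset_span ⟨σ, β, x, hx, rfl⟩)

theorem projClass_comp_perm {k : ℕ} (β : Fin k → Set X.X) (σ : Equiv.Perm (Fin k)) :
    projClass U X c (β ∘ σ) = ((Equiv.Perm.sign σ : ℤ) : 𝕜) • projClass U X c β := by
  refine LinearMap.ext fun x => ?_
  -- The chosen projection depends only on the subspace, so `β` and `β ∘ σ`, having the same blob
  -- space, use the same one. The sign rule thus holds for all fields, not only for those in the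
  -- blob space.
  have hproj : ∀ {T T' : Submodule 𝕜 (S.Fiber X.bdry c)}, T = T' →
      T.exists_projection.choose = T'.exists_projection.choose := by
    rintro T _ rfl
    rfl
  have hx := (blobSpace U X c β).exists_projection.choose_spec.1 x
  rw [LinearMap.smul_apply, projClass_eq_blobClass, projClass_eq_blobClass,
    ← blobClass_comp_perm U hx σ (by rwa [blobSpace_comp_perm])]
  exact blobClass_congr U rfl (by rw [hproj (blobSpace_comp_perm U X c β σ)]) _ _

theorem BlobModule.mem_of_blobClass_mem {k : ℕ} (E : Submodule 𝕜 (BlobModule U X c k))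
    (h : ∀ β (x : S.Fiber X.bdry c) (hx : x ∈ blobSpace U X c β), IsBlobDiagram U β x.1 →
      blobClass U X c β x hx ∈ E) (y : BlobModule U X c k) : y ∈ E := by
  obtain ⟨f, rfl⟩ := Submodule.Quotient.mk_surjective _ y
  have hE : ∀ β, blobSpace U X c β ≤ E.comap (projClass U X c β) := fun β =>
    Submodule.span_le.2 fun x hx => by
      change projClass U X c β x ∈ E
      rw [projClass_of_mem U (Submodule.subset_span hx)]
      exact h β x _ hx
  have hf : f = ∑ β ∈ f.1.support, ⟨Finsupp.single β (f.1 β),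
      single_mem_orderedBlobs U (f.2 β)⟩ := Subtype.ext <| by
    rw [AddSubmonoidClass.coe_finsetSum]
    exact (Finsupp.sum_single f.1).symm
  have hmk : (Submodule.Quotient.mk f : BlobModule U X c k) =
      ∑ β ∈ f.1.support, blobClass U X c β (f.1 β) (f.2 β) :=
    (congrArg (Submodule.mkQ _) hf).trans (map_sum _ _ _)
  rw [hmk]
  refine sum_mem fun β _ => ?_
  rw [← projClass_of_mem]
  exact hE β (f.2 β)

theorem BlobModule.hom_ext {k : ℕ} {M : Type*} [AddCommGroup M] [Module 𝕜 M]
    {f g : BlobModule U X c k →ₗ[𝕜] M} (h : ∀ β (x : S.Fiber X.bdry c)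
      (hx : x ∈ blobSpace U X c β), IsBlobDiagram U β x.1 →
      f (blobClass U X c β x hx) = g (blobClass U X c β x hx)) : f = g :=
  LinearMap.ext (BlobModule.mem_of_blobClass_mem U (LinearMap.eqLocus f g) h)

/-- Testing on genuine blob diagrams rather than on elements of the blob spaces makes nonemptiness
of the blobs available. -/
theorem BlobModule.tensor_hom_ext {X' : BMfd n} {c' : S.Fld 1 X'.Z} {p q : ℕ} {M : Type*}
    [AddCommGroup M] [Module 𝕜 M]
    {f g : BlobModule U X c p ⊗[𝕜] BlobModule U X' c' q →ₗ[𝕜] M}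
    (h : ∀ α (x : S.Fiber X.bdry c) (hx : x ∈ blobSpace U X c α) β (y : S.Fiber X'.bdry c')
      (hy : y ∈ blobSpace U X' c' β), IsBlobDiagram U α x.1 → IsBlobDiagram U β y.1 →
      f (blobClass U X c α x hx ⊗ₜ blobClass U X' c' β y hy) =
        g (blobClass U X c α x hx ⊗ₜ blobClass U X' c' β y hy)) : f = g :=
  TensorProduct.ext (BlobModule.hom_ext U fun α x hx hx' => BlobModule.hom_ext U fun β y hy hy' =>
    h α x hx β y hy hx' hy')

theorem blobD_blobClass {k : ℕ} {β : Fin (k + 1) → Set X.X} {x : S.Fiber X.bdry c}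
    (hx : x ∈ blobSpace U X c β) : blobD U X c k (blobClass U X c β x hx) =
      ∑ i : Fin (k + 1), ((-1 : 𝕜) ^ (i : ℕ)) •
        blobClass U X c (β ∘ i.succAbove) x (blobSpace_forget U hx i) := by
  have h : (forgetSum X c k).restrict (forgetSum_mem_orderedBlobs U X c k)
      ⟨Finsupp.single β x, single_mem_orderedBlobs U hx⟩ =
      ∑ i : Fin (k + 1), ((-1 : 𝕜) ^ (i : ℕ)) • (⟨Finsupp.single (β ∘ i.succAbove) x,
        single_mem_orderedBlobs U (blobSpace_forget U hx i)⟩ : orderedBlobs U X c k) := by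
    refine Subtype.ext ?_
    rw [AddSubmonoidClass.coe_finsetSum]
    exact forgetSum_single X c k β x
  refine (congrArg (Submodule.mkQ _) h).trans ((map_sum _ _ _).trans ?_)
  exact Finset.sum_congr rfl fun i _ => map_smul _ _ _

end Blob

/-! ## Juxtaposition of classes -/

/-- A bilinear map which vanishes on submodules descends to the quotients. -/
noncomputable def Submodule.tensorLiftQ {R M N L : Type*} [CommRing R] [AddCommGroup M]
    [Module R M] [AddCommGroup N] [Module R N] [AddCommGroup L] [Module R L] (P : Submodule R M)
    (Q : Submodule R N) (T : M →ₗ[R] N →ₗ[R] L) (hP : ∀ m ∈ P, ∀ n, T m n = 0)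
    (hQ : ∀ n ∈ Q, ∀ m, T m n = 0) : (M ⧸ P) ⊗[R] (N ⧸ Q) →ₗ[R] L :=
  TensorProduct.lift (P.liftQ (Q.liftQ T.flip fun n hn => LinearMap.ext fun m => hQ n hn m).flip
    fun m hm => LinearMap.ext fun y => by
      obtain ⟨n, rfl⟩ := Submodule.Quotient.mk_surjective _ y
      exact hP m hm n)

section Blob

variable {𝕜 : Type u} [Field 𝕜] {n : ℕ} {S : SystemOfFields.{u} 𝕜 n} (U : LocalRelation S)
  {X₁ X₂ X : BMfd n} (J : BMfd.DisjointUnion X₁ X₂ X) (c₁ : S.Fld 1 X₁.Z) (c₂ : S.Fld 1 X₂.Z)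
  {p q k : ℕ} (h : p + q = k)

/-- The juxtaposition of families of fields. -/
noncomputable def juxtFamily : ((Fin p → Set X₁.X) →₀ S.Fiber X₁.bdry c₁) →ₗ[𝕜]
    ((Fin q → Set X₂.X) →₀ S.Fiber X₂.bdry c₂) →ₗ[𝕜]
      BlobModule U X (S.union J.sumBdry c₁ c₂) k :=
  (TensorProduct.mk 𝕜 _ _).compr₂
    ((Finsupp.lsum 𝕜 fun γ : (Fin p → Set X₁.X) × (Fin q → Set X₂.X) =>
      projClass U X (S.union J.sumBdry c₁ c₂) (J.blobs h γ.1 γ.2) ∘ₗ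
        (S.fiberUnion J c₁ c₂).toLinearMap) ∘ₗ
      (finsuppTensorFinsupp 𝕜 𝕜 (S.Fiber X₁.bdry c₁) (S.Fiber X₂.bdry c₂) _ _).toLinearMap)

theorem juxtFamily_single (α : Fin p → Set X₁.X) (β : Fin q → Set X₂.X)
    (x : S.Fiber X₁.bdry c₁) (y : S.Fiber X₂.bdry c₂) :
    juxtFamily U J c₁ c₂ h (Finsupp.single α x) (Finsupp.single β y) =
      projClass U X _ (J.blobs h α β) (S.fiberUnion J c₁ c₂ (x ⊗ₜ y)) := by
  simp [juxtFamily]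

/-- Permuting the first configuration is a block permutation of the juxtaposition, with the same
sign. -/
theorem juxtFamily_left {f : (Fin p → Set X₁.X) →₀ S.Fiber X₁.bdry c₁}
    (hf : f ∈ permutationRelations U X₁ c₁ p) : juxtFamily U J c₁ c₂ h f = 0 := by
  suffices hle : permutationRelations U X₁ c₁ p ≤ LinearMap.ker (juxtFamily U J c₁ c₂ h) from hle hf
  refine Submodule.span_le.2 ?_
  rintro _ ⟨σ, α, x, -, rfl⟩
  refine LinearMap.mem_ker.2 (Finsupp.lhom_ext fun β y => ?_)
  rw [map_sub, map_smul, LinearMap.sub_apply, LinearMap.smul_apply, juxtFamily_single,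
    juxtFamily_single, LinearMap.zero_apply, sub_eq_zero]
  have hb := J.blobs_comp_blockPerm h (α := α) (β := β) σ 1
  rw [show β ∘ ((1 : Equiv.Perm (Fin q)) : Fin q → Fin q) = β from rfl] at hb
  rw [← hb, projClass_comp_perm, sign_blockPerm, Equiv.Perm.sign_one, mul_one,
    LinearMap.smul_apply]

theorem juxtFamily_right {g : (Fin q → Set X₂.X) →₀ S.Fiber X₂.bdry c₂}
    (hg : g ∈ permutationRelations U X₂ c₂ q) : (juxtFamily U J c₁ c₂ h).flip g = 0 := by
  suffices hle : permutationRelations U X₂ c₂ q ≤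
    LinearMap.ker (juxtFamily U J c₁ c₂ h).flip from hle hg
  refine Submodule.span_le.2 ?_
  rintro _ ⟨σ, β, y, -, rfl⟩
  refine LinearMap.mem_ker.2 (Finsupp.lhom_ext fun α x => ?_)
  rw [map_sub, map_smul, LinearMap.sub_apply, LinearMap.smul_apply, LinearMap.flip_apply,
    LinearMap.flip_apply, juxtFamily_single, juxtFamily_single, LinearMap.zero_apply, sub_eq_zero]
  have hb := J.blobs_comp_blockPerm h (α := α) (β := β) 1 σ
  rw [show α ∘ ((1 : Equiv.Perm (Fin p)) : Fin p → Fin p) = α from rfl] at hb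
  rw [← hb, projClass_comp_perm, sign_blockPerm, Equiv.Perm.sign_one, one_mul,
    LinearMap.smul_apply]

/-- The juxtaposition of elements of blob complexes. -/
noncomputable def juxt : BlobModule U X₁ c₁ p ⊗[𝕜] BlobModule U X₂ c₂ q →ₗ[𝕜]
    BlobModule U X (S.union J.sumBdry c₁ c₂) k :=
  Submodule.tensorLiftQ _ _ ((juxtFamily U J c₁ c₂ h).domRestrict₁₂ (orderedBlobs U X₁ c₁ p)
    (orderedBlobs U X₂ c₂ q))
    (fun _ hf g => LinearMap.congr_fun (juxtFamily_left U J c₁ c₂ h hf) g.1)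
    (fun _ hg f => LinearMap.congr_fun (juxtFamily_right U J c₁ c₂ h hg) f.1)

variable {c₁ c₂}

theorem juxt_blobClass {α : Fin p → Set X₁.X} {β : Fin q → Set X₂.X} {x : S.Fiber X₁.bdry c₁}
    {y : S.Fiber X₂.bdry c₂} (hx : x ∈ blobSpace U X₁ c₁ α) (hy : y ∈ blobSpace U X₂ c₂ β) :
    juxt U J c₁ c₂ h (blobClass U X₁ c₁ α x hx ⊗ₜ blobClass U X₂ c₂ β y hy) =
      blobClass U X _ (J.blobs h α β) (S.fiberUnion J c₁ c₂ (x ⊗ₜ y))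
        (fiberUnion_mem_blobSpace U J h hx hy) :=
  (juxtFamily_single U J c₁ c₂ h α β x y).trans
    (projClass_of_mem U (fiberUnion_mem_blobSpace U J h hx hy))

/-- Every class is a combination of juxtapositions. -/
theorem BlobModule.eq_top_of_juxt_mem {E : Submodule 𝕜 (BlobModule U X (S.union J.sumBdry c₁ c₂) k)}
    (hE : ∀ (p q : ℕ) (h : p + q = k) y, juxt U J c₁ c₂ h y ∈ E) : E = ⊤ := by
  refine Submodule.eq_top_iff'.2 (BlobModule.mem_of_blobClass_mem U E fun γ x _ hx => ?_)
  obtain ⟨p, q, h, σ, α, β, hσ⟩ :=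
    BMfd.DisjointUnion.exists_sorting J fun i => IsBlobDiagram.subset_range U J hx i
  have hx' := IsBlobDiagram.comp_perm U hx σ
  rw [hσ] at hx'
  have hle : Submodule.span 𝕜 {z | ∃ (x₁ : S.Fiber X₁.bdry c₁) (x₂ : S.Fiber X₂.bdry c₂),
      IsBlobDiagram U α x₁.1 ∧ IsBlobDiagram U β x₂.1 ∧
        z = S.fiberUnion J c₁ c₂ (x₁ ⊗ₜ x₂)} ≤ E.comap (projClass U X _ (J.blobs h α β)) := by
    refine Submodule.span_le.2 ?_
    rintro _ ⟨x₁, x₂, h₁, h₂, rfl⟩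
    have h₁' : x₁ ∈ blobSpace U X₁ c₁ α := Submodule.subset_span h₁
    have h₂' : x₂ ∈ blobSpace U X₂ c₂ β := Submodule.subset_span h₂
    change projClass U X _ _ _ ∈ E
    rw [projClass_of_mem U (fiberUnion_mem_blobSpace U J h h₁' h₂'), ← juxt_blobClass U J h h₁' h₂']
    exact hE p q h _
  have hmem : projClass U X _ (J.blobs h α β) x ∈ E :=
    hle (IsBlobDiagram.mem_span_fiberUnion U J h hx')
  -- The sorted class differs from the original one by the sign of `σ`, which is its own inverse.
  rw [← hσ, projClass_comp_perm, LinearMap.smul_apply] at hmem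
  rw [← projClass_of_mem]
  have hs : ((Equiv.Perm.sign σ : ℤ) : 𝕜) * ((Equiv.Perm.sign σ : ℤ) : 𝕜) = 1 := by
    rw [← Int.cast_mul, Int.units_coe_mul_self, Int.cast_one]
  have := E.smul_mem ((Equiv.Perm.sign σ : ℤ) : 𝕜) hmem
  rwa [smul_smul, hs, one_smul] at this

/-! ### The inverse of juxtaposition -/

variable (c₁ c₂)

/-- The contribution of a sorted configuration to the inverse of juxtaposition. -/
noncomputable def unjuxtTerm (σ : Equiv.Perm (Fin k)) (α : Fin p → Set X₁.X)
    (β : Fin q → Set X₂.X) : S.Fiber X.bdry (S.union J.sumBdry c₁ c₂) →ₗ[𝕜]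
      BlobModule U X₁ c₁ p ⊗[𝕜] BlobModule U X₂ c₂ q :=
  ((Equiv.Perm.sign σ : ℤ) : 𝕜) •
    (TensorProduct.map (projClass U X₁ c₁ α) (projClass U X₂ c₂ β) ∘ₗ
      (S.fiberUnion J c₁ c₂).symm.toLinearMap)

/-- Two sortings differ by permutations of the blocks. Their signs enter twice, once through the
sign of the sorting and once through the classes of the two factors, and cancel. -/
theorem unjuxtTerm_eq {γ : Fin k → Set X.X} {σ σ' : Equiv.Perm (Fin k)} {α α' : Fin p → Set X₁.X}
    {β β' : Fin q → Set X₂.X} (hγ : J.IsSorting h γ σ α β) (hγ' : J.IsSorting h γ σ' α' β') :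
    unjuxtTerm U J c₁ c₂ σ' α' β' = unjuxtTerm U J c₁ c₂ σ α β := by
  obtain ⟨τ₁, τ₂, rfl, rfl, rfl⟩ := hγ.exists_blockPerm hγ'
  have hs : ∀ {m : ℕ} (τ : Equiv.Perm (Fin m)),
      ((Equiv.Perm.sign τ : ℤ) : 𝕜) * ((Equiv.Perm.sign τ : ℤ) : 𝕜) = 1 := fun τ => by
    rw [← Int.cast_mul, Int.units_coe_mul_self, Int.cast_one]
  rw [unjuxtTerm, unjuxtTerm, projClass_comp_perm, projClass_comp_perm, TensorProduct.map_smul_left,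
    TensorProduct.map_smul_right, LinearMap.smul_comp, LinearMap.smul_comp, smul_smul, smul_smul,
    Equiv.Perm.sign_mul, sign_blockPerm]
  congr 1
  push_cast
  linear_combination ((Equiv.Perm.sign σ : ℤ) : 𝕜) * ((Equiv.Perm.sign τ₂ : ℤ) : 𝕜) *
    ((Equiv.Perm.sign τ₂ : ℤ) : 𝕜) * hs τ₁ + ((Equiv.Perm.sign σ : ℤ) : 𝕜) * hs τ₂

open Classical in
/-- The inverse of juxtaposition on fields with a given configuration of blobs. -/
noncomputable def unjuxtCoeff (γ : Fin k → Set X.X) :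
    S.Fiber X.bdry (S.union J.sumBdry c₁ c₂) →ₗ[𝕜]
      BlobModule U X₁ c₁ p ⊗[𝕜] BlobModule U X₂ c₂ q :=
  if hγ : ∃ s : Equiv.Perm (Fin k) × (Fin p → Set X₁.X) × (Fin q → Set X₂.X),
    J.IsSorting h γ s.1 s.2.1 s.2.2 then
    unjuxtTerm U J c₁ c₂ hγ.choose.1 hγ.choose.2.1 hγ.choose.2.2 else 0

theorem unjuxtCoeff_of_isSorting {γ : Fin k → Set X.X} {σ : Equiv.Perm (Fin k)}
    {α : Fin p → Set X₁.X} {β : Fin q → Set X₂.X} (hγ : J.IsSorting h γ σ α β) :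
    unjuxtCoeff U J c₁ c₂ h γ = unjuxtTerm U J c₁ c₂ σ α β := by
  have hex : ∃ s : Equiv.Perm (Fin k) × (Fin p → Set X₁.X) × (Fin q → Set X₂.X),
    J.IsSorting h γ s.1 s.2.1 s.2.2 := ⟨(σ, α, β), hγ⟩
  rw [unjuxtCoeff, dif_pos hex]
  exact unjuxtTerm_eq U J c₁ c₂ h hγ hex.choose_spec

theorem unjuxtCoeff_of_not {γ : Fin k → Set X.X}
    (hγ : ∀ σ (α : Fin p → Set X₁.X) (β : Fin q → Set X₂.X), ¬ J.IsSorting h γ σ α β) :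
    unjuxtCoeff U J c₁ c₂ h γ = 0 :=
  dif_neg fun ⟨_, hs⟩ => hγ _ _ _ hs

/-- If `σ` sorts `γ`, then `τ⁻¹ * σ` sorts `γ ∘ τ` into the same pair of configurations, so only the
sign of `τ` is left. This is the compatibility needed to pass to the quotient. -/
theorem unjuxtCoeff_comp (γ : Fin k → Set X.X) (τ : Equiv.Perm (Fin k)) :
    unjuxtCoeff U J c₁ c₂ h (γ ∘ τ) =
      ((Equiv.Perm.sign τ : ℤ) : 𝕜) • unjuxtCoeff U J c₁ c₂ h γ := by
  by_cases hγ : ∃ (σ : Equiv.Perm (Fin k)) (α : Fin p → Set X₁.X) (β : Fin q → Set X₂.X),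
      J.IsSorting h γ σ α β
  · obtain ⟨σ, α, β, hγ⟩ := hγ
    rw [unjuxtCoeff_of_isSorting U J c₁ c₂ h hγ,
      unjuxtCoeff_of_isSorting U J c₁ c₂ h (hγ.comp τ), unjuxtTerm, unjuxtTerm, smul_smul,
      Equiv.Perm.sign_mul, Equiv.Perm.sign_inv]
    push_cast
    rfl
  · push Not at hγ
    rw [unjuxtCoeff_of_not U J c₁ c₂ h hγ, unjuxtCoeff_of_not U J c₁ c₂ h, smul_zero]
    intro σ α β hσ
    have := hσ.comp τ⁻¹
    rw [show (γ ∘ τ) ∘ (τ⁻¹ : Equiv.Perm (Fin k)) = γ from funext fun i => by simp] at this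
    exact hγ _ α β this

/-- The inverse of juxtaposition. -/
noncomputable def unjuxt : BlobModule U X (S.union J.sumBdry c₁ c₂) k →ₗ[𝕜]
    BlobModule U X₁ c₁ p ⊗[𝕜] BlobModule U X₂ c₂ q :=
  Submodule.liftQ _ ((Finsupp.lsum 𝕜 (unjuxtCoeff U J c₁ c₂ h)) ∘ₗ Submodule.subtype _) (by
    rw [LinearMap.ker_comp]
    refine Submodule.comap_mono (Submodule.span_le.2 ?_)
    rintro _ ⟨σ, γ, x, -, rfl⟩
    refine LinearMap.mem_ker.2 ?_
    rw [map_sub, map_smul, Finsupp.lsum_single, Finsupp.lsum_single, unjuxtCoeff_comp,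
      LinearMap.smul_apply, sub_self])

variable {c₁ c₂}

theorem unjuxt_blobClass {γ : Fin k → Set X.X} {x : S.Fiber X.bdry (S.union J.sumBdry c₁ c₂)}
    (hx : x ∈ blobSpace U X (S.union J.sumBdry c₁ c₂) γ) :
    unjuxt U J c₁ c₂ h (blobClass U X _ γ x hx) = unjuxtCoeff U J c₁ c₂ h γ x :=
  Finsupp.lsum_single 𝕜 (unjuxtCoeff U J c₁ c₂ h) γ x

theorem isSorting_blobs {α : Fin p → Set X₁.X} {β : Fin q → Set X₂.X} {x : S.Fld 0 X₁.X}
    {y : S.Fld 0 X₂.X} (hx : IsBlobDiagram U α x) (hy : IsBlobDiagram U β y) :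
    J.IsSorting h (J.blobs h α β) 1 α β :=
  ⟨rfl, IsBlobDiagram.nonempty U hx, IsBlobDiagram.nonempty U hy⟩

theorem unjuxt_juxt : unjuxt U J c₁ c₂ h ∘ₗ juxt U J c₁ c₂ h = LinearMap.id :=
  BlobModule.tensor_hom_ext U fun α x hx β y hy hx' hy' => by
    rw [LinearMap.comp_apply, juxt_blobClass, unjuxt_blobClass,
      unjuxtCoeff_of_isSorting U J c₁ c₂ h (isSorting_blobs U J h hx' hy')]
    simp only [unjuxtTerm, Equiv.Perm.sign_one, Units.val_one, Int.cast_one, one_smul,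
      LinearMap.comp_apply, LinearEquiv.coe_coe, LinearEquiv.symm_apply_apply,
      TensorProduct.map_tmul, LinearMap.id_apply]
    rw [projClass_of_mem U hx, projClass_of_mem U hy]

/-- A configuration with `p'` blobs in the first part admits no sorting with `p` of them there, and
the coefficient then has its default value zero. -/
theorem unjuxt_juxt_of_ne {p' q' : ℕ} (h' : p' + q' = k) (hp : p ≠ p') :
    unjuxt U J c₁ c₂ h ∘ₗ juxt U J c₁ c₂ h' = 0 :=
  BlobModule.tensor_hom_ext U fun α x hx β y hy hx' hy' => by
    rw [LinearMap.comp_apply, juxt_blobClass, unjuxt_blobClass, unjuxtCoeff_of_not]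
    · rfl
    · exact fun σ α' β' hs => hp (hs.eq_left (isSorting_blobs U J h' hx' hy'))

/-! ### Juxtaposition and the differential -/

theorem BMfd.DisjointUnion.blobs_succAbove_inl (h : p + 1 + q = k + 1) (h' : p + q = k)
    (α : Fin (p + 1) → Set X₁.X) (β : Fin q → Set X₂.X) (i : Fin (p + 1)) :
    J.blobs h α β ∘ (finSumEquiv h (Sum.inl i)).succAbove =
      J.blobs h' (α ∘ i.succAbove) β := by
  refine funext ((forall_fin_iff h').2 ⟨fun j => ?_, fun j => ?_⟩)
  · have : (finSumEquiv h (Sum.inl i)).succAbove (finSumEquiv h' (Sum.inl j)) =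
        finSumEquiv h (Sum.inl (i.succAbove j)) := Fin.ext <| by
      simp only [Fin.succAbove, Fin.lt_def, Fin.val_castSucc, finSumEquiv_inl_val]
      split_ifs <;> simp [finSumEquiv_inl_val]
    rw [Function.comp_apply, this, blobs_inl, blobs_inl, Function.comp_apply]
  · have : (finSumEquiv h (Sum.inl i)).succAbove (finSumEquiv h' (Sum.inr j)) =
        finSumEquiv h (Sum.inr j) := Fin.ext <| by
      have := i.2
      simp only [Fin.succAbove, Fin.lt_def, Fin.val_castSucc, finSumEquiv_inl_val,
        finSumEquiv_inr_val]
      rw [if_neg (by omega), Fin.val_succ, finSumEquiv_inr_val]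
      omega
    rw [Function.comp_apply, this, blobs_inr, blobs_inr]

theorem BMfd.DisjointUnion.blobs_succAbove_inr (h : p + (q + 1) = k + 1) (h' : p + q = k)
    (α : Fin p → Set X₁.X) (β : Fin (q + 1) → Set X₂.X) (i : Fin (q + 1)) :
    J.blobs h α β ∘ (finSumEquiv h (Sum.inr i)).succAbove =
      J.blobs h' α (β ∘ i.succAbove) := by
  refine funext ((forall_fin_iff h').2 ⟨fun j => ?_, fun j => ?_⟩)
  · have : (finSumEquiv h (Sum.inr i)).succAbove (finSumEquiv h' (Sum.inl j)) =
        finSumEquiv h (Sum.inl j) := Fin.ext <| by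
      have := j.2
      simp only [Fin.succAbove, Fin.lt_def, Fin.val_castSucc, finSumEquiv_inl_val,
        finSumEquiv_inr_val]
      rw [if_pos (by omega), Fin.val_castSucc, finSumEquiv_inl_val]
    rw [Function.comp_apply, this, blobs_inl, blobs_inl]
  · have : (finSumEquiv h (Sum.inr i)).succAbove (finSumEquiv h' (Sum.inr j)) =
        finSumEquiv h (Sum.inr (i.succAbove j)) := Fin.ext <| by
      simp only [Fin.succAbove, Fin.lt_def, Fin.val_castSucc, finSumEquiv_inr_val]
      split_ifs <;> simp [finSumEquiv_inr_val] <;> omega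
    rw [Function.comp_apply, this, blobs_inr, blobs_inr, Function.comp_apply]

theorem sum_fin_eq {M : Type*} [AddCommMonoid M] (f : Fin k → M) :
    ∑ i, f i = ∑ i, f (finSumEquiv h (Sum.inl i)) + ∑ i, f (finSumEquiv h (Sum.inr i)) := by
  rw [← (finSumEquiv h).sum_comp, Fintype.sum_sum_type]

section

variable {α : Fin p → Set X₁.X} {β : Fin q → Set X₂.X} {x : S.Fiber X₁.bdry c₁}
    {y : S.Fiber X₂.bdry c₂}

theorem sum_forget_left {p : ℕ} {α : Fin (p + 1) → Set X₁.X} (h : p + 1 + q = k + 1)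
    (h' : p + q = k) (hx : x ∈ blobSpace U X₁ c₁ α) (hy : y ∈ blobSpace U X₂ c₂ β) :
    ∑ i : Fin (p + 1), ((-1 : 𝕜) ^ (finSumEquiv h (Sum.inl i) : ℕ)) •
      blobClass U X _ (J.blobs h α β ∘ (finSumEquiv h (Sum.inl i)).succAbove)
        (S.fiberUnion J c₁ c₂ (x ⊗ₜ y))
        (blobSpace_forget U (fiberUnion_mem_blobSpace U J h hx hy) _) =
      juxt U J c₁ c₂ h' (blobD U X₁ c₁ p (blobClass U X₁ c₁ α x hx) ⊗ₜ
        blobClass U X₂ c₂ β y hy) := by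
  rw [blobD_blobClass, TensorProduct.sum_tmul, map_sum]
  refine Finset.sum_congr rfl fun i _ => ?_
  rw [← TensorProduct.smul_tmul', map_smul, juxt_blobClass, finSumEquiv_inl_val]
  exact congrArg _ (blobClass_congr U (J.blobs_succAbove_inl h h' α β i) rfl _ _)

/-- The blob with index `i` in the second block has index `p + i` in the juxtaposition; the shift by
`p` produces the Koszul sign. -/
theorem sum_forget_right {q : ℕ} {β : Fin (q + 1) → Set X₂.X} (h : p + (q + 1) = k + 1)
    (h' : p + q = k) (hx : x ∈ blobSpace U X₁ c₁ α) (hy : y ∈ blobSpace U X₂ c₂ β) :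
    ∑ i : Fin (q + 1), ((-1 : 𝕜) ^ (finSumEquiv h (Sum.inr i) : ℕ)) •
      blobClass U X _ (J.blobs h α β ∘ (finSumEquiv h (Sum.inr i)).succAbove)
        (S.fiberUnion J c₁ c₂ (x ⊗ₜ y))
        (blobSpace_forget U (fiberUnion_mem_blobSpace U J h hx hy) _) =
      (-1 : 𝕜) ^ p • juxt U J c₁ c₂ h' (blobClass U X₁ c₁ α x hx ⊗ₜ
        blobD U X₂ c₂ q (blobClass U X₂ c₂ β y hy)) := by
  rw [blobD_blobClass, TensorProduct.tmul_sum, map_sum, Finset.smul_sum]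
  refine Finset.sum_congr rfl fun i _ => ?_
  rw [TensorProduct.tmul_smul, map_smul, juxt_blobClass, finSumEquiv_inr_val, smul_smul, pow_add]
  exact congrArg _ (blobClass_congr U (J.blobs_succAbove_inr h h' α β i) rfl _ _)

end

/-- The alternating sum over all blobs separates into the sums over the two blocks. Factors of
degree zero have no blobs to forget and are treated separately below. -/
theorem blobD_juxt {p q : ℕ} (h : p + 1 + (q + 1) = k + 1) (h₁ : p + (q + 1) = k)
    (h₂ : p + 1 + q = k) :
    blobD U X (S.union J.sumBdry c₁ c₂) k ∘ₗ juxt U J c₁ c₂ h =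
      juxt U J c₁ c₂ h₁ ∘ₗ (blobD U X₁ c₁ p).rTensor _ +
        (-1 : 𝕜) ^ (p + 1) • juxt U J c₁ c₂ h₂ ∘ₗ (blobD U X₂ c₂ q).lTensor _ :=
  BlobModule.tensor_hom_ext U fun α x hx β y hy _ _ => by
    rw [LinearMap.comp_apply, juxt_blobClass, blobD_blobClass, sum_fin_eq h,
      sum_forget_left U J h h₁ hx hy, sum_forget_right U J h h₂ hx hy]
    simp

theorem blobD_juxt_zero_left {q : ℕ} (h : 0 + (q + 1) = k + 1) (h' : 0 + q = k) :
    blobD U X (S.union J.sumBdry c₁ c₂) k ∘ₗ juxt U J c₁ c₂ h =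
      juxt U J c₁ c₂ h' ∘ₗ (blobD U X₂ c₂ q).lTensor _ :=
  BlobModule.tensor_hom_ext U fun α x hx β y hy _ _ => by
    rw [LinearMap.comp_apply, juxt_blobClass, blobD_blobClass, sum_fin_eq h,
      sum_forget_right U J h h' hx hy]
    simp

theorem blobD_juxt_zero_right {p : ℕ} (h : p + 1 + 0 = k + 1) (h' : p + 0 = k) :
    blobD U X (S.union J.sumBdry c₁ c₂) k ∘ₗ juxt U J c₁ c₂ h =
      juxt U J c₁ c₂ h' ∘ₗ (blobD U X₁ c₁ p).rTensor _ :=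
  BlobModule.tensor_hom_ext U fun α x hx β y hy _ _ => by
    rw [LinearMap.comp_apply, juxt_blobClass, blobD_blobClass, sum_fin_eq h,
      sum_forget_left U J h h' hx hy]
    simp

end Blob

/-! ## Morphisms from a tensor product of chain complexes -/

/-- Signs act on linear maps as they act on morphisms of modules. -/
theorem ModuleCat.neg_one_pow_smul_hom {R : Type u} [CommRing R] {M N : ModuleCat.{u} R} (m : ℕ)
    (f : M ⟶ N) : (-1 : R) ^ m • f.hom = ((-1 : ℤˣ) ^ m • f).hom := by
  rcases Nat.even_or_odd m with hm | hm
  · rw [hm.neg_one_pow, hm.neg_one_pow, one_smul, one_smul]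
  · rw [hm.neg_one_pow, hm.neg_one_pow, neg_one_smul, Units.neg_smul, one_smul,
      ModuleCat.hom_neg]

section TensorObj

open MonoidalCategory HomologicalComplex

variable {R : Type u} [CommRing R] {K L M : ChainComplex (ModuleCat.{u} R) ℕ}

/-- The chain map from a tensor product of chain complexes given by compatible maps on the
summands. -/
noncomputable def ChainComplex.tensorObjDesc
    (φ : ∀ {p q k : ℕ}, p + q = k → (K.X p ⊗ L.X q ⟶ M.X k))
    (hd : ∀ {p q k : ℕ} (h : p + 1 + (q + 1) = k + 1) (h₁ : p + (q + 1) = k)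
      (h₂ : p + 1 + q = k), φ h ≫ M.d (k + 1) k = K.d (p + 1) p ▷ L.X (q + 1) ≫ φ h₁ +
        (-1 : ℤˣ) ^ (p + 1) • K.X (p + 1) ◁ L.d (q + 1) q ≫ φ h₂)
    (hl : ∀ {q k : ℕ} (h : 0 + (q + 1) = k + 1) (h' : 0 + q = k),
      φ h ≫ M.d (k + 1) k = K.X 0 ◁ L.d (q + 1) q ≫ φ h')
    (hr : ∀ {p k : ℕ} (h : p + 1 + 0 = k + 1) (h' : p + 0 = k),
      φ h ≫ M.d (k + 1) k = K.d (p + 1) p ▷ L.X 0 ≫ φ h') :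
    HomologicalComplex.tensorObj K L ⟶ M where
  f k := mapBifunctorDesc fun _ _ h => φ h
  comm' := by
    rintro _ k rfl
    refine mapBifunctor.hom_ext fun p q h => ?_
    rw [ι_mapBifunctorDesc_assoc, mapBifunctor.d_eq, Preadditive.add_comp, Preadditive.comp_add,
      mapBifunctor.ι_D₁_assoc, mapBifunctor.ι_D₂_assoc]
    have h : p + q = k + 1 := h
    -- Degree `0` has no successor, so the corresponding half of the total differential vanishes.
    have hz : ¬ (ComplexShape.down ℕ).Rel 0 ((ComplexShape.down ℕ).next 0) := by simp
    have hrel (i : ℕ) : (ComplexShape.down ℕ).Rel (i + 1) i := rfl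
    rcases p with _ | p <;> rcases q with _ | q
    · omega
    · have h' : 0 + q = k := by omega
      rw [mapBifunctor.d₁_eq_zero _ _ _ _ _ _ _ hz, Limits.zero_comp, zero_add,
        mapBifunctor.d₂_eq _ _ _ _ _ (hrel q) _ h', hl h h']
      rw [Linear.units_smul_comp, Category.assoc, ι_mapBifunctorDesc]
      exact (one_smul ℤˣ _).symm
    · have h' : p + 0 = k := by omega
      rw [mapBifunctor.d₂_eq_zero _ _ _ _ _ _ _ hz, Limits.zero_comp, add_zero,
        mapBifunctor.d₁_eq _ _ _ _ (hrel p) _ _ h', hr h h']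
      rw [Linear.units_smul_comp, Category.assoc, ι_mapBifunctorDesc]
      exact (one_smul ℤˣ _).symm
    · have h₁ : p + (q + 1) = k := by omega
      have h₂ : p + 1 + q = k := by omega
      rw [mapBifunctor.d₁_eq _ _ _ _ (hrel p) _ _ h₁, mapBifunctor.d₂_eq _ _ _ _ _ (hrel q) _ h₂,
        hd h h₁ h₂]
      rw [Linear.units_smul_comp, Linear.units_smul_comp, Category.assoc, Category.assoc,
        ι_mapBifunctorDesc, ι_mapBifunctorDesc]
      exact congrArg (· + _) (one_smul ℤˣ _).symm

theorem ChainComplex.ι_tensorObjDesc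
    (φ : ∀ {p q k : ℕ}, p + q = k → (K.X p ⊗ L.X q ⟶ M.X k)) (hd hl hr) {p q k : ℕ}
    (h : p + q = k) : ιTensorObj K L p q k h ≫ (ChainComplex.tensorObjDesc φ hd hl hr).f k = φ h :=
  ι_mapBifunctorDesc (K₁ := K) (K₂ := L) (F := curriedTensor _) (c := ComplexShape.down ℕ)
    (A := M.X k) (fun _ _ h => φ h) p q h

/-- In each degree the inverse is the sum over `p + q = k` of `ψ` followed by the inclusion of the
summand. The relations between `φ` and `ψ` give one composite; the other is the identity because it
agrees with it after every `φ`, and the `φ` are jointly epimorphic by `hφ`. -/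
theorem ChainComplex.isIso_of_desc {f : HomologicalComplex.tensorObj K L ⟶ M}
    (φ : ∀ {p q k : ℕ}, p + q = k → (K.X p ⊗ L.X q ⟶ M.X k))
    (hf : ∀ {p q k : ℕ} (h : p + q = k), ιTensorObj K L p q k h ≫ f.f k = φ h)
    (ψ : ∀ {p q k : ℕ}, p + q = k → (M.X k ⟶ K.X p ⊗ L.X q))
    (hψ : ∀ {p q k : ℕ} (h : p + q = k), φ h ≫ ψ h = 𝟙 _)
    (hne : ∀ {p q p' q' k : ℕ} (h : p + q = k) (h' : p' + q' = k), p' ≠ p → φ h ≫ ψ h' = 0)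
    (hφ : ∀ {k : ℕ} {A : ModuleCat.{u} R} {g g' : M.X k ⟶ A},
      (∀ {p q : ℕ} (h : p + q = k), φ h ≫ g = φ h ≫ g') → g = g') : IsIso f := by
  have key {p q k : ℕ} (h : p + q = k) :
      φ h ≫ ∑ x : Finset.HasAntidiagonal.antidiagonal k, ψ (Finset.HasAntidiagonal.mem_antidiagonal.1 x.2) ≫
        ιTensorObj K L x.1.1 x.1.2 k (Finset.HasAntidiagonal.mem_antidiagonal.1 x.2) = ιTensorObj K L p q k h := by
    rw [Preadditive.comp_sum,
      Finset.sum_eq_single ⟨(p, q), Finset.HasAntidiagonal.mem_antidiagonal.2 h⟩, ← Category.assoc, hψ]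
    · exact Category.id_comp _
    · rintro ⟨⟨p', q'⟩, hx⟩ - hxne
      have hx' := Finset.HasAntidiagonal.mem_antidiagonal.1 hx
      rw [← Category.assoc, hne h hx', Limits.zero_comp]
      rintro rfl
      obtain rfl : q' = q := by omega
      exact hxne rfl
    · simp
  have hiso (k : ℕ) : IsIso (f.f k) := by
    refine ⟨∑ x : Finset.HasAntidiagonal.antidiagonal k, ψ (Finset.HasAntidiagonal.mem_antidiagonal.1 x.2) ≫
        ιTensorObj K L x.1.1 x.1.2 k (Finset.HasAntidiagonal.mem_antidiagonal.1 x.2), ?_, ?_⟩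
    · refine mapBifunctor.hom_ext fun p q h => ?_
      rw [← Category.assoc, hf h, key h]
      exact (Category.comp_id _).symm
    · refine hφ fun h => ?_
      rw [← Category.assoc, key h, hf h]
      exact (Category.comp_id _).symm
  exact HomologicalComplex.Hom.isIso_of_components f

end TensorObj

/-! ## The isomorphism -/

section Blob

open MonoidalCategory HomologicalComplex

variable {𝕜 : Type u} [Field 𝕜] {n : ℕ} {S : SystemOfFields.{u} 𝕜 n} (U : LocalRelation S)
  {X₁ X₂ X : BMfd n} (J : BMfd.DisjointUnion X₁ X₂ X) (c₁ : S.Fld 1 X₁.Z) (c₂ : S.Fld 1 X₂.Z)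

/-- Juxtaposition as a morphism between the terms of the blob complexes. -/
noncomputable def juxtHom {p q k : ℕ} (h : p + q = k) :
    (blobComplex U X₁ c₁).X p ⊗ (blobComplex U X₂ c₂).X q ⟶
      (blobComplex U X (S.union J.sumBdry c₁ c₂)).X k :=
  ModuleCat.ofHom (juxt U J c₁ c₂ h)

/-- Juxtaposition as a chain map. -/
noncomputable def juxtChainMap :
    HomologicalComplex.tensorObj (blobComplex U X₁ c₁) (blobComplex U X₂ c₂) ⟶
      blobComplex U X (S.union J.sumBdry c₁ c₂) :=
  ChainComplex.tensorObjDesc (juxtHom U J c₁ c₂)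
    (fun {p q k} h h₁ h₂ => by
      rw [blobComplex_d, blobComplex_d, blobComplex_d]
      refine ModuleCat.hom_ext ((blobD_juxt U J h h₁ h₂).trans ?_)
      exact congrArg (_ + ·) (ModuleCat.neg_one_pow_smul_hom (p + 1)
        ((blobComplex U X₁ c₁).X (p + 1) ◁ ModuleCat.ofHom (blobD U X₂ c₂ q) ≫
          juxtHom U J c₁ c₂ h₂)))
    (fun h h' => by
      rw [blobComplex_d, blobComplex_d]
      exact ModuleCat.hom_ext (blobD_juxt_zero_left U J h h'))
    (fun h h' => by
      rw [blobComplex_d, blobComplex_d]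
      exact ModuleCat.hom_ext (blobD_juxt_zero_right U J h h'))

theorem ι_juxtChainMap {p q k : ℕ} (h : p + q = k) :
    ιTensorObj (blobComplex U X₁ c₁) (blobComplex U X₂ c₂) p q k h ≫
      (juxtChainMap U J c₁ c₂).f k = juxtHom U J c₁ c₂ h :=
  ChainComplex.ι_tensorObjDesc _ _ _ _ h

theorem isIso_juxtChainMap : IsIso (juxtChainMap U J c₁ c₂) :=
  ChainComplex.isIso_of_desc (juxtHom U J c₁ c₂) (ι_juxtChainMap U J c₁ c₂)
    (fun h => ModuleCat.ofHom (unjuxt U J c₁ c₂ h))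
    (fun h => ModuleCat.hom_ext (unjuxt_juxt U J h))
    (fun h h' hne => ModuleCat.hom_ext (unjuxt_juxt_of_ne U J h' h hne))
    -- Two morphisms which agree on juxtapositions are equal because juxtapositions span.
    (fun {k A g g'} hg => by
      let a : BlobModule U X (S.union J.sumBdry c₁ c₂) k →ₗ[𝕜] A := g.hom
      let b : BlobModule U X (S.union J.sumBdry c₁ c₂) k →ₗ[𝕜] A := g'.hom
      have hE := BlobModule.eq_top_of_juxt_mem U J (E := LinearMap.eqLocus a b)
        fun p q h y => LinearMap.congr_fun (congrArg ModuleCat.Hom.hom (hg h)) y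
      exact ModuleCat.hom_ext (LinearMap.eqLocus_eq_top.1 hE : a = b))

variable {c₁ c₂}

theorem blobModuleMap_blobClass {X X' : BMfd n} (F : X.Homeo X') {c : S.Fld 1 X.Z}
    {c' : S.Fld 1 X'.Z} (hc : S.map F.g c = c') {k : ℕ} {β : Fin k → Set X.X}
    {x : S.Fiber X.bdry c} (hx : x ∈ blobSpace U X c β) :
    blobModuleMap U F hc k (blobClass U X c β x hx) =
      blobClass U X' c' (fun i => F.f '' β i) (fiberMap F hc x)
        (fiberMap_mem_blobSpace U F hc hx) :=
  congrArg Submodule.Quotient.mk (Subtype.ext (familyMap_single F hc k β x))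

/-- Compatibility of the boundary homeomorphisms with the disjoint unions need not be assumed: it
follows from that of the homeomorphisms, since the inclusion of the boundary is injective. -/
theorem BMfd.DisjointUnion.map_union {X₁' X₂' X' : BMfd n} (J' : BMfd.DisjointUnion X₁' X₂' X')
    {F₁ : X₁.Homeo X₁'} {F₂ : X₂.Homeo X₂'} {F : X.Homeo X'}
    (hl : ∀ x, F.f (J.sum.inl x) = J'.sum.inl (F₁.f x))
    (hr : ∀ x, F.f (J.sum.inr x) = J'.sum.inr (F₂.f x)) (c₁ : S.Fld 1 X₁.Z) (c₂ : S.Fld 1 X₂.Z) :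
    S.map F.g (S.union J.sumBdry c₁ c₂) =
      S.union J'.sumBdry (S.map F₁.g c₁) (S.map F₂.g c₂) :=
  S.map_union J.sumBdry J'.sumBdry F₁.g F₂.g F.g
    (fun z => X'.bdry.injective <| by
      rw [← F.comm, J.inl_comm, hl, F₁.comm, ← J'.inl_comm])
    (fun z => X'.bdry.injective <| by
      rw [← F.comm, J.inr_comm, hr, F₂.comm, ← J'.inr_comm]) c₁ c₂

theorem blobModuleMap_juxt {X₁' X₂' X' : BMfd n} (J' : BMfd.DisjointUnion X₁' X₂' X')
    {F₁ : X₁.Homeo X₁'} {F₂ : X₂.Homeo X₂'} {F : X.Homeo X'}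
    (hl : ∀ x, F.f (J.sum.inl x) = J'.sum.inl (F₁.f x))
    (hr : ∀ x, F.f (J.sum.inr x) = J'.sum.inr (F₂.f x)) {c₁' : S.Fld 1 X₁'.Z}
    {c₂' : S.Fld 1 X₂'.Z} (h₁ : S.map F₁.g c₁ = c₁') (h₂ : S.map F₂.g c₂ = c₂')
    (h : S.map F.g (S.union J.sumBdry c₁ c₂) = S.union J'.sumBdry c₁' c₂') {p q k : ℕ}
    (hk : p + q = k) :
    blobModuleMap U F h k ∘ₗ juxt U J c₁ c₂ hk = juxt U J' c₁' c₂' hk ∘ₗ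
      TensorProduct.map (blobModuleMap U F₁ h₁ p) (blobModuleMap U F₂ h₂ q) :=
  BlobModule.tensor_hom_ext U fun α x hx β y hy _ _ => by
    rw [LinearMap.comp_apply, LinearMap.comp_apply, TensorProduct.map_tmul, juxt_blobClass,
      blobModuleMap_blobClass, blobModuleMap_blobClass, blobModuleMap_blobClass, juxt_blobClass]
    refine blobClass_congr U (funext ((forall_fin_iff hk).2 ⟨fun i => ?_, fun i => ?_⟩))
      (Subtype.ext ?_) _ _
    · rw [J.blobs_inl, J'.blobs_inl, Set.image_image, Set.image_image]
      exact Set.image_congr fun z _ => hl z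
    · rw [J.blobs_inr, J'.blobs_inr, Set.image_image, Set.image_image]
      exact Set.image_congr fun z _ => hr z
    · rw [fiberMap_val, S.fiberUnion_tmul, S.fiberUnion_tmul, fiberMap_val, fiberMap_val]
      exact S.map_union J.sum J'.sum F₁.f F₂.f F.f hl hr x.1 y.1

theorem juxtChainMap_naturality {X₁' X₂' X' : BMfd n} (J' : BMfd.DisjointUnion X₁' X₂' X')
    {F₁ : X₁.Homeo X₁'} {F₂ : X₂.Homeo X₂'} {F : X.Homeo X'}
    (hl : ∀ x, F.f (J.sum.inl x) = J'.sum.inl (F₁.f x))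
    (hr : ∀ x, F.f (J.sum.inr x) = J'.sum.inr (F₂.f x)) {c₁' : S.Fld 1 X₁'.Z}
    {c₂' : S.Fld 1 X₂'.Z} (h₁ : S.map F₁.g c₁ = c₁') (h₂ : S.map F₂.g c₂ = c₂')
    (h : S.map F.g (S.union J.sumBdry c₁ c₂) = S.union J'.sumBdry c₁' c₂') :
    juxtChainMap U J c₁ c₂ ≫ blobMap U F h =
      HomologicalComplex.tensorHom (blobMap U F₁ h₁) (blobMap U F₂ h₂) ≫
        juxtChainMap U J' c₁' c₂' := by
  refine HomologicalComplex.hom_ext _ _ fun k => mapBifunctor.hom_ext fun p q hk => ?_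
  rw [HomologicalComplex.comp_f, HomologicalComplex.comp_f, ι_mapBifunctorMap_assoc,
    ← Category.assoc]
  erw [ι_juxtChainMap U J c₁ c₂ hk, ι_juxtChainMap U J' c₁' c₂' hk]
  refine ModuleCat.hom_ext ((blobModuleMap_juxt U J J' hl hr h₁ h₂ h hk).trans ?_)
  -- The tensor product of the two chain maps is the composite of two one-sided tensor products.
  exact congrArg (juxt U J' c₁' c₂' hk ∘ₗ ·) (LinearMap.lTensor_comp_rTensor _ _ _).symm

theorem BMfd.DisjointUnion.blobs_eq_append {p q : ℕ} (α : Fin p → Set X₁.X)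
    (β : Fin q → Set X₂.X) : J.blobs rfl α β =
      Fin.append (fun i => J.sum.inl '' α i) (fun i => J.sum.inr '' β i) := by
  refine funext ((forall_fin_iff rfl).2 ⟨fun i => ?_, fun i => ?_⟩)
  · rw [J.blobs_inl, show finSumEquiv rfl (Sum.inl i) = Fin.castAdd q i from
      Fin.ext (finSumEquiv_inl_val _ i), Fin.append_left]
  · rw [J.blobs_inr, show finSumEquiv rfl (Sum.inr i) = Fin.natAdd p i from
      Fin.ext (finSumEquiv_inr_val _ i), Fin.append_right]

end Blob

theorem mainTheorem10 {𝕜 : Type u} [Field 𝕜] {n : ℕ} (S : SystemOfFields.{u} 𝕜 n)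
    (U : LocalRelation S) :
    ∃ Φ : ∀ {X₁ X₂ X : BMfd n} (J : BMfd.DisjointUnion X₁ X₂ X)
        (c₁ : S.Fld 1 X₁.Z) (c₂ : S.Fld 1 X₂.Z),
        HomologicalComplex.tensorObj (blobComplex U X₁ c₁) (blobComplex U X₂ c₂) ≅
          blobComplex U X (S.union J.sumBdry c₁ c₂),
      -- naturality
      (∀ {X₁ X₂ X X₁' X₂' X' : BMfd n} (J : BMfd.DisjointUnion X₁ X₂ X)
        (J' : BMfd.DisjointUnion X₁' X₂' X')
        (F₁ : X₁.Homeo X₁') (F₂ : X₂.Homeo X₂') (F : X.Homeo X'),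
        (∀ x, F.f (J.sum.inl x) = J'.sum.inl (F₁.f x)) →
        (∀ x, F.f (J.sum.inr x) = J'.sum.inr (F₂.f x)) →
        ∀ (c₁ : S.Fld 1 X₁.Z) (c₂ : S.Fld 1 X₂.Z) (c₁' : S.Fld 1 X₁'.Z) (c₂' : S.Fld 1 X₂'.Z)
          (h₁ : S.map F₁.g c₁ = c₁') (h₂ : S.map F₂.g c₂ = c₂'),
          ∃ h : S.map F.g (S.union J.sumBdry c₁ c₂) = S.union J'.sumBdry c₁' c₂',
            (Φ J c₁ c₂).hom ≫ blobMap U F h =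
              HomologicalComplex.tensorHom (blobMap U F₁ h₁) (blobMap U F₂ h₂) ≫
                (Φ J' c₁' c₂').hom) ∧
      -- the isomorphism is given by juxtaposition of blob diagrams
      (∀ {X₁ X₂ X : BMfd n} (J : BMfd.DisjointUnion X₁ X₂ X)
        (c₁ : S.Fld 1 X₁.Z) (c₂ : S.Fld 1 X₂.Z) (k₁ k₂ : ℕ)
        (β₁ : Fin k₁ → Set X₁.X) (β₂ : Fin k₂ → Set X₂.X)
        (x₁ : S.Fiber X₁.bdry c₁) (x₂ : S.Fiber X₂.bdry c₂)
        (hx₁ : x₁ ∈ blobSpace U X₁ c₁ β₁) (hx₂ : x₂ ∈ blobSpace U X₂ c₂ β₂)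
        (x : S.Fiber X.bdry (S.union J.sumBdry c₁ c₂)), x.1 = S.union J.sum x₁.1 x₂.1 →
        ∃ hx : x ∈ blobSpace U X (S.union J.sumBdry c₁ c₂)
            (Fin.append (fun i => J.sum.inl '' β₁ i) (fun i => J.sum.inr '' β₂ i)),
          ModuleCat.Hom.hom
            (HomologicalComplex.ιTensorObj (blobComplex U X₁ c₁) (blobComplex U X₂ c₂)
              k₁ k₂ (k₁ + k₂) rfl ≫ (Φ J c₁ c₂).hom.f (k₁ + k₂))
            (blobClass U X₁ c₁ β₁ x₁ hx₁ ⊗ₜ[𝕜] blobClass U X₂ c₂ β₂ x₂ hx₂) =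
          blobClass U X (S.union J.sumBdry c₁ c₂) _ x hx) := by
  have hiso := fun {X₁ X₂ X : BMfd n} (J : BMfd.DisjointUnion X₁ X₂ X) (c₁ : S.Fld 1 X₁.Z)
    (c₂ : S.Fld 1 X₂.Z) => isIso_juxtChainMap U J c₁ c₂
  refine ⟨fun J c₁ c₂ => asIso (juxtChainMap U J c₁ c₂), ?_, ?_⟩
  · intro X₁ X₂ X X₁' X₂' X' J J' F₁ F₂ F hl hr c₁ c₂ c₁' c₂' h₁ h₂
    have h : S.map F.g (S.union J.sumBdry c₁ c₂) = S.union J'.sumBdry c₁' c₂' := by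
      rw [← h₁, ← h₂]
      exact J.map_union J' hl hr c₁ c₂
    exact ⟨h, juxtChainMap_naturality U J J' hl hr h₁ h₂ h⟩
  · intro X₁ X₂ X J c₁ c₂ p q α β x y hx hy z hz
    have hz' : S.fiberUnion J c₁ c₂ (x ⊗ₜ y) = z :=
      Subtype.ext ((S.fiberUnion_tmul J x y).trans hz.symm)
    have hmem := fiberUnion_mem_blobSpace U J rfl hx hy
    rw [hz', J.blobs_eq_append] at hmem
    refine ⟨hmem, ?_⟩
    refine (LinearMap.congr_fun (congrArg ModuleCat.Hom.hom (ι_juxtChainMap U J c₁ c₂ rfl))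
      _).trans ((juxt_blobClass U J rfl hx hy).trans ?_)
    exact blobClass_congr U (J.blobs_eq_append α β) hz' _ _
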